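/- On $\mathbb R^4$ with coordinates $z=(q_1,q_2,p_1,p_2)$ let $P=\begin{pmatrix}0&I\\-I&0\end{pmatrix}$ be the canonical Poisson tensor. Let $U$ be a connected non-empty open subset of the $q$-plane, and consider on $U\times\mathbb R^2$ skew-symmetric tensors $$P'=\begin{pmatrix}0&h(q)&c_1p_1+c_2p_2&c_3p_1+c_4p_2\\ *&0&c_5p_1+c_6p_2&c_7p_1+c_8p_2\\ *&*&0&f(q)\\ *&*&*&0\end{pmatrix},\qquad c_k\in\mathbb R\ \text{not all zero},$$ together with functions $H_1=p_1^2+p_2^2+V(q_1,q_2)$ and $H_2=H_2(q,p)$, where $h,f,V,H_2$ are smooth. Put $N=P'P^{-1}$, let $N^*=N^{T}$ be its adjoint acting on differentials, let $\sigma_1,\sigma_2$ be defined by $\det(x-N)=(x^2-\sigma_1x-\sigma_2)^2$, and let $F=\begin{pmatrix}\sigma_1&1\\ \sigma_2&0\end{pmatrix}$. A solution is a tuple $(U,P',V,H_2)$ such that $P+\lambda P'$ (for all $\lambda\in\mathbb R$) and $P'$ satisfy the Jacobi identity and $N^*dH_j=\sum_{k}F_{jk}\,dH_k$ for $j=1,2$.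 It is nontrivial if $H_1,H_2$ are in involution and functionally independent (their differentials are linearly independent on a dense set) and $V$ is not constant on $U$. Two solutions are called equivalent if they are related by a canonical affine point transformation $q\mapsto Aq+d$, $p\mapsto (A^{T})^{-1}p$ with $A$ invertible, multiplication of $P'$ and $H_1$ by nonzero constants (and of $H_2$ by their product), and addition of constants to $H_1$ and $H_2$. Then, for every nontrivial solution, $H_2$ is a polynomial of degree three in the momenta, and up to equivalence there are exactly four types of nontrivial solutions, namely (with arbitrary real constants $b,C_1,C_2$ for which $V$ is not constant on $U$): 1. (periodic Toda lattice with three particles, of type $\mathcal A_3$ in the paper's notation, in the centre-of-mass frame) $P'=\begin{pmatrix}0&-2&p_2&3p_1\\ *&0&p_1&p_2\\ *&*&0&b\,e^{q_1}\\ *&*&*&0\end{pmatrix}$, $V=-\frac{2b}{3}e^{q_1}+C_1e^{-\frac{q_1}{2}+\frac{\sqrt3q_2}{2}}+C_2e^{-\frac{q_1}{2}-\frac{\sqrt3q_2}{2}}$; 2. (Holt system, $q_1>0$) $P'=\begin{pmatrix}0&q_1&-\frac23p_2&0\\ *&0&\frac13p_1&-\frac23p_2\\ *&*&0&b\,q_1^{1/3}\\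 *&*&*&0\end{pmatrix}$, $V=\dfrac{b(3q_1^2+4q_2^2)+C_1q_2+C_2}{4q_1^{2/3}}$; 3. (Calogero type, $q_1\ne0$ unless $C_2=0$) $P'=\begin{pmatrix}0&q_1&0&0\\ *&0&p_1&-2p_2\\ *&*&0&b\,q_1\\ *&*&*&0\end{pmatrix}$, $V=b\left(\dfrac{q_1^2}{4}+q_2^2\right)+C_1q_2+\dfrac{C_2}{q_1^2}$; 4. (Calogero type, $q_1\ne0$ unless $b=0$) $P'=\begin{pmatrix}0&q_1&0&4p_1\\ *&0&p_1&2p_2\\ *&*&0&\dfrac{b}{q_1^3}\\ *&*&*&0\end{pmatrix}$, $V=\dfrac{b}{4q_1^2}+C_1\left(q_2^2+\dfrac{q_1^2}{4}\right)+C_2q_2$. That is: over every connected non-empty open $U$ in the indicated region on which $V$ is not constant, each of these $(P',V)$ admits an $H_2$, of degree three in the momenta, making it a nontrivial solution; every nontrivial solution is equivalent to one of these; and nontrivial solutions of different types are not equivalent. -/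

import Mathlib

open scoped ContDiff Matrix

namespace BiHam

/-- The configuration plane, with coordinates `q₁ = q 0`, `q₂ = q 1`. -/
abbrev Plane := Fin 2 → ℝ

/-- The phase space, with coordinates `z = (q₁, q₂, p₁, p₂)`. -/
abbrev Phase := Fin 4 → ℝ

def position (z : Phase) : Plane := ![z 0, z 1]

def momentum (z : Phase) : Plane := ![z 2, z 3]

def join (q p : Plane) : Phase := ![q 0, q 1, p 0, p 1]

/-- The coordinates `∂g/∂z_i` of the differential `dg`. -/
noncomputable def grad (g : Phase → ℝ) (z : Phase) : Fin 4 → ℝ :=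
  fun i => fderiv ℝ g z (Pi.single i 1)

/-- The canonical Poisson tensor. -/
def canonicalP : Matrix (Fin 4) (Fin 4) ℝ :=
  !![ 0,  0, 1, 0;
      0,  0, 0, 1;
     -1,  0, 0, 0;
      0, -1, 0, 0]

/-- The Jacobi identity, in coordinates and at the points of `D`, for the bivector `T`. -/
def JacobiOn (D : Set Phase) (T : Phase → Matrix (Fin 4) (Fin 4) ℝ) : Prop :=
  ∀ z ∈ D, ∀ i j k : Fin 4,
    ∑ m : Fin 4, (T z i m * grad (fun w => T w j k) z m
      + T z j m * grad (fun w => T w k i) z m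
      + T z k m * grad (fun w => T w i j) z m) = 0

/-- The recursion operator `N = P' P⁻¹` of a second tensor `P'`. Its adjoint, acting on
differentials, is the transposed matrix. -/
noncomputable def recursionOp (T : Matrix (Fin 4) (Fin 4) ℝ) : Matrix (Fin 4) (Fin 4) ℝ :=
  T * canonicalP⁻¹

/-- The control matrix of Veronese type for two degrees of freedom. -/
def controlMatrix (s₁ s₂ : ℝ) : Matrix (Fin 2) (Fin 2) ℝ :=
  !![s₁, 1;
     s₂, 0]

/-- The polynomial `Δ(x) = x² - s₁ x - s₂`. -/
noncomputable def minimalPoly (s₁ s₂ : ℝ) : Polynomial ℝ :=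
  Polynomial.X ^ 2 - Polynomial.C s₁ * Polynomial.X - Polynomial.C s₂

/-- The unknowns: a domain `U` of the plane, the coefficients `c₁, …, c₈` (here `c 0, …, c 7`) and
functions `h`, `f` of the linear tensor `P'`, the potential `V` and the second integral `H₂`.
Only the values over `U` matter. -/
structure Data where
  U : Set Plane
  c : Fin 8 → ℝ
  h : Plane → ℝ
  f : Plane → ℝ
  V : Plane → ℝ
  H₂ : Phase → ℝ

namespace Data

variable (S : Data)

/-- The part `U × ℝ²` of the phase space. -/
def phaseDomain : Set Phase := {z | position z ∈ S.U}

/-- The second tensor, linear in the momenta. -/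
def P' (z : Phase) : Matrix (Fin 4) (Fin 4) ℝ :=
  let p₁ := z 2
  let p₂ := z 3
  let a := S.h (position z)
  let b₁₁ := S.c 0 * p₁ + S.c 1 * p₂
  let b₁₂ := S.c 2 * p₁ + S.c 3 * p₂
  let b₂₁ := S.c 4 * p₁ + S.c 5 * p₂
  let b₂₂ := S.c 6 * p₁ + S.c 7 * p₂
  let e := S.f (position z)
  !![   0,    a,  b₁₁,  b₁₂;
       -a,    0,  b₂₁,  b₂₂;
     -b₁₁, -b₂₁,    0,    e;
     -b₁₂, -b₂₂,   -e,    0]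

/-- The natural Hamiltonian. -/
def H₁ (z : Phase) : ℝ := z 2 ^ 2 + z 3 ^ 2 + S.V (position z)

def H : Fin 2 → Phase → ℝ := ![S.H₁, S.H₂]

/-- `N* dH_j = ∑ k, F_{jk} dH_k`, where `F` is built from the coefficients `σ₁, σ₂` of the
polynomial `Δ(x) = x² - σ₁ x - σ₂` with `Δ(x)² = det (x - N)`. -/
def NijenhuisChain : Prop :=
  ∀ z ∈ S.phaseDomain, ∃ s₁ s₂ : ℝ,
    (recursionOp (S.P' z)).charpoly = minimalPoly s₁ s₂ ^ 2 ∧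
    ∀ j : Fin 2, (recursionOp (S.P' z))ᵀ *ᵥ grad (S.H j) z
      = ∑ k : Fin 2, controlMatrix s₁ s₂ j k • grad (S.H k) z

/-- The functions are smooth on a domain, `P'` is a Poisson tensor compatible with the canonical
one, and `H₁, H₂` form a Nijenhuis chain with the Veronese type control matrix. -/
structure IsSolution : Prop where
  isOpen : IsOpen S.U
  isConnected : IsConnected S.U
  smooth_h : ContDiffOn ℝ ∞ S.h S.U
  smooth_f : ContDiffOn ℝ ∞ S.f S.U
  smooth_V : ContDiffOn ℝ ∞ S.V S.U
  smooth_H₂ : ContDiffOn ℝ ∞ S.H₂ S.phaseDomain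
  jacobi : JacobiOn S.phaseDomain S.P'
  compatible : ∀ l : ℝ, JacobiOn S.phaseDomain (fun z => canonicalP + l • S.P' z)
  chain : S.NijenhuisChain

/-- Nontrivial solutions: `H₁, H₂` are in involution, their differentials are linearly independent
on a dense subset of the phase space, and the potential is not constant. -/
structure IsNontrivialSolution : Prop extends S.IsSolution where
  involution : ∀ z ∈ S.phaseDomain, grad S.H₁ z ⬝ᵥ canonicalP *ᵥ grad S.H₂ z = 0
  independent : ∀ W : Set Phase, IsOpen W → W.Nonempty → W ⊆ S.phaseDomain →
    ∃ z ∈ W, LinearIndependent ℝ ![grad S.H₁ z, grad S.H₂ z]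
  not_const : ¬ ∃ k : ℝ, ∀ q ∈ S.U, S.V q = k

/-- Over every point of `U`, the second integral is a polynomial of degree exactly three in the
momenta. -/
def HasCubicIntegral : Prop :=
  ∀ q ∈ S.U, ∃ Q : MvPolynomial (Fin 2) ℝ, Q.totalDegree = 3 ∧
    ∀ p : Plane, S.H₂ (join q p) = MvPolynomial.eval p Q

end Data

/-- The canonical affine point transformation `(q, p) ↦ (A q + d, (Aᵀ)⁻¹ p)`. -/
noncomputable def pointTransform (A : Matrix (Fin 2) (Fin 2) ℝ) (d : Plane) (z : Phase) : Phase :=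
  join (A *ᵥ position z + d) ((Aᵀ)⁻¹ *ᵥ momentum z)

/-- The Jacobi matrix `∂ζ_i/∂z_j` of a transformation `ζ = Φ(z)`. -/
noncomputable def jacobian (Φ : Phase → Phase) (z : Phase) : Matrix (Fin 4) (Fin 4) ℝ :=
  Matrix.of fun i j => grad (fun w => Φ w i) z j

/-- Equivalence up to a canonical affine point transformation, the choice of the constant factors
in `P'` and `H₁` (with the factor in `H₂` that these impose), and additive constants in the
integrals, none of which the equations see. -/
def Equivalent (S T : Data) : Prop :=
  ∃ (A : Matrix (Fin 2) (Fin 2) ℝ) (d : Plane) (μ κ k₁ k₂ : ℝ),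
    IsUnit A.det ∧ μ ≠ 0 ∧ κ ≠ 0 ∧
    T.U = (fun q => A *ᵥ q + d) '' S.U ∧
    ∀ z ∈ S.phaseDomain,
      T.P' (pointTransform A d z)
        = μ • (jacobian (pointTransform A d) z * S.P' z * (jacobian (pointTransform A d) z)ᵀ) ∧
      T.H₁ (pointTransform A d z) = κ * S.H₁ z + k₁ ∧
      T.H₂ (pointTransform A d z) = κ * μ * S.H₂ z + k₂

/-- The four types of normal form. -/
inductive Kind
  | toda
  | holt
  | calogeroA
  | calogeroB

/-- A type of normal form together with the values of its constants. -/
structure NormalForm where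
  kind : Kind
  b : ℝ
  C₁ : ℝ
  C₂ : ℝ

namespace NormalForm

/-- The coefficients `c₁, …, c₈` of `P'`. -/
noncomputable def c (F : NormalForm) : Fin 8 → ℝ :=
  match F.kind with
  | .toda => ![0, 1, 3, 0, 1, 0, 0, 1]
  | .holt => ![0, -2 / 3, 0, 0, 1 / 3, 0, 0, -2 / 3]
  | .calogeroA => ![0, 0, 0, 0, 1, 0, 0, -2]
  | .calogeroB => ![0, 0, 4, 0, 1, 0, 0, 2]

/-- The entry `P'₁₂`. -/
def h (F : NormalForm) (q : Plane) : ℝ :=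
  match F.kind with
  | .toda => -2
  | .holt => q 0
  | .calogeroA => q 0
  | .calogeroB => q 0

/-- The entry `P'₃₄`. -/
noncomputable def f (F : NormalForm) (q : Plane) : ℝ :=
  match F.kind with
  | .toda => F.b * Real.exp (q 0)
  | .holt => F.b * q 0 ^ (1 / 3 : ℝ)
  | .calogeroA => F.b * q 0
  | .calogeroB => F.b / q 0 ^ 3

/-- The potential. -/
noncomputable def V (F : NormalForm) (q : Plane) : ℝ :=
  match F.kind with
  | .toda => -(2 * F.b / 3) * Real.exp (q 0)
      + F.C₁ * Real.exp (-(q 0) / 2 + Real.sqrt 3 * q 1 / 2)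
      + F.C₂ * Real.exp (-(q 0) / 2 - Real.sqrt 3 * q 1 / 2)
  | .holt => (F.b * (3 * q 0 ^ 2 + 4 * q 1 ^ 2) + F.C₁ * q 1 + F.C₂)
      / (4 * q 0 ^ (2 / 3 : ℝ))
  | .calogeroA => F.b * (q 0 ^ 2 / 4 + q 1 ^ 2) + F.C₁ * q 1 + F.C₂ / q 0 ^ 2
  | .calogeroB => F.b / (4 * q 0 ^ 2) + F.C₁ * (q 1 ^ 2 + q 0 ^ 2 / 4) + F.C₂ * q 1

/-- The set on which the formulas are used: the half-plane `q₁ > 0` for the fractional powers, and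
the complement of the singular line `q₁ = 0`, if it is singular, for the rational ones. -/
def domain (F : NormalForm) : Set Plane :=
  match F.kind with
  | .toda => Set.univ
  | .holt => {q | 0 < q 0}
  | .calogeroA => {q | q 0 ≠ 0 ∨ F.C₂ = 0}
  | .calogeroB => {q | q 0 ≠ 0 ∨ F.b = 0}

/-- The normal form over `U`, with a candidate `H₂` for the second integral. -/
noncomputable def toData (F : NormalForm) (U : Set Plane) (H₂ : Phase → ℝ) : Data where
  U := U
  c := F.c
  h := F.h
  f := F.f
  V := F.V
  H₂ := H₂

end NormalForm

end BiHam

/-! The geometry collapses to a system for `h`, `f`, `V` and the eight coefficients, which can then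
be normalized and integrated by hand. The Schouten bracket of `P` with `P'` fixes the gradient of
`h`, so `h` is affine. The bracket of `P'` with itself gives first-order equations for `f` and four
quadratic relations among the `c k`. The first chain equation expresses `dH₂` through first
derivatives of `V`. Closedness of this form gives two linear relations among the `c k` and the
complete set of second derivatives of `V`, each multiplied by `h`. This is `ReducedSystem`
(`reduced_of_solution`). Conversely, under these equations `cubicIntegral` is a primitive of the
form, so `H₂` equals it up to a constant. The second chain equation and involution are then
automatic. The cubic part of `H₂` vanishes only if `c = 0`.

Similarities of the plane preserve the kinetic energy up to a factor and act on reduced systems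
(`ReducedSystem.transport`); this action is an equivalence (`equivalent_of_transport`). If `h` is
not constant, a similarity turns it into `q 0`, and the algebraic relations leave three coefficient
vectors: Holt and the two Calogero types. If `h` is constant, nonconstancy of `V` forces `h ≠ 0`;
after the trace of the block `B` of `P'` is rotated onto `2 p₂` and `h` is scaled to `-2`, only the
Toda vector survives. For each vector the equations for `f` and `V` are integrated by integrating
factors. Care is needed on the line `q 0 = 0`, where the equations degenerate.

Types are separated by two entries of `P'`: `h`, which is multiplied by a constant under an
equivalence, and the trace of `B`, which transforms as a linear form in the momenta. -/

namespace BiHam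

/-- The partial derivative of a function on the plane. -/
noncomputable def pd (i : Fin 2) (g : Plane → ℝ) (q : Plane) : ℝ :=
  fderiv ℝ g q (Pi.single i 1)

/-! ### Derivatives on the plane and on phase space. -/

section Calculus

variable {E : Type*} [NormedAddCommGroup E] [NormedSpace ℝ E]

theorem contDiffOn_fderiv_apply {g : E → ℝ} {D : Set E} (hD : IsOpen D)
    (hg : ContDiffOn ℝ ∞ g D) (v : E) : ContDiffOn ℝ ∞ (fun w => fderiv ℝ g w v) D :=
  (hg.fderiv_of_isOpen hD (by simp)).clm_apply contDiffOn_const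

/-- Applied to `H₂` on phase space, this is the closedness of `dH₂`, the source of the second-order
equations for `V`. -/
theorem fderiv_fderiv_comm {g : E → ℝ} {D : Set E} (hD : IsOpen D)
    (hg : ContDiffOn ℝ ∞ g D) {z : E} (hz : z ∈ D) (u v : E) :
    fderiv ℝ (fun w => fderiv ℝ g w u) z v = fderiv ℝ (fun w => fderiv ℝ g w v) z u := by
  have hc : ContDiffAt ℝ ∞ g z := hg.contDiffAt (hD.mem_nhds hz)
  have hs : IsSymmSndFDerivAt ℝ g z := hc.isSymmSndFDerivAt (by
    rw [minSmoothness_of_isRCLikeNormedField]; exact WithTop.coe_le_coe.2 (le_top : (2 : ℕ∞) ≤ ⊤))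
  have hd : DifferentiableAt ℝ (fderiv ℝ g) z :=
    ((hg.fderiv_of_isOpen hD (m := ∞) (by simp)).contDiffAt (hD.mem_nhds hz)).differentiableAt
      (by simp)
  have key : ∀ a b : E, fderiv ℝ (fun w => fderiv ℝ g w a) z b = fderiv ℝ (fderiv ℝ g) z b a := by
    intro a b
    rw [fderiv_clm_apply hd (differentiableAt_const a)]
    simp
  rw [key, key]
  exact hs v u

theorem differentiableAt_of_contDiffOn {g : E → ℝ} {D : Set E} (hD : IsOpen D)
    (hg : ContDiffOn ℝ ∞ g D) {z : E} (hz : z ∈ D) : DifferentiableAt ℝ g z :=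
  (hg.contDiffAt (hD.mem_nhds hz)).differentiableAt (by simp)

end Calculus

section PlaneCalculus

variable {U : Set Plane} {g g' : Plane → ℝ} {q : Plane}

theorem contDiffOn_pd (hU : IsOpen U) (hg : ContDiffOn ℝ ∞ g U) (i : Fin 2) :
    ContDiffOn ℝ ∞ (pd i g) U :=
  contDiffOn_fderiv_apply hU hg _

theorem pd_comm (hU : IsOpen U) (hg : ContDiffOn ℝ ∞ g U) (hq : q ∈ U) (i j : Fin 2) :
    pd i (pd j g) q = pd j (pd i g) q :=
  fderiv_fderiv_comm hU hg hq _ _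

theorem pd_congr (hU : IsOpen U) (h : ∀ q ∈ U, g q = g' q) (hq : q ∈ U) (i : Fin 2) :
    pd i g q = pd i g' q := by
  have : g =ᶠ[nhds q] g' := Filter.eventuallyEq_of_mem (hU.mem_nhds hq) h
  rw [pd, pd, this.fderiv_eq]

theorem fderiv_eq_pd (g : Plane → ℝ) (q v : Plane) :
    fderiv ℝ g q v = v 0 * pd 0 g q + v 1 * pd 1 g q := by
  have : v = v 0 • (Pi.single 0 1 : Plane) + v 1 • (Pi.single 1 1 : Plane) := by
    ext i; fin_cases i <;> simp
  conv_lhs => rw [this]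
  simp [pd]

theorem HasFDerivAt.pd_eq {L : Plane →L[ℝ] ℝ} (h : HasFDerivAt g L q) (i : Fin 2) :
    pd i g q = L (Pi.single i 1) := by
  rw [pd, h.fderiv]

theorem pd_const (a : ℝ) (i : Fin 2) : pd i (fun _ => a) q = 0 := by
  simp [pd]

theorem pd_coord (i j : Fin 2) : pd i (fun q => q j) q = if i = j then 1 else 0 := by
  have : HasFDerivAt (fun q : Plane => q j) (ContinuousLinearMap.proj (R := ℝ) j) q :=
    (ContinuousLinearMap.proj (R := ℝ) (φ := fun _ : Fin 2 => ℝ) j).hasFDerivAt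
  rw [HasFDerivAt.pd_eq this]
  simp [Pi.single_apply, eq_comm]

theorem pd_add (hg : DifferentiableAt ℝ g q) (hg' : DifferentiableAt ℝ g' q) (i : Fin 2) :
    pd i (fun q => g q + g' q) q = pd i g q + pd i g' q := by
  simp only [pd]
  rw [fderiv_fun_add hg hg']
  rfl

theorem pd_mul (hg : DifferentiableAt ℝ g q) (hg' : DifferentiableAt ℝ g' q) (i : Fin 2) :
    pd i (fun q => g q * g' q) q = pd i g q * g' q + g q * pd i g' q := by
  simp only [pd]
  rw [fderiv_fun_mul hg hg']
  simp
  ring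

theorem pd_const_mul (hg : DifferentiableAt ℝ g q) (a : ℝ) (i : Fin 2) :
    pd i (fun q => a * g q) q = a * pd i g q := by
  rw [pd_mul (differentiableAt_const a) hg, pd_const]
  ring

/-- A function with vanishing gradient on a connected open set is constant there. -/
theorem exists_const_of_pd_eq_zero (hU : IsOpen U) (hc : IsConnected U)
    (hg : DifferentiableOn ℝ g U) (h0 : ∀ q ∈ U, pd 0 g q = 0) (h1 : ∀ q ∈ U, pd 1 g q = 0) :
    ∃ k, ∀ q ∈ U, g q = k := by
  refine hU.exists_is_const_of_fderiv_eq_zero hc.isPreconnected hg fun q hq => ?_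
  ext v
  simp [fderiv_eq_pd, h0 q hq, h1 q hq]

/-- A continuous function that vanishes off the line `q₁ = 0` vanishes. -/
theorem eq_zero_of_off_line (hU : IsOpen U) (hg : ContinuousOn g U)
    (h : ∀ q ∈ U, q 0 ≠ 0 → g q = 0) : ∀ q ∈ U, g q = 0 := by
  intro q hq
  by_cases h0 : q 0 = 0
  -- The horizontal line through `q` meets `q 0 = 0` only at parameter `0`, so the value at `q` is a
  -- limit of zeros.
  · obtain ⟨γ, hγ⟩ : ∃ γ : ℝ → Plane, γ = fun t => q + t • (Pi.single 0 1 : Plane) := ⟨_, rfl⟩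
    have hγc : ContinuousAt γ 0 := by rw [hγ]; fun_prop
    have hγ0 : γ 0 = q := by simp [hγ]
    have hnear : ∀ᶠ t in nhds (0 : ℝ), γ t ∈ U :=
      hγc.eventually_mem (by rw [hγ0]; exact hU.mem_nhds hq)
    have hlim : Filter.Tendsto (fun t => g (γ t)) (nhdsWithin 0 {0}ᶜ) (nhds (g q)) := by
      have hgq : ContinuousAt g (γ 0) := by
        rw [hγ0]; exact hg.continuousAt (hU.mem_nhds hq)
      have := (ContinuousAt.comp hgq hγc).tendsto
      simp only [Function.comp_def, hγ0] at this
      exact this.mono_left nhdsWithin_le_nhds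
    refine tendsto_nhds_unique hlim (tendsto_const_nhds.congr' ?_)
    filter_upwards [self_mem_nhdsWithin, nhdsWithin_le_nhds hnear] with t ht htU
    refine (h _ htU ?_).symm
    simpa [hγ, h0] using ht
  · exact h q hq h0

end PlaneCalculus

section PhaseCalculus

variable {g g' : Phase → ℝ} {z : Phase}

theorem grad_congr {D : Set Phase} (hD : IsOpen D) (h : ∀ w ∈ D, g w = g' w) (hz : z ∈ D) :
    grad g z = grad g' z := by
  have : g =ᶠ[nhds z] g' := Filter.eventuallyEq_of_mem (hD.mem_nhds hz) h
  ext i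
  rw [grad, grad, this.fderiv_eq]

theorem grad_const (a : ℝ) : grad (fun _ => a) z = 0 := by
  ext i; simp [grad]

theorem grad_add (hg : DifferentiableAt ℝ g z) (hg' : DifferentiableAt ℝ g' z) :
    grad (fun w => g w + g' w) z = grad g z + grad g' z := by
  ext i
  simp only [grad]
  rw [fderiv_fun_add hg hg']
  rfl

theorem grad_sub (hg : DifferentiableAt ℝ g z) (hg' : DifferentiableAt ℝ g' z) :
    grad (fun w => g w - g' w) z = grad g z - grad g' z := by
  ext i
  simp only [grad]
  rw [fderiv_fun_sub hg hg']
  rfl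

theorem grad_neg : grad (fun w => -g w) z = -grad g z := by
  ext i
  simp only [grad]
  rw [fderiv_fun_neg]
  rfl

theorem grad_mul (hg : DifferentiableAt ℝ g z) (hg' : DifferentiableAt ℝ g' z) :
    grad (fun w => g w * g' w) z = g' z • grad g z + g z • grad g' z := by
  ext i
  simp only [grad]
  rw [fderiv_fun_mul hg hg']
  simp [grad]
  ring

theorem grad_const_mul (a : ℝ) (hg : DifferentiableAt ℝ g z) :
    grad (fun w => a * g w) z = a • grad g z := by
  rw [grad_mul (differentiableAt_const a) hg, grad_const]
  simp

theorem grad_coord (j : Fin 4) : grad (fun w => w j) z = Pi.single j 1 := by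
  have : HasFDerivAt (fun w : Phase => w j) (ContinuousLinearMap.proj (R := ℝ) j) z :=
    (ContinuousLinearMap.proj (R := ℝ) (φ := fun _ : Fin 4 => ℝ) j).hasFDerivAt
  ext i
  rw [grad, this.fderiv]
  simp [Pi.single_apply, eq_comm]

theorem grad_pow (hg : DifferentiableAt ℝ g z) (n : ℕ) :
    grad (fun w => g w ^ n) z = (n * g z ^ (n - 1)) • grad g z := by
  have := (hasDerivAt_pow n (g z)).comp_hasFDerivAt z hg.hasFDerivAt
  ext i
  rw [grad]
  change fderiv ℝ ((fun x => x ^ n) ∘ g) z _ = _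
  rw [this.fderiv]
  simp [grad]

/-- `position` as a continuous linear map. -/
noncomputable def positionL : Phase →L[ℝ] Plane :=
  ContinuousLinearMap.pi ![ContinuousLinearMap.proj 0, ContinuousLinearMap.proj 1]

theorem positionL_apply (z : Phase) : positionL z = position z := by
  ext i; fin_cases i <;> simp [positionL, position]

theorem position_eq : position = positionL := by
  ext1 z; exact (positionL_apply z).symm

theorem continuous_position : Continuous position := by
  rw [position_eq]; exact positionL.continuous

theorem position_join (q p : Plane) : position (join q p) = q := by
  ext i; fin_cases i <;> simp [position, join]

variable {G : Plane → ℝ}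

theorem differentiableAt_comp_position (hG : DifferentiableAt ℝ G (position z)) :
    DifferentiableAt ℝ (fun w => G (position w)) z := by
  rw [position_eq] at *
  exact hG.comp z positionL.differentiableAt

theorem grad_comp_position (hG : DifferentiableAt ℝ G (position z)) :
    grad (fun w => G (position w)) z = ![pd 0 G (position z), pd 1 G (position z), 0, 0] := by
  have h : HasFDerivAt (fun w => G (position w)) ((fderiv ℝ G (position z)).comp positionL) z := by
    have h1 := hG.hasFDerivAt
    rw [← positionL_apply] at h1
    have := h1.comp z positionL.hasFDerivAt
    simpa [Function.comp_def, positionL_apply] using this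
  ext i
  rw [grad, h.fderiv]
  simp only [ContinuousLinearMap.comp_apply, positionL_apply, fderiv_eq_pd]
  fin_cases i <;> simp [position]

theorem grad_linear (a b : ℝ) : grad (fun w => a * w 2 + b * w 3) z = ![0, 0, a, b] := by
  rw [grad_add (by fun_prop) (by fun_prop), grad_const_mul _ (by fun_prop),
    grad_const_mul _ (by fun_prop), grad_coord, grad_coord]
  ext i; fin_cases i <;> simp

end PhaseCalculus

end BiHam

/-! ### The reduced system and the Schouten brackets. -/

namespace BiHam

/-- The algebraic equations for the coefficients `c₁, …, c₈`. -/
structure AlgebraicRelations (c : Fin 8 → ℝ) : Prop where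
  sym₁ : c 2 = c 7 + 2 * c 4
  sym₂ : c 5 = c 0 + 2 * c 3
  quad₁ : c 0 * c 1 + c 2 * c 5 - c 4 * (c 0 + c 6 - c 3) - c 6 * c 1 = 0
  quad₂ : c 1 ^ 2 + c 3 * c 5 - c 5 * (c 0 + c 6 - c 3) - c 7 * c 1 = 0
  quad₃ : c 0 * c 6 + c 2 * (c 7 - c 4 + c 1) - c 4 * c 2 - c 6 ^ 2 = 0
  quad₄ : c 1 * c 6 + c 3 * (c 7 - c 4 + c 1) - c 5 * c 2 - c 7 * c 6 = 0

/-- The differential equations for `h, f, V` to which the definition of a solution reduces. -/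
structure ReducedSystem (U : Set Plane) (c : Fin 8 → ℝ) (h f V : Plane → ℝ) : Prop where
  isOpen : IsOpen U
  isConnected : IsConnected U
  smooth_h : ContDiffOn ℝ ∞ h U
  smooth_f : ContDiffOn ℝ ∞ f U
  smooth_V : ContDiffOn ℝ ∞ V U
  algebraic : AlgebraicRelations c
  h₁ : ∀ q ∈ U, pd 0 h q = c 4 - c 1
  h₂ : ∀ q ∈ U, pd 1 h q = c 6 - c 3
  f₁ : ∀ q ∈ U, h q * pd 0 f q = -(c 4 + c 7) * f q
  f₂ : ∀ q ∈ U, h q * pd 1 f q = (c 0 + c 3) * f q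
  V₁₁ : ∀ q ∈ U, h q * pd 0 (pd 0 V) q
    = (c 7 - c 4 + c 1) * pd 0 V q - c 5 * pd 1 V q + 2 * f q
  V₁₂ : ∀ q ∈ U, h q * pd 0 (pd 1 V) q = -c 6 * pd 0 V q + c 1 * pd 1 V q
  V₂₂ : ∀ q ∈ U, h q * pd 1 (pd 1 V) q
    = c 2 * pd 0 V q + (c 3 - c 0 - c 6) * pd 1 V q + 2 * f q

/-- The cubic second integral. -/
noncomputable def cubicIntegral (c : Fin 8 → ℝ) (h V : Plane → ℝ) (z : Phase) : ℝ :=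
  -2 * (c 6 / 3 * z 2 ^ 3 - c 4 * z 2 ^ 2 * z 3 - c 3 * z 2 * z 3 ^ 2 + c 1 / 3 * z 3 ^ 3)
    + h (position z) * pd 1 V (position z) * z 2 - h (position z) * pd 0 V (position z) * z 3

theorem isOpen_position_preimage {U : Set Plane} (hU : IsOpen U) :
    IsOpen {z | position z ∈ U} :=
  hU.preimage continuous_position

theorem isConnected_position_preimage {U : Set Plane} (hU : IsConnected U) :
    IsConnected {z | position z ∈ U} := by
  have hj : Continuous fun x : Plane × Plane => join x.1 x.2 := by
    refine continuous_pi fun i => ?_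
    fin_cases i <;> simp [join] <;> fun_prop
  have := (hU.prod (isConnected_univ (α := Plane))).image _ hj.continuousOn
  convert this using 1
  ext z
  constructor
  · intro hz
    refine ⟨(position z, momentum z), ⟨hz, trivial⟩, ?_⟩
    ext i; fin_cases i <;> simp [join, position, momentum]
  · rintro ⟨⟨q, p⟩, ⟨hq, -⟩, rfl⟩
    simpa [position_join] using hq

/-- A function with vanishing differential on a connected open set is constant there. -/
theorem exists_const_of_grad_eq_zero {D : Set Phase} {g : Phase → ℝ} (hD : IsOpen D)
    (hc : IsConnected D) (hg : DifferentiableOn ℝ g D) (h0 : ∀ z ∈ D, grad g z = 0) :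
    ∃ k, ∀ z ∈ D, g z = k := by
  refine hD.exists_is_const_of_fderiv_eq_zero hc.isPreconnected hg fun z hz => ?_
  refine ContinuousLinearMap.coe_injective ((Pi.basisFun ℝ (Fin 4)).ext fun i => ?_)
  simpa [grad] using congrFun (h0 z hz) i

namespace Data

variable {S : Data}

/-- The differentials of the entries of `P'`. -/
noncomputable def gradP' (S : Data) (z : Phase) : Matrix (Fin 4) (Fin 4) (Fin 4 → ℝ) :=
  let a := ![pd 0 S.h (position z), pd 1 S.h (position z), 0, 0]
  let e := ![pd 0 S.f (position z), pd 1 S.f (position z), 0, 0]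
  !![0, a, ![0, 0, S.c 0, S.c 1], ![0, 0, S.c 2, S.c 3];
     -a, 0, ![0, 0, S.c 4, S.c 5], ![0, 0, S.c 6, S.c 7];
     -![0, 0, S.c 0, S.c 1], -![0, 0, S.c 4, S.c 5], 0, e;
     -![0, 0, S.c 2, S.c 3], -![0, 0, S.c 6, S.c 7], -e, 0]

theorem differentiableAt_P' {z : Phase} (hh : DifferentiableAt ℝ S.h (position z))
    (hf : DifferentiableAt ℝ S.f (position z)) (i j : Fin 4) :
    DifferentiableAt ℝ (fun w => S.P' w i j) z := by
  have h1 := differentiableAt_comp_position hh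
  have h2 := differentiableAt_comp_position hf
  fin_cases i <;> fin_cases j <;> simp [P'] <;>
    first
    | exact h1 | exact h2 | exact h1.neg | exact h2.neg | fun_prop

theorem grad_P' {z : Phase} (hh : DifferentiableAt ℝ S.h (position z))
    (hf : DifferentiableAt ℝ S.f (position z)) (i j : Fin 4) :
    grad (fun w => S.P' w i j) z = S.gradP' z i j := by
  fin_cases i <;> fin_cases j <;>
    simp only [P', gradP', Matrix.of_apply, Matrix.cons_val', Matrix.cons_val_zero,
      Matrix.cons_val_one, Matrix.cons_val, Fin.zero_eta, Fin.mk_one, Fin.reduceFinMk,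
      Fin.isValue, grad_const, grad_linear, grad_neg, grad_comp_position hh,
      grad_comp_position hf]

/-- The coordinates of the Schouten bracket of `P` with `P'`, on the left, and half of that of `P'`
with itself, on the right. -/
theorem jacobiator_pencil (S : Data) (z : Phase) (a l : ℝ) (i j k : Fin 4) :
    ∑ m, ((a • canonicalP + l • S.P' z) i m * (l • S.gradP' z j k) m
      + (a • canonicalP + l • S.P' z) j m * (l • S.gradP' z k i) m
      + (a • canonicalP + l • S.P' z) k m * (l • S.gradP' z i j) m)
    = a * l * ∑ m, (canonicalP i m * S.gradP' z j k m + canonicalP j m * S.gradP' z k i m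
        + canonicalP k m * S.gradP' z i j m)
      + l ^ 2 * ∑ m, (S.P' z i m * S.gradP' z j k m + S.P' z j m * S.gradP' z k i m
        + S.P' z k m * S.gradP' z i j m) := by
  simp only [Matrix.add_apply, Matrix.smul_apply, Pi.smul_apply, smul_eq_mul, Fin.sum_univ_four]
  ring

end Data
end BiHam

namespace BiHam
namespace Data

variable {S : Data}

theorem grad_pencil {z : Phase} (hh : DifferentiableAt ℝ S.h (position z))
    (hf : DifferentiableAt ℝ S.f (position z)) (l : ℝ) (i j : Fin 4) :
    grad (fun w => (canonicalP + l • S.P' w) i j) z = l • S.gradP' z i j := by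
  simp only [Matrix.add_apply, Matrix.smul_apply, smul_eq_mul]
  rw [grad_add (differentiableAt_const _) ((differentiableAt_P' hh hf i j).const_mul l),
    grad_const, zero_add, grad_const_mul _ (differentiableAt_P' hh hf i j), grad_P' hh hf]

/-- The coordinates of the Schouten bracket of `P` with `P'`. -/
noncomputable def schoutenMixed (S : Data) (z : Phase) (i j k : Fin 4) : ℝ :=
  ∑ m, (canonicalP i m * S.gradP' z j k m + canonicalP j m * S.gradP' z k i m
    + canonicalP k m * S.gradP' z i j m)

/-- Half of the coordinates of the Schouten bracket of `P'` with itself. -/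
noncomputable def schoutenSelf (S : Data) (z : Phase) (i j k : Fin 4) : ℝ :=
  ∑ m, (S.P' z i m * S.gradP' z j k m + S.P' z j m * S.gradP' z k i m
    + S.P' z k m * S.gradP' z i j m)

theorem jacobiOn_P' (hh : ∀ q ∈ S.U, DifferentiableAt ℝ S.h q)
    (hf : ∀ q ∈ S.U, DifferentiableAt ℝ S.f q) :
    JacobiOn S.phaseDomain S.P' ↔ ∀ z ∈ S.phaseDomain, ∀ i j k, S.schoutenSelf z i j k = 0 := by
  refine forall₂_congr fun z hz => ?_
  simp only [grad_P' (hh _ hz) (hf _ hz), schoutenSelf]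

theorem jacobiOn_pencil (hh : ∀ q ∈ S.U, DifferentiableAt ℝ S.h q)
    (hf : ∀ q ∈ S.U, DifferentiableAt ℝ S.f q) (l : ℝ) :
    JacobiOn S.phaseDomain (fun z => canonicalP + l • S.P' z) ↔
      ∀ z ∈ S.phaseDomain, ∀ i j k,
        l * S.schoutenMixed z i j k + l ^ 2 * S.schoutenSelf z i j k = 0 := by
  refine forall₂_congr fun z hz => forall₃_congr fun i j k => ?_
  simp only [grad_pencil (hh _ hz) (hf _ hz)]
  have := S.jacobiator_pencil z 1 l i j k
  simp only [one_smul, one_mul] at this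
  rw [this]
  rfl

/-- The Jacobi identity of the pencil is linear plus quadratic in the parameter. Once the quadratic
part vanishes by the Jacobi identity for `P'`, the single value `1` isolates the mixed bracket. -/
theorem schouten_of_solution (hS : S.IsSolution) {z : Phase} (hz : z ∈ S.phaseDomain)
    (i j k : Fin 4) : S.schoutenSelf z i j k = 0 ∧ S.schoutenMixed z i j k = 0 := by
  have hh : ∀ q ∈ S.U, DifferentiableAt ℝ S.h q := fun q hq =>
    differentiableAt_of_contDiffOn hS.isOpen hS.smooth_h hq
  have hf : ∀ q ∈ S.U, DifferentiableAt ℝ S.f q := fun q hq =>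
    differentiableAt_of_contDiffOn hS.isOpen hS.smooth_f hq
  have h1 := (jacobiOn_P' hh hf).1 hS.jacobi z hz i j k
  have h2 := (jacobiOn_pencil hh hf 1).1 (hS.compatible 1) z hz i j k
  rw [h1] at h2
  exact ⟨h1, by simpa using h2⟩

/-- Since `P` is constant, the mixed bracket sees only derivatives of the entries of `P'`: momentum
derivatives of `B` are balanced against position derivatives of `h`. -/
theorem h_of_solution (hS : S.IsSolution) {q : Plane} (hq : q ∈ S.U) :
    pd 0 S.h q = S.c 4 - S.c 1 ∧ pd 1 S.h q = S.c 6 - S.c 3 := by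
  have hz : join q 0 ∈ S.phaseDomain := by simpa [phaseDomain, position_join] using hq
  have h1 := (schouten_of_solution hS hz 0 1 2).2
  have h2 := (schouten_of_solution hS hz 0 1 3).2
  simp [schoutenMixed, Fin.sum_univ_four, gradP', canonicalP, position_join] at h1 h2
  constructor <;> linarith

theorem f_of_solution (hS : S.IsSolution) {q : Plane} (hq : q ∈ S.U) :
    S.h q * pd 0 S.f q = -(S.c 4 + S.c 7) * S.f q ∧
      S.h q * pd 1 S.f q = (S.c 0 + S.c 3) * S.f q := by
  have hz : join q 0 ∈ S.phaseDomain := by simpa [phaseDomain, position_join] using hq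
  have h1 := (schouten_of_solution hS hz 1 2 3).1
  have h2 := (schouten_of_solution hS hz 0 2 3).1
  simp [schoutenSelf, Fin.sum_univ_four, gradP', P', position_join] at h1 h2
  constructor <;> linarith

/-- With the gradient of `h` known, the components of the self-bracket with both position indices
are linear forms in the momenta. Evaluation at the two unit momenta reads off their four
coefficients. -/
theorem quad_of_solution (hS : S.IsSolution) {q : Plane} (hq : q ∈ S.U) :
    (S.c 0 * S.c 1 + S.c 2 * S.c 5 - S.c 4 * (S.c 0 + S.c 6 - S.c 3) - S.c 6 * S.c 1 = 0 ∧
    S.c 1 ^ 2 + S.c 3 * S.c 5 - S.c 5 * (S.c 0 + S.c 6 - S.c 3) - S.c 7 * S.c 1 = 0) ∧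
    S.c 0 * S.c 6 + S.c 2 * (S.c 7 - S.c 4 + S.c 1) - S.c 4 * S.c 2 - S.c 6 ^ 2 = 0 ∧
    S.c 1 * S.c 6 + S.c 3 * (S.c 7 - S.c 4 + S.c 1) - S.c 5 * S.c 2 - S.c 7 * S.c 6 = 0 := by
  have hz : ∀ p, join q p ∈ S.phaseDomain := fun p => by
    simpa [phaseDomain, position_join] using hq
  obtain ⟨e1, e2⟩ := h_of_solution hS hq
  have h1 := (schouten_of_solution hS (hz ![1, 0]) 0 1 2).1
  have h2 := (schouten_of_solution hS (hz ![0, 1]) 0 1 2).1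
  have h3 := (schouten_of_solution hS (hz ![1, 0]) 0 1 3).1
  have h4 := (schouten_of_solution hS (hz ![0, 1]) 0 1 3).1
  simp [schoutenSelf, Fin.sum_univ_four, gradP', P', position_join, e1, e2] at h1 h2 h3 h4
  simp [join] at h1 h2 h3 h4
  refine ⟨⟨?_, ?_⟩, ?_, ?_⟩ <;> linarith

theorem schoutenMixed_of_reduced (h : ReducedSystem S.U S.c S.h S.f S.V) {z : Phase}
    (hz : z ∈ S.phaseDomain) (i j k : Fin 4) : S.schoutenMixed z i j k = 0 := by
  have e1 := h.h₁ _ hz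
  have e2 := h.h₂ _ hz
  fin_cases i <;> fin_cases j <;> fin_cases k <;>
    simp [schoutenMixed, Fin.sum_univ_four, gradP', canonicalP, e1, e2] <;> ring

theorem schoutenSelf_of_reduced (h : ReducedSystem S.U S.c S.h S.f S.V) {z : Phase}
    (hz : z ∈ S.phaseDomain) (i j k : Fin 4) : S.schoutenSelf z i j k = 0 := by
  have e1 := h.h₁ _ hz
  have e2 := h.h₂ _ hz
  have e3 := h.f₁ _ hz
  have e4 := h.f₂ _ hz
  obtain ⟨-, -, q1, q2, q3, q4⟩ := h.algebraic
  -- The quadratic relations are recombined into the linear forms in the momenta that appear as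
  -- components of the self-bracket.
  have e5 : z 2 * (S.c 0 * S.c 1 + S.c 2 * S.c 5 - S.c 4 * (S.c 0 + S.c 6 - S.c 3)
      - S.c 6 * S.c 1) + z 3 * (S.c 1 ^ 2 + S.c 3 * S.c 5 - S.c 5 * (S.c 0 + S.c 6 - S.c 3)
      - S.c 7 * S.c 1) = 0 := by rw [q1, q2]; ring
  have e6 : z 2 * (S.c 0 * S.c 6 + S.c 2 * (S.c 7 - S.c 4 + S.c 1) - S.c 4 * S.c 2
      - S.c 6 ^ 2) + z 3 * (S.c 1 * S.c 6 + S.c 3 * (S.c 7 - S.c 4 + S.c 1) - S.c 5 * S.c 2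
      - S.c 7 * S.c 6) = 0 := by rw [q3, q4]; ring
  fin_cases i <;> fin_cases j <;> fin_cases k <;>
    simp [schoutenSelf, Fin.sum_univ_four, gradP', P', e1, e2] <;> linarith

end Data
end BiHam

/-! ### The recursion operator, the chain equations and involution. -/

namespace BiHam
namespace Data

variable {S : Data}

theorem canonicalP_inv : canonicalP⁻¹ = -canonicalP := by
  refine Matrix.inv_eq_right_inv ?_
  ext i j
  fin_cases i <;> fin_cases j <;> simp [canonicalP, Matrix.mul_apply, Fin.sum_univ_four]

/-- The coefficient `σ₁ = tr B` for the block `B` of `P'`. -/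
def sigma₁ (S : Data) (z : Phase) : ℝ := S.P' z 0 2 + S.P' z 1 3

/-- The coefficient `σ₂ = hf - det B` for the blocks of `P'`. -/
def sigma₂ (S : Data) (z : Phase) : ℝ :=
  S.P' z 0 1 * S.P' z 2 3 - (S.P' z 0 2 * S.P' z 1 3 - S.P' z 0 3 * S.P' z 1 2)

theorem recursionOp_P' (S : Data) (z : Phase) : recursionOp (S.P' z) =
    !![S.P' z 0 2, S.P' z 0 3, 0, -S.P' z 0 1;
       S.P' z 1 2, S.P' z 1 3, S.P' z 0 1, 0;
       0, S.P' z 2 3, S.P' z 0 2, S.P' z 1 2;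
       -S.P' z 2 3, 0, S.P' z 0 3, S.P' z 1 3] := by
  rw [recursionOp, canonicalP_inv]
  ext i j
  fin_cases i <;> fin_cases j <;> simp [canonicalP, Matrix.mul_apply, Fin.sum_univ_four, P']

/-- Up to the factor `det P⁻¹ = 1`, `det (x - N)` is the determinant of the skew matrix `x P - P'`,
hence the square of its Pfaffian, a quadratic in `x`. Here the square is checked by expansion. -/
theorem charpoly_recursionOp (S : Data) (z : Phase) :
    (recursionOp (S.P' z)).charpoly = minimalPoly (S.sigma₁ z) (S.sigma₂ z) ^ 2 := by
  refine Polynomial.funext fun x => ?_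
  rw [Matrix.eval_charpoly, recursionOp_P']
  simp [Matrix.det_succ_row_zero, Fin.sum_univ_succ, minimalPoly, sigma₁, sigma₂, Fin.succAbove,
    Matrix.submatrix]
  ring

/-- The coefficient of `x ^ 3` in the square is `-2 s₁`. Only `s₁` is needed, because the first row
of the chain does not involve `s₂`. -/
theorem minimalPoly_sq_injective {s₁ s₂ t₁ t₂ : ℝ}
    (h : minimalPoly s₁ s₂ ^ 2 = minimalPoly t₁ t₂ ^ 2) : s₁ = t₁ := by
  have key : ∀ a b : ℝ, (minimalPoly a b ^ 2).coeff 3 = -2 * a := by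
    intro a b
    have : minimalPoly a b ^ 2 = Polynomial.X ^ 4 + Polynomial.C (-2 * a) * Polynomial.X ^ 3
        + Polynomial.C (a ^ 2 - 2 * b) * Polynomial.X ^ 2
        + Polynomial.C (2 * a * b) * Polynomial.X + Polynomial.C (b ^ 2) := by
      refine Polynomial.funext fun x => ?_
      simp [minimalPoly]
      ring
    rw [this]
    simp only [Polynomial.coeff_add, Polynomial.coeff_C_mul, Polynomial.coeff_X_pow,
      Polynomial.coeff_X, Polynomial.coeff_C]
    norm_num
  have := congrArg (fun p => Polynomial.coeff p 3) h
  simp only [key] at this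
  linarith

/-- The differential of `H₂` determined by the first equation of the chain. -/
noncomputable def chainGrad (S : Data) (z : Phase) : Fin 4 → ℝ :=
  let V₁ := pd 0 S.V (position z)
  let V₂ := pd 1 S.V (position z)
  ![S.P' z 1 2 * V₂ - S.P' z 1 3 * V₁ - 2 * S.f (position z) * z 3,
    S.P' z 0 3 * V₁ - S.P' z 0 2 * V₂ + 2 * S.f (position z) * z 2,
    S.h (position z) * V₂ + 2 * (S.P' z 0 3 * z 3 - S.P' z 1 3 * z 2),
    -S.h (position z) * V₁ + 2 * (S.P' z 1 2 * z 2 - S.P' z 0 2 * z 3)]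

theorem grad_H₁ {z : Phase} (hV : DifferentiableAt ℝ S.V (position z)) :
    grad S.H₁ z = ![pd 0 S.V (position z), pd 1 S.V (position z), 2 * z 2, 2 * z 3] := by
  change grad (fun w => w 2 ^ 2 + w 3 ^ 2 + S.V (position w)) z = _
  rw [grad_add (by fun_prop) (differentiableAt_comp_position hV), grad_comp_position hV,
    grad_add (by fun_prop) (by fun_prop), grad_pow (by fun_prop), grad_pow (by fun_prop),
    grad_coord, grad_coord]
  ext i; fin_cases i <;> simp

/-- The first chain equation says `dH₂ = (N* - σ₁) dH₁`, which is `chainGrad`. The second then costs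
nothing: `N` is annihilated by its Pfaffian polynomial, so `N* (N* - σ₁) dH₁ = σ₂ dH₁`. -/
theorem nijenhuisChain_iff (hV : ∀ q ∈ S.U, DifferentiableAt ℝ S.V q) :
    S.NijenhuisChain ↔ ∀ z ∈ S.phaseDomain, grad S.H₂ z = S.chainGrad z := by
  refine forall₂_congr fun z hz => ?_
  have hH := grad_H₁ (S := S) (hV _ hz)
  have hN := charpoly_recursionOp S z
  constructor
  · rintro ⟨s₁, s₂, hs, hc⟩
    have e : S.sigma₁ z = s₁ := minimalPoly_sq_injective (hN.symm.trans hs)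
    have h0 := hc 0
    simp only [H, Fin.sum_univ_two, controlMatrix, Matrix.of_apply, Matrix.cons_val_zero,
      Matrix.cons_val_one, Matrix.cons_val', Matrix.cons_val_fin_one, one_smul] at h0
    rw [hH, recursionOp_P', ← e] at h0
    have h1 := eq_sub_of_add_eq' h0.symm
    rw [h1]
    ext i
    fin_cases i <;> simp [chainGrad, Matrix.mulVec, dotProduct, Fin.sum_univ_four, sigma₁] <;>
      simp [P'] <;> ring
  · intro hg
    refine ⟨_, _, hN, fun j => ?_⟩
    ext i
    fin_cases j <;> fin_cases i <;>
      simp [H, hg, hH, recursionOp_P', controlMatrix, chainGrad, Matrix.mulVec, dotProduct,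
        Fin.sum_univ_four, sigma₁, sigma₂] <;>
      simp [P'] <;> ring

/-- Since `P Nᵀ = P'`, the bracket of `H₁` and `H₂` is the form `P' - σ₁ P` evaluated twice on
`dH₁`, and this form is skew. -/
theorem involution_of_chainGrad (hV : ∀ q ∈ S.U, DifferentiableAt ℝ S.V q)
    (hg : ∀ z ∈ S.phaseDomain, grad S.H₂ z = S.chainGrad z) :
    ∀ z ∈ S.phaseDomain, grad S.H₁ z ⬝ᵥ canonicalP *ᵥ grad S.H₂ z = 0 := by
  intro z hz
  rw [hg z hz, grad_H₁ (hV _ hz)]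
  simp [chainGrad, canonicalP, Matrix.mulVec, dotProduct, Fin.sum_univ_four]
  simp [P']
  ring

end Data
end BiHam

/-! ### The differential of the cubic integral. -/

namespace BiHam

section Gradients

variable {α β : Plane → ℝ} {z : Phase}

theorem grad_affine (hα : DifferentiableAt ℝ α (position z))
    (hβ : DifferentiableAt ℝ β (position z)) :
    grad (fun w => α (position w) * w 2 + β (position w) * w 3) z =
      ![pd 0 α (position z) * z 2 + pd 0 β (position z) * z 3,
        pd 1 α (position z) * z 2 + pd 1 β (position z) * z 3,
        α (position z), β (position z)] := by
  have h1 := differentiableAt_comp_position hα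
  have h2 := differentiableAt_comp_position hβ
  rw [grad_add (h1.fun_mul (by fun_prop)) (h2.fun_mul (by fun_prop)), grad_mul h1 (by fun_prop),
    grad_mul h2 (by fun_prop), grad_comp_position hα, grad_comp_position hβ, grad_coord,
    grad_coord]
  ext i
  simp only [Pi.add_apply, Pi.smul_apply, smul_eq_mul]
  fin_cases i <;> simp <;> ring

theorem grad_quadratic (hα : DifferentiableAt ℝ α (position z)) (a b d : ℝ) :
    grad (fun w => α (position w) + (a * w 2 ^ 2 + b * (w 2 * w 3) + d * w 3 ^ 2)) z =
      ![pd 0 α (position z), pd 1 α (position z), 2 * a * z 2 + b * z 3,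
        b * z 2 + 2 * d * z 3] := by
  rw [grad_add (differentiableAt_comp_position hα) (by fun_prop), grad_comp_position hα,
    grad_add (by fun_prop) (by fun_prop), grad_add (by fun_prop) (by fun_prop),
    grad_const_mul _ (by fun_prop), grad_const_mul _ (by fun_prop),
    grad_const_mul _ (by fun_prop), grad_mul (by fun_prop) (by fun_prop),
    grad_pow (by fun_prop), grad_pow (by fun_prop), grad_coord, grad_coord]
  ext i; fin_cases i <;> simp <;> ring

theorem grad_cubic (a b d e : ℝ) :
    grad (fun w => a * w 2 ^ 3 + b * (w 2 ^ 2 * w 3) + d * (w 2 * w 3 ^ 2) + e * w 3 ^ 3) z =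
      ![0, 0, 3 * a * z 2 ^ 2 + 2 * b * z 2 * z 3 + d * z 3 ^ 2,
        b * z 2 ^ 2 + 2 * d * z 2 * z 3 + 3 * e * z 3 ^ 2] := by
  rw [grad_add (by fun_prop) (by fun_prop), grad_add (by fun_prop) (by fun_prop),
    grad_add (by fun_prop) (by fun_prop), grad_const_mul _ (by fun_prop),
    grad_const_mul _ (by fun_prop), grad_const_mul _ (by fun_prop),
    grad_const_mul _ (by fun_prop), grad_mul (by fun_prop) (by fun_prop),
    grad_mul (by fun_prop) (by fun_prop), grad_pow (by fun_prop), grad_pow (by fun_prop),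
    grad_pow (by fun_prop), grad_pow (by fun_prop), grad_coord, grad_coord]
  ext i; fin_cases i <;> simp <;> ring

end Gradients

section

variable {U : Set Plane} {c : Fin 8 → ℝ} {h V : Plane → ℝ}

theorem contDiffOn_cubicIntegral (hU : IsOpen U) (hh : ContDiffOn ℝ ∞ h U)
    (hV : ContDiffOn ℝ ∞ V U) : ContDiffOn ℝ ∞ (cubicIntegral c h V) {z | position z ∈ U} := by
  have hp : ContDiffOn ℝ ∞ position {z | position z ∈ U} := by
    rw [position_eq]; exact positionL.contDiff.contDiffOn
  have h0 : ContDiffOn ℝ ∞ (fun z => h (position z)) {z | position z ∈ U} :=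
    hh.comp hp fun z hz => hz
  have h1 : ∀ i, ContDiffOn ℝ ∞ (fun z => pd i V (position z)) {z | position z ∈ U} := fun i =>
    (contDiffOn_pd hU hV i).comp hp fun z hz => hz
  have h2 := h1 0
  have h3 := h1 1
  have h4 : ∀ i : Fin 4, ContDiffOn ℝ ∞ (fun z : Phase => z i) {z | position z ∈ U} := fun i =>
    (contDiff_apply ℝ ℝ i).contDiffOn
  have h5 : ContDiffOn ℝ ∞ (fun z : Phase => -2 * (c 6 / 3 * z 2 ^ 3 - c 4 * z 2 ^ 2 * z 3
      - c 3 * z 2 * z 3 ^ 2 + c 1 / 3 * z 3 ^ 3)) {z | position z ∈ U} := by fun_prop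
  exact (h5.add ((h0.mul h3).mul (h4 2))).sub ((h0.mul h2).mul (h4 3))

theorem grad_cubicIntegral (hU : IsOpen U) (hh : ContDiffOn ℝ ∞ h U)
    (hV : ContDiffOn ℝ ∞ V U) {z : Phase} (hz : position z ∈ U) :
    grad (cubicIntegral c h V) z =
      ![(pd 0 h (position z) * pd 1 V (position z)
            + h (position z) * pd 0 (pd 1 V) (position z)) * z 2
          - (pd 0 h (position z) * pd 0 V (position z)
            + h (position z) * pd 0 (pd 0 V) (position z)) * z 3,
        (pd 1 h (position z) * pd 1 V (position z)
            + h (position z) * pd 1 (pd 1 V) (position z)) * z 2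
          - (pd 1 h (position z) * pd 0 V (position z)
            + h (position z) * pd 1 (pd 0 V) (position z)) * z 3,
        -2 * (c 6 * z 2 ^ 2 - 2 * c 4 * z 2 * z 3 - c 3 * z 3 ^ 2)
          + h (position z) * pd 1 V (position z),
        -2 * (-c 4 * z 2 ^ 2 - 2 * c 3 * z 2 * z 3 + c 1 * z 3 ^ 2)
          - h (position z) * pd 0 V (position z)] := by
  have hh' := differentiableAt_of_contDiffOn hU hh hz
  have hV' : ∀ i, DifferentiableAt ℝ (pd i V) (position z) := fun i =>
    differentiableAt_of_contDiffOn hU (contDiffOn_pd hU hV i) hz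
  have hα : DifferentiableAt ℝ (fun q => h q * pd 1 V q) (position z) := hh'.mul (hV' 1)
  have hβ : DifferentiableAt ℝ (fun q => -1 * (h q * pd 0 V q)) (position z) :=
    (hh'.mul (hV' 0)).const_mul _
  have e : cubicIntegral c h V = fun w =>
      ((-2 * (c 6 / 3)) * w 2 ^ 3 + (2 * c 4) * (w 2 ^ 2 * w 3) + (2 * c 3) * (w 2 * w 3 ^ 2)
        + (-2 * (c 1 / 3)) * w 3 ^ 3)
      + (h (position w) * pd 1 V (position w) * w 2
        + -1 * (h (position w) * pd 0 V (position w)) * w 3) := by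
    funext w
    simp only [cubicIntegral]
    ring
  have G := grad_affine hα hβ
  rw [e, grad_add (by fun_prop)
    (((differentiableAt_comp_position hα).fun_mul (by fun_prop)).fun_add
      ((differentiableAt_comp_position hβ).fun_mul (by fun_prop))),
    grad_cubic, G, pd_const_mul (hh'.fun_mul (hV' 0)), pd_const_mul (hh'.fun_mul (hV' 0)),
    pd_mul hh' (hV' 1), pd_mul hh' (hV' 1), pd_mul hh' (hV' 0), pd_mul hh' (hV' 0)]
  ext i; fin_cases i <;> simp <;> ring

end

/-! ### Passing between solutions and the reduced system. -/

namespace Data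

variable {S : Data}

/-- The momentum components match by the two linear relations on `c`. In the position components
every second derivative of `V` carries a factor `h`, and the equations for `V` replace these
products by first derivatives. -/
theorem grad_cubicIntegral_of_reduced (hR : ReducedSystem S.U S.c S.h S.f S.V) {z : Phase}
    (hz : z ∈ S.phaseDomain) : grad (cubicIntegral S.c S.h S.V) z = S.chainGrad z := by
  have e1 := hR.h₁ _ hz
  have e2 := hR.h₂ _ hz
  have e3 := hR.V₁₁ _ hz
  have e4 := hR.V₁₂ _ hz
  have e5 := hR.V₂₂ _ hz
  have e6 := pd_comm hR.isOpen hR.smooth_V hz 1 0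
  obtain ⟨s1, s2, -, -, -, -⟩ := hR.algebraic
  rw [grad_cubicIntegral hR.isOpen hR.smooth_h hR.smooth_V hz, e6, e1, e2, e3, e4, e5]
  ext i
  fin_cases i <;> simp [chainGrad] <;> simp [P', s1, s2] <;> ring

/-- `dH₂ = chainGrad` contains only first derivatives of `V`, so symmetry of its Jacobian matrix is
a second-order system for `V`. The components along positions are affine in the momenta and those
along momenta are quadratic, which makes all required derivatives explicit. -/
theorem reduced_of_solution (hS : S.IsSolution) : ReducedSystem S.U S.c S.h S.f S.V := by
  have hU := hS.isOpen
  have hD : IsOpen S.phaseDomain := isOpen_position_preimage hU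
  have dV : ∀ q ∈ S.U, DifferentiableAt ℝ S.V q := fun q hq =>
    differentiableAt_of_contDiffOn hU hS.smooth_V hq
  have hg := (nijenhuisChain_iff dV).1 hS.chain
  have dh : ∀ q ∈ S.U, DifferentiableAt ℝ S.h q := fun q hq =>
    differentiableAt_of_contDiffOn hU hS.smooth_h hq
  have df : ∀ q ∈ S.U, DifferentiableAt ℝ S.f q := fun q hq =>
    differentiableAt_of_contDiffOn hU hS.smooth_f hq
  have dV' : ∀ i, ∀ q ∈ S.U, DifferentiableAt ℝ (pd i S.V) q := fun i q hq =>
    differentiableAt_of_contDiffOn hU (contDiffOn_pd hU hS.smooth_V i) hq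
  have sym : ∀ z ∈ S.phaseDomain, ∀ i j,
      grad (fun w => S.chainGrad w i) z j = grad (fun w => S.chainGrad w j) z i := by
    intro z hz i j
    have e : ∀ k, grad (fun w => S.chainGrad w k) z = grad (fun w => grad S.H₂ w k) z := fun k =>
      grad_congr hD (fun w hw => by rw [hg w hw]) hz
    rw [e, e]
    exact fderiv_fderiv_comm hD hS.smooth_H₂ hz _ _
  have g0 : ∀ z ∈ S.phaseDomain, grad (fun w => S.chainGrad w 0) z 2
        = S.c 4 * pd 1 S.V (position z) - S.c 6 * pd 0 S.V (position z) ∧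
      grad (fun w => S.chainGrad w 0) z 3
        = S.c 5 * pd 1 S.V (position z) - S.c 7 * pd 0 S.V (position z)
          - 2 * S.f (position z) := by
    intro z hz
    have hf := df _ hz
    have hV0 := dV' 0 _ hz
    have hV1 := dV' 1 _ hz
    have G := grad_affine (z := z) (α := fun q => S.c 4 * pd 1 S.V q - S.c 6 * pd 0 S.V q)
      (β := fun q => S.c 5 * pd 1 S.V q - S.c 7 * pd 0 S.V q - 2 * S.f q) (by fun_prop) (by fun_prop)
    have e : (fun w => S.chainGrad w 0) = fun w =>
        (S.c 4 * pd 1 S.V (position w) - S.c 6 * pd 0 S.V (position w)) * w 2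
        + (S.c 5 * pd 1 S.V (position w) - S.c 7 * pd 0 S.V (position w) - 2 * S.f (position w)) * w 3 := by
      funext w; simp [chainGrad, P']; ring
    rw [e, G]
    simp
  have g1 : ∀ z ∈ S.phaseDomain, grad (fun w => S.chainGrad w 1) z 2
        = S.c 2 * pd 0 S.V (position z) - S.c 0 * pd 1 S.V (position z)
          + 2 * S.f (position z) ∧
      grad (fun w => S.chainGrad w 1) z 3
        = S.c 3 * pd 0 S.V (position z) - S.c 1 * pd 1 S.V (position z) := by
    intro z hz
    have hf := df _ hz
    have hV0 := dV' 0 _ hz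
    have hV1 := dV' 1 _ hz
    have G := grad_affine (z := z) (α := fun q => S.c 2 * pd 0 S.V q - S.c 0 * pd 1 S.V q + 2 * S.f q)
      (β := fun q => S.c 3 * pd 0 S.V q - S.c 1 * pd 1 S.V q) (by fun_prop) (by fun_prop)
    have e : (fun w => S.chainGrad w 1) = fun w =>
        (S.c 2 * pd 0 S.V (position w) - S.c 0 * pd 1 S.V (position w) + 2 * S.f (position w)) * w 2
        + (S.c 3 * pd 0 S.V (position w) - S.c 1 * pd 1 S.V (position w)) * w 3 := by
      funext w; simp [chainGrad, P']; ring
    rw [e, G]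
    simp
  have g2 : ∀ z ∈ S.phaseDomain, grad (fun w => S.chainGrad w 2) z =
      ![pd 0 S.h (position z) * pd 1 S.V (position z)
          + S.h (position z) * pd 0 (pd 1 S.V) (position z),
        pd 1 S.h (position z) * pd 1 S.V (position z)
          + S.h (position z) * pd 1 (pd 1 S.V) (position z),
        2 * (-2 * S.c 6) * z 2 + 2 * (S.c 2 - S.c 7) * z 3,
        2 * (S.c 2 - S.c 7) * z 2 + 2 * (2 * S.c 3) * z 3] := by
    intro z hz
    have hh := dh _ hz
    have hV1 := dV' 1 _ hz
    have G := grad_quadratic (z := z) (α := fun q => S.h q * pd 1 S.V q) (by fun_prop)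
    have e : (fun w => S.chainGrad w 2) = fun w =>
        S.h (position w) * pd 1 S.V (position w)
        + ((-2 * S.c 6) * w 2 ^ 2 + (2 * (S.c 2 - S.c 7)) * (w 2 * w 3)
          + (2 * S.c 3) * w 3 ^ 2) := by
      funext w; simp [chainGrad, P']; ring
    rw [e, G, pd_mul hh hV1, pd_mul hh hV1]
  have g3 : ∀ z ∈ S.phaseDomain, grad (fun w => S.chainGrad w 3) z =
      ![-1 * (pd 0 S.h (position z) * pd 0 S.V (position z)
          + S.h (position z) * pd 0 (pd 0 S.V) (position z)),
        -1 * (pd 1 S.h (position z) * pd 0 S.V (position z)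
          + S.h (position z) * pd 1 (pd 0 S.V) (position z)),
        2 * (2 * S.c 4) * z 2 + 2 * (S.c 5 - S.c 0) * z 3,
        2 * (S.c 5 - S.c 0) * z 2 + 2 * (-2 * S.c 1) * z 3] := by
    intro z hz
    have hh := dh _ hz
    have hV0 := dV' 0 _ hz
    have G := grad_quadratic (z := z) (α := fun q => -1 * (S.h q * pd 0 S.V q)) (by fun_prop)
    have e : (fun w => S.chainGrad w 3) = fun w =>
        -1 * (S.h (position w) * pd 0 S.V (position w))
        + ((2 * S.c 4) * w 2 ^ 2 + (2 * (S.c 5 - S.c 0)) * (w 2 * w 3)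
          + (-2 * S.c 1) * w 3 ^ 2) := by
      funext w; simp [chainGrad, P']; ring
    rw [e, G, pd_const_mul (hh.fun_mul hV0), pd_const_mul (hh.fun_mul hV0),
      pd_mul hh hV0, pd_mul hh hV0]
  have hz : ∀ q ∈ S.U, ∀ p, join q p ∈ S.phaseDomain := fun q hq p => by
    simpa [phaseDomain, position_join] using hq
  obtain ⟨q₀, hq₀⟩ := hS.isConnected.nonempty
  obtain ⟨⟨j1, j2⟩, j3, j4⟩ := quad_of_solution hS hq₀
  -- Symmetry in the two momentum directions is linear in `p`; unit momenta give the two linear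
  -- relations on `c`.
  have alg : S.c 2 = S.c 7 + 2 * S.c 4 ∧ S.c 5 = S.c 0 + 2 * S.c 3 := by
    have a := sym _ (hz q₀ hq₀ ![1, 0]) 2 3
    have b := sym _ (hz q₀ hq₀ ![0, 1]) 2 3
    rw [g2 _ (hz _ hq₀ _), g3 _ (hz _ hq₀ _)] at a b
    simp [join] at a b
    constructor <;> linarith
  refine ⟨hU, hS.isConnected, hS.smooth_h, hS.smooth_f, hS.smooth_V,
    ⟨alg.1, alg.2, j1, j2, j3, j4⟩, fun q hq => (h_of_solution hS hq).1,
    fun q hq => (h_of_solution hS hq).2, fun q hq => (f_of_solution hS hq).1,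
    fun q hq => (f_of_solution hS hq).2, fun q hq => ?_, fun q hq => ?_, fun q hq => ?_⟩
  -- Mixed position and momentum symmetry at `p = 0` gives the equations for `V`. The remaining pair
  -- `1 3` would only repeat the equation for the mixed derivative.
  · have a := sym _ (hz q hq 0) 0 3
    rw [(g0 _ (hz q hq 0)).2, g3 _ (hz q hq 0)] at a
    simp [position_join, h_of_solution hS hq] at a
    linarith
  · have a := sym _ (hz q hq 0) 0 2
    rw [(g0 _ (hz q hq 0)).1, g2 _ (hz q hq 0)] at a
    simp [position_join, h_of_solution hS hq] at a
    linarith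
  · have a := sym _ (hz q hq 0) 1 2
    rw [(g1 _ (hz q hq 0)).1, g2 _ (hz q hq 0)] at a
    simp [position_join, h_of_solution hS hq] at a
    linarith

theorem H₂_of_solution (hS : S.IsSolution) :
    ∃ k, ∀ z ∈ S.phaseDomain, S.H₂ z = cubicIntegral S.c S.h S.V z + k := by
  have hR := reduced_of_solution hS
  have hD : IsOpen S.phaseDomain := isOpen_position_preimage hS.isOpen
  have hg := (nijenhuisChain_iff fun q hq =>
    differentiableAt_of_contDiffOn hS.isOpen hS.smooth_V hq).1 hS.chain
  have hc : ContDiffOn ℝ ∞ (cubicIntegral S.c S.h S.V) S.phaseDomain :=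
    contDiffOn_cubicIntegral hS.isOpen hS.smooth_h hS.smooth_V
  have d1 : ∀ z ∈ S.phaseDomain, DifferentiableAt ℝ S.H₂ z := fun z hz =>
    differentiableAt_of_contDiffOn hD hS.smooth_H₂ hz
  have d2 : ∀ z ∈ S.phaseDomain, DifferentiableAt ℝ (cubicIntegral S.c S.h S.V) z := fun z hz =>
    differentiableAt_of_contDiffOn hD hc hz
  obtain ⟨k, hk⟩ := exists_const_of_grad_eq_zero (g := fun z => S.H₂ z - cubicIntegral _ _ _ z) hD
    (isConnected_position_preimage hS.isConnected)
    (fun z hz => ((d1 z hz).sub (d2 z hz)).differentiableWithinAt) fun z hz => by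
      rw [grad_sub (d1 z hz) (d2 z hz), hg z hz, grad_cubicIntegral_of_reduced hR hz, sub_self]
  exact ⟨k, fun z hz => by linarith [hk z hz]⟩

theorem isSolution_of_reduced (hR : ReducedSystem S.U S.c S.h S.f S.V)
    (hH : S.H₂ = cubicIntegral S.c S.h S.V) : S.IsSolution := by
  have dh : ∀ q ∈ S.U, DifferentiableAt ℝ S.h q := fun q hq =>
    differentiableAt_of_contDiffOn hR.isOpen hR.smooth_h hq
  have df : ∀ q ∈ S.U, DifferentiableAt ℝ S.f q := fun q hq =>
    differentiableAt_of_contDiffOn hR.isOpen hR.smooth_f hq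
  have dV : ∀ q ∈ S.U, DifferentiableAt ℝ S.V q := fun q hq =>
    differentiableAt_of_contDiffOn hR.isOpen hR.smooth_V hq
  refine ⟨hR.isOpen, hR.isConnected, hR.smooth_h, hR.smooth_f, hR.smooth_V, ?_,
    (jacobiOn_P' dh df).2 fun z hz i j k => schoutenSelf_of_reduced hR hz i j k, fun l =>
    (jacobiOn_pencil dh df l).2 fun z hz i j k => ?_, (nijenhuisChain_iff dV).2 fun z hz => ?_⟩
  · rw [hH]
    exact contDiffOn_cubicIntegral hR.isOpen hR.smooth_h hR.smooth_V
  · rw [schoutenSelf_of_reduced hR hz, schoutenMixed_of_reduced hR hz]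
    ring
  · rw [hH]
    exact grad_cubicIntegral_of_reduced hR hz

end Data
end BiHam

/-! ### Exact degree three and functional independence. -/

namespace BiHam

/-- The four coefficients assumed to vanish are those of the cubic form in `H₂`. Then `quad₂` and
`quad₃` reduce to `c 0 ^ 2 = 0` and `c 7 ^ 2 = 0`. Hence a nonzero `P'` forces degree exactly three.
-/
theorem AlgebraicRelations.eq_zero {c : Fin 8 → ℝ} (hc : AlgebraicRelations c) (h1 : c 1 = 0)
    (h3 : c 3 = 0) (h4 : c 4 = 0) (h6 : c 6 = 0) : c = 0 := by
  obtain ⟨s1, s2, -, q2, q3, -⟩ := hc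
  have h0 : c 0 = 0 := by
    rw [s2, h1, h3, h6] at q2
    exact pow_eq_zero_iff two_ne_zero |>.1 (by linarith)
  have h7 : c 7 = 0 := by
    rw [s1, h1, h4, h6] at q3
    exact pow_eq_zero_iff two_ne_zero |>.1 (by linarith)
  have h2 : c 2 = 0 := by rw [s1, h7, h4]; ring
  have h5 : c 5 = 0 := by rw [s2, h0, h3]; ring
  ext i
  fin_cases i <;> assumption

/-- The cubic form in the momenta that starts the second integral. -/
noncomputable def cubicPart (c : Fin 8 → ℝ) : MvPolynomial (Fin 2) ℝ :=
  MvPolynomial.C (-2) * (MvPolynomial.C (c 6 / 3) * MvPolynomial.X 0 ^ 3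
    - MvPolynomial.C (c 4) * (MvPolynomial.X 0 ^ 2 * MvPolynomial.X 1)
    - MvPolynomial.C (c 3) * (MvPolynomial.X 0 * MvPolynomial.X 1 ^ 2)
    + MvPolynomial.C (c 1 / 3) * MvPolynomial.X 1 ^ 3)

theorem isHomogeneous_cubicPart (c : Fin 8 → ℝ) : (cubicPart c).IsHomogeneous 3 := by
  have X3 : ∀ i : Fin 2, (MvPolynomial.X i ^ 3 : MvPolynomial (Fin 2) ℝ).IsHomogeneous 3 :=
    fun i => MvPolynomial.isHomogeneous_X_pow i 3
  have hC : ∀ (a : ℝ) {Q : MvPolynomial (Fin 2) ℝ}, Q.IsHomogeneous 3 →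
      (MvPolynomial.C a * Q).IsHomogeneous 3 := fun a Q hQ => hQ.C_mul a
  refine hC _ (MvPolynomial.IsHomogeneous.add (MvPolynomial.IsHomogeneous.sub
    (MvPolynomial.IsHomogeneous.sub (hC _ (X3 0)) (hC _ ?_)) (hC _ ?_)) (hC _ (X3 1)))
  · exact (MvPolynomial.isHomogeneous_X_pow 0 2).mul (MvPolynomial.isHomogeneous_X ℝ 1)
  · exact (MvPolynomial.isHomogeneous_X ℝ 0).mul (MvPolynomial.isHomogeneous_X_pow 1 2)

theorem eval_cubicPart (c : Fin 8 → ℝ) (p : Plane) : MvPolynomial.eval p (cubicPart c)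
    = -2 * (c 6 / 3 * p 0 ^ 3 - c 4 * p 0 ^ 2 * p 1 - c 3 * p 0 * p 1 ^ 2
      + c 1 / 3 * p 1 ^ 3) := by
  simp [cubicPart]
  ring

theorem cubicPart_ne_zero {c : Fin 8 → ℝ} (hc : AlgebraicRelations c) (h : c ≠ 0) :
    cubicPart c ≠ 0 := by
  intro h0
  have e : ∀ p : Plane, -2 * (c 6 / 3 * p 0 ^ 3 - c 4 * p 0 ^ 2 * p 1 - c 3 * p 0 * p 1 ^ 2
      + c 1 / 3 * p 1 ^ 3) = 0 := fun p => by rw [← eval_cubicPart, h0, map_zero]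
  have e1 := e ![1, 0]
  have e2 := e ![0, 1]
  have e3 := e ![1, 1]
  have e4 := e ![1, -1]
  simp at e1 e2 e3 e4
  rw [e1, e2] at e3 e4
  exact h (hc.eq_zero e2 (by linarith) (by linarith) e1)

namespace Data

variable {S : Data}

theorem hasCubicIntegral_of_eq (hR : ReducedSystem S.U S.c S.h S.f S.V) (hc : S.c ≠ 0) {k : ℝ}
    (hH : ∀ z ∈ S.phaseDomain, S.H₂ z = cubicIntegral S.c S.h S.V z + k) :
    S.HasCubicIntegral := by
  intro q hq
  refine ⟨cubicPart S.c + (MvPolynomial.C (S.h q * pd 1 S.V q) * MvPolynomial.X 0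
    + (MvPolynomial.C (-(S.h q * pd 0 S.V q)) * MvPolynomial.X 1 + MvPolynomial.C k)), ?_, ?_⟩
  · have h3 : (cubicPart S.c).totalDegree = 3 :=
      (isHomogeneous_cubicPart _).totalDegree (cubicPart_ne_zero hR.algebraic hc)
    have hX : ∀ (a : ℝ) (i : Fin 2),
        (MvPolynomial.C a * MvPolynomial.X i : MvPolynomial (Fin 2) ℝ).totalDegree ≤ 1 :=
      fun a i => (MvPolynomial.totalDegree_mul _ _).trans (by simp)
    rw [MvPolynomial.totalDegree_add_eq_left_of_totalDegree_lt, h3]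
    rw [h3]
    refine lt_of_le_of_lt (MvPolynomial.totalDegree_add _ _) (max_lt ((hX _ _).trans_lt (by simp))
      (lt_of_le_of_lt (MvPolynomial.totalDegree_add _ _) (max_lt ((hX _ _).trans_lt (by simp))
        (by simp))))
  · intro p
    rw [hH (join q p) (by simpa [phaseDomain, position_join] using hq)]
    rw [map_add, eval_cubicPart]
    simp [cubicIntegral, position_join]
    simp [join]
    ring

/-- Dependence of `dH₁` and `dH₂` would kill the minor in the momentum directions. Along a line in
the `p₁` direction this minor is a cubic polynomial with leading coefficient `2 c 4`, so it cannot
vanish on an open set. -/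
theorem isNontrivialSolution_of_reduced (hR : ReducedSystem S.U S.c S.h S.f S.V)
    (hH : S.H₂ = cubicIntegral S.c S.h S.V) (hc : S.c 4 ≠ 0)
    (hV : ¬ ∃ k : ℝ, ∀ q ∈ S.U, S.V q = k) : S.IsNontrivialSolution := by
  have dV : ∀ q ∈ S.U, DifferentiableAt ℝ S.V q := fun q hq =>
    differentiableAt_of_contDiffOn hR.isOpen hR.smooth_V hq
  have hS := isSolution_of_reduced hR hH
  have hg := (nijenhuisChain_iff dV).1 hS.chain
  refine ⟨hS, involution_of_chainGrad dV hg, ?_, hV⟩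
  intro W hW hne hWD
  by_contra! hdep
  have hdet : ∀ z ∈ W, z 2 * S.chainGrad z 3 - z 3 * S.chainGrad z 2 = 0 := by
    intro z hz
    have := hdep z hz
    rw [LinearIndependent.pair_iff] at this
    push Not at this
    obtain ⟨s, t, hst, hne⟩ := this
    rw [hg z (hWD hz), grad_H₁ (dV _ (hWD hz))] at hst
    have e2 := congrFun hst 2
    have e3 := congrFun hst 3
    simp only [Pi.add_apply, Pi.smul_apply, smul_eq_mul, Pi.zero_apply, Matrix.cons_val] at e2 e3
    by_cases hs : s = 0
    · have ht := hne hs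
      rw [hs, zero_mul, zero_add] at e2 e3
      rw [(mul_eq_zero.1 e2).resolve_left ht, (mul_eq_zero.1 e3).resolve_left ht]
      ring
    · have : s * (z 2 * S.chainGrad z 3 - z 3 * S.chainGrad z 2) = 0 := by
        linear_combination (S.chainGrad z 3 * e2 - S.chainGrad z 2 * e3) / 2
      exact (mul_eq_zero.1 this).resolve_left hs
  obtain ⟨z, hz⟩ := hne
  -- Only `p₁` varies along `γ`, so `h`, `f` and the derivatives of `V` stay fixed and four sample
  -- points suffice.
  obtain ⟨γ, hγ⟩ : ∃ γ : ℝ → Phase, γ = fun t => z + t • (Pi.single 2 1 : Phase) := ⟨_, rfl⟩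
  have hγc : Continuous γ := by rw [hγ]; fun_prop
  have hn : ∀ᶠ t in nhds (0 : ℝ), γ t ∈ W :=
    hγc.continuousAt.eventually_mem (by rw [hγ]; simpa using hW.mem_nhds hz)
  obtain ⟨ε, hε, hball⟩ := Metric.eventually_nhds_iff.1 hn
  have hmem : ∀ j : ℝ, 0 ≤ j → j ≤ 3 → γ (j * (ε / 4)) ∈ W := by
    intro j hj hj3
    refine hball ?_
    rw [Real.dist_eq, sub_zero, abs_of_nonneg (by positivity)]
    nlinarith
  have d0 := hdet _ (hmem 0 (by norm_num) (by norm_num))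
  have d1 := hdet _ (hmem 1 (by norm_num) (by norm_num))
  have d2 := hdet _ (hmem 2 (by norm_num) (by norm_num))
  have d3 := hdet _ (hmem 3 (by norm_num) (by norm_num))
  have hpos : ∀ t, position (γ t) = position z := by
    intro t; ext i; fin_cases i <;> simp [hγ, position]
  have hγ2 : ∀ t, γ t 2 = z 2 + t := fun t => by simp [hγ]
  have hγ3 : ∀ t, γ t 3 = z 3 := fun t => by simp [hγ]
  simp [chainGrad, P', hpos, hγ2, hγ3] at d0 d1 d2 d3
  have : S.c 4 * ε ^ 3 = 0 := by
    -- The third difference of a cubic with leading coefficient `2 c 4` and step `ε / 4` is `6 * 2 c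
    -- 4 * (ε / 4) ^ 3 = (3 / 16) c 4 ε ^ 3`.
    linear_combination (16 / 3) * (d3 - 3 * d2 + 3 * d1 - d0)
  rcases mul_eq_zero.1 this with h | h
  · exact hc h
  · exact hε.ne' (pow_eq_zero_iff three_ne_zero |>.1 h)

end Data
end BiHam

/-! ### The action of similarities on the reduced system. -/

namespace BiHam

/-- The orientation preserving similarity `q ↦ M q + e` of the plane with the matrix
`M = !![m, -n; n, m]`. -/
def similarity (m n : ℝ) (e : Plane) (q : Plane) : Plane :=
  ![m * q 0 - n * q 1 + e 0, n * q 0 + m * q 1 + e 1]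

/-- The linear part of a similarity. -/
noncomputable def similarityL (m n : ℝ) : Plane →L[ℝ] Plane :=
  ContinuousLinearMap.pi
    ![m • ContinuousLinearMap.proj 0 - n • ContinuousLinearMap.proj 1,
      n • ContinuousLinearMap.proj 0 + m • ContinuousLinearMap.proj 1]

theorem similarity_eq (m n : ℝ) (e : Plane) :
    similarity m n e = fun q => similarityL m n q + e := by
  funext q; ext i; fin_cases i <;> simp [similarity, similarityL]

theorem hasFDerivAt_similarity (m n : ℝ) (e q : Plane) :
    HasFDerivAt (similarity m n e) (similarityL m n) q := by
  rw [similarity_eq]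
  exact (similarityL m n).hasFDerivAt.add_const e

theorem contDiff_similarity (m n : ℝ) (e : Plane) : ContDiff ℝ ∞ (similarity m n e) := by
  rw [similarity_eq]
  exact (similarityL m n).contDiff.add contDiff_const

/-- The inverse of a similarity. -/
noncomputable def similarityInv (m n : ℝ) (e : Plane) (q : Plane) : Plane :=
  ![(m * (q 0 - e 0) + n * (q 1 - e 1)) / (m ^ 2 + n ^ 2),
    (-n * (q 0 - e 0) + m * (q 1 - e 1)) / (m ^ 2 + n ^ 2)]

section

variable {m n : ℝ} {e : Plane}

theorem similarity_similarityInv (hr : m ^ 2 + n ^ 2 ≠ 0) (q : Plane) :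
    similarity m n e (similarityInv m n e q) = q := by
  ext i
  fin_cases i <;> simp [similarity, similarityInv] <;> field_simp <;> ring

theorem similarityInv_similarity (hr : m ^ 2 + n ^ 2 ≠ 0) (q : Plane) :
    similarityInv m n e (similarity m n e q) = q := by
  ext i
  fin_cases i <;> simp [similarity, similarityInv] <;> field_simp <;> ring

theorem continuous_similarityInv : Continuous (similarityInv m n e) := by
  refine continuous_pi fun i => ?_
  fin_cases i <;> simp [similarityInv] <;> fun_prop

theorem preimage_similarity (hr : m ^ 2 + n ^ 2 ≠ 0) (U : Set Plane) :
    similarity m n e ⁻¹' U = similarityInv m n e '' U := by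
  ext q
  constructor
  · intro hq
    exact ⟨_, hq, similarityInv_similarity hr q⟩
  · rintro ⟨q', hq', rfl⟩
    simpa [similarity_similarityInv hr] using hq'

variable {g : Plane → ℝ} {q : Plane}

theorem pd_comp_similarity (hg : DifferentiableAt ℝ g (similarity m n e q)) (a : ℝ) :
    pd 0 (fun q => a * g (similarity m n e q)) q
        = a * (m * pd 0 g (similarity m n e q) + n * pd 1 g (similarity m n e q)) ∧
      pd 1 (fun q => a * g (similarity m n e q)) q
        = a * (-n * pd 0 g (similarity m n e q) + m * pd 1 g (similarity m n e q)) := by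
  have h := (hg.hasFDerivAt.comp q (hasFDerivAt_similarity m n e q)).const_mul a
  have h' : HasFDerivAt (fun q => a * g (similarity m n e q)) _ q := h
  rw [HasFDerivAt.pd_eq h', HasFDerivAt.pd_eq h']
  simp [fderiv_eq_pd, similarityL]

end

/-- The coefficients of the transformed tensor. -/
def transportCoeff (m n ν : ℝ) (c : Fin 8 → ℝ) : Fin 8 → ℝ :=
  let s (x y : ℝ) := m * x + n * y
  let t (x y : ℝ) := -n * x + m * y
  ![ν * (m ^ 2 * s (c 0) (c 1) + m * n * s (c 2) (c 3) + m * n * s (c 4) (c 5)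
      + n ^ 2 * s (c 6) (c 7)),
    ν * (m ^ 2 * t (c 0) (c 1) + m * n * t (c 2) (c 3) + m * n * t (c 4) (c 5)
      + n ^ 2 * t (c 6) (c 7)),
    ν * (-(m * n) * s (c 0) (c 1) + m ^ 2 * s (c 2) (c 3) - n ^ 2 * s (c 4) (c 5)
      + m * n * s (c 6) (c 7)),
    ν * (-(m * n) * t (c 0) (c 1) + m ^ 2 * t (c 2) (c 3) - n ^ 2 * t (c 4) (c 5)
      + m * n * t (c 6) (c 7)),
    ν * (-(m * n) * s (c 0) (c 1) - n ^ 2 * s (c 2) (c 3) + m ^ 2 * s (c 4) (c 5)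
      + m * n * s (c 6) (c 7)),
    ν * (-(m * n) * t (c 0) (c 1) - n ^ 2 * t (c 2) (c 3) + m ^ 2 * t (c 4) (c 5)
      + m * n * t (c 6) (c 7)),
    ν * (n ^ 2 * s (c 0) (c 1) - m * n * s (c 2) (c 3) - m * n * s (c 4) (c 5)
      + m ^ 2 * s (c 6) (c 7)),
    ν * (n ^ 2 * t (c 0) (c 1) - m * n * t (c 2) (c 3) - m * n * t (c 4) (c 5)
      + m ^ 2 * t (c 6) (c 7))]

/-- The two linear relations form a vector and the four quadratic ones a tensor with two indices. A
similarity mixes each group linearly, with the matrix entries `m`, `n` as weights. -/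
theorem transportCoeff_algebraic (m n ν : ℝ) {c : Fin 8 → ℝ} (hc : AlgebraicRelations c) :
    AlgebraicRelations (transportCoeff m n ν c) := by
  obtain ⟨s1, s2, q1, q2, q3, q4⟩ := hc
  constructor <;> simp [transportCoeff]
  · linear_combination (ν * m * (m ^ 2 + n ^ 2)) * s1 - (ν * n * (m ^ 2 + n ^ 2)) * s2
  · linear_combination (ν * n * (m ^ 2 + n ^ 2)) * s1 + (ν * m * (m ^ 2 + n ^ 2)) * s2
  · linear_combination (ν ^ 2 * (m ^ 2 + n ^ 2) ^ 2) *
      (m * m * q1 + m * n * q2 + n * m * q3 + n * n * q4)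
  · linear_combination (ν ^ 2 * (m ^ 2 + n ^ 2) ^ 2) *
      (-m * n * q1 + m * m * q2 - n * n * q3 + n * m * q4)
  · linear_combination (ν ^ 2 * (m ^ 2 + n ^ 2) ^ 2) *
      (-n * m * q1 - n * n * q2 + m * m * q3 + m * n * q4)
  · linear_combination (ν ^ 2 * (m ^ 2 + n ^ 2) ^ 2) *
      (n * n * q1 - n * m * q2 - m * n * q3 + m * m * q4)

/-- Put `r = m ^ 2 + n ^ 2`. The data are pulled back by the similarity, with `P'` scaled by `ν r ^
2`. The entry `h` acquires the determinant `1 / r` of the inverse map and `f` the determinant `r` on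
the momenta, whence `ν r` and `ν r ^ 3`. The factor `r` on `V` matches that of the kinetic energy.
The equations for `V` transform as the entries of a symmetric bilinear form. -/
theorem ReducedSystem.transport {U : Set Plane} {c : Fin 8 → ℝ} {h f V : Plane → ℝ}
    (hR : ReducedSystem U c h f V) {m n : ℝ} (hr : m ^ 2 + n ^ 2 ≠ 0) (ν : ℝ) (e : Plane) :
    ReducedSystem (similarity m n e ⁻¹' U) (transportCoeff m n ν c)
      (fun q => ν * (m ^ 2 + n ^ 2) * h (similarity m n e q))
      (fun q => ν * (m ^ 2 + n ^ 2) ^ 3 * f (similarity m n e q))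
      (fun q => (m ^ 2 + n ^ 2) * V (similarity m n e q)) := by
  have hφ := contDiff_similarity m n e
  have hU := hR.isOpen
  have hU' : IsOpen (similarity m n e ⁻¹' U) := hU.preimage hφ.continuous
  have dd : ∀ {g : Plane → ℝ}, ContDiffOn ℝ ∞ g U → ∀ q ∈ similarity m n e ⁻¹' U,
      DifferentiableAt ℝ g (similarity m n e q) := fun hg q hq =>
    differentiableAt_of_contDiffOn hU hg hq
  have sm : ∀ {g : Plane → ℝ} (a : ℝ), ContDiffOn ℝ ∞ g U →
      ContDiffOn ℝ ∞ (fun q => a * g (similarity m n e q)) (similarity m n e ⁻¹' U) :=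
    fun a hg => contDiffOn_const.mul (hg.comp hφ.contDiffOn fun q hq => hq)
  have dV : ∀ i, ∀ q ∈ similarity m n e ⁻¹' U,
      DifferentiableAt ℝ (pd i V) (similarity m n e q) := fun i q hq =>
    dd (contDiffOn_pd hU hR.smooth_V i) q hq
  have dcomp : ∀ i, ∀ q ∈ similarity m n e ⁻¹' U, ∀ a : ℝ,
      DifferentiableAt ℝ (fun q => a * pd i V (similarity m n e q)) q := fun i q hq a =>
    differentiableAt_of_contDiffOn hU' (sm a (contDiffOn_pd hU hR.smooth_V i)) hq
  have p0 : ∀ q ∈ similarity m n e ⁻¹' U, ∀ i,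
      pd i (pd 0 fun q => (m ^ 2 + n ^ 2) * V (similarity m n e q)) q
        = pd i (fun q => (m ^ 2 + n ^ 2) * m * pd 0 V (similarity m n e q)
          + (m ^ 2 + n ^ 2) * n * pd 1 V (similarity m n e q)) q := fun q hq i =>
    pd_congr hU' (fun q hq => by
      rw [(pd_comp_similarity (dd hR.smooth_V q hq) _).1]; ring) hq i
  have p1 : ∀ q ∈ similarity m n e ⁻¹' U, ∀ i,
      pd i (pd 1 fun q => (m ^ 2 + n ^ 2) * V (similarity m n e q)) q
        = pd i (fun q => (m ^ 2 + n ^ 2) * (-n) * pd 0 V (similarity m n e q)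
          + (m ^ 2 + n ^ 2) * m * pd 1 V (similarity m n e q)) q := fun q hq i =>
    pd_congr hU' (fun q hq => by
      rw [(pd_comp_similarity (dd hR.smooth_V q hq) _).2]; ring) hq i
  refine ⟨hU', ?_, sm _ hR.smooth_h, sm _ hR.smooth_f, sm _ hR.smooth_V,
    transportCoeff_algebraic m n ν hR.algebraic, fun q hq => ?_, fun q hq => ?_, fun q hq => ?_,
    fun q hq => ?_, fun q hq => ?_, fun q hq => ?_, fun q hq => ?_⟩
  · rw [preimage_similarity hr]
    exact hR.isConnected.image _ continuous_similarityInv.continuousOn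
  · rw [(pd_comp_similarity (dd hR.smooth_h q hq) _).1, hR.h₁ _ hq, hR.h₂ _ hq]
    simp [transportCoeff]
    ring
  · rw [(pd_comp_similarity (dd hR.smooth_h q hq) _).2, hR.h₁ _ hq, hR.h₂ _ hq]
    simp [transportCoeff]
    ring
  · rw [(pd_comp_similarity (dd hR.smooth_f q hq) _).1]
    simp [transportCoeff]
    linear_combination (ν ^ 2 * (m ^ 2 + n ^ 2) ^ 4) * (m * hR.f₁ _ hq + n * hR.f₂ _ hq)
  · rw [(pd_comp_similarity (dd hR.smooth_f q hq) _).2]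
    simp [transportCoeff]
    linear_combination (ν ^ 2 * (m ^ 2 + n ^ 2) ^ 4) * (-n * hR.f₁ _ hq + m * hR.f₂ _ hq)
  all_goals
    have c1 := pd_comp_similarity (dd hR.smooth_V q hq) (m ^ 2 + n ^ 2)
    have c2 := fun a => pd_comp_similarity (dV 0 q hq) a
    have c3 := fun a => pd_comp_similarity (dV 1 q hq) a
    have c4 := pd_comm hU hR.smooth_V hq 1 0
    have e1 := hR.V₁₁ _ hq
    have e2 := hR.V₁₂ _ hq
    have e3 := hR.V₂₂ _ hq
    obtain ⟨s1, s2, -, -, -, -⟩ := hR.algebraic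
    simp only [p0 q hq, p1 q hq, pd_add (dcomp 0 q hq _) (dcomp 1 q hq _), (c2 _).1, (c2 _).2,
      (c3 _).1, (c3 _).2, c1.1, c1.2, c4]
    simp [transportCoeff]
  · linear_combination (ν * (m ^ 2 + n ^ 2) ^ 2) *
      (m ^ 2 * e1 + 2 * m * n * e2 + n ^ 2 * e3)
  · linear_combination (ν * (m ^ 2 + n ^ 2) ^ 2) *
      (-m * n * e1 + (m ^ 2 - n ^ 2) * e2 + m * n * e3)
  · linear_combination (ν * (m ^ 2 + n ^ 2) ^ 2) *
      (n ^ 2 * e1 - 2 * m * n * e2 + m ^ 2 * e3)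

end BiHam

/-! ### Transported data are equivalent data. -/

namespace BiHam

/-- The linear part of the inverse of a similarity, as a matrix. -/
noncomputable def similarityInvMatrix (m n : ℝ) : Matrix (Fin 2) (Fin 2) ℝ :=
  !![m / (m ^ 2 + n ^ 2), n / (m ^ 2 + n ^ 2); -n / (m ^ 2 + n ^ 2), m / (m ^ 2 + n ^ 2)]

section

variable {m n : ℝ} {e : Plane}

theorem similarityInvMatrix_mulVec (q : Plane) :
    similarityInvMatrix m n *ᵥ q + similarityInvMatrix m n *ᵥ (-e) = similarityInv m n e q := by
  ext i
  fin_cases i <;>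
    simp [similarityInvMatrix, similarityInv, dotProduct, Fin.sum_univ_two] <;> ring

theorem det_similarityInvMatrix (hr : m ^ 2 + n ^ 2 ≠ 0) :
    (similarityInvMatrix m n).det = 1 / (m ^ 2 + n ^ 2) := by
  simp [similarityInvMatrix, Matrix.det_fin_two]
  field_simp
  ring

theorem transpose_similarityInvMatrix_inv (hr : m ^ 2 + n ^ 2 ≠ 0) :
    ((similarityInvMatrix m n)ᵀ)⁻¹ = !![m, n; -n, m] := by
  refine Matrix.inv_eq_right_inv ?_
  ext i j
  fin_cases i <;> fin_cases j <;>
    simp [similarityInvMatrix, Matrix.mul_apply, Fin.sum_univ_two] <;> field_simp <;> ring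

theorem pointTransform_similarityInvMatrix (hr : m ^ 2 + n ^ 2 ≠ 0) (z : Phase) :
    pointTransform (similarityInvMatrix m n) (similarityInvMatrix m n *ᵥ (-e)) z =
      join (similarityInv m n e (position z)) ![m * z 2 + n * z 3, -n * z 2 + m * z 3] := by
  rw [pointTransform, similarityInvMatrix_mulVec, transpose_similarityInvMatrix_inv hr]
  congr 1
  ext i
  fin_cases i <;> simp [Matrix.mulVec, dotProduct, momentum]

theorem grad_affine_coord (i j : Fin 4) (a b d : ℝ) (z : Phase) :
    grad (fun w => a * w i + b * w j + d) z = a • Pi.single i 1 + b • Pi.single j 1 := by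
  rw [grad_add (by fun_prop) (by fun_prop), grad_add (by fun_prop) (by fun_prop),
    grad_const_mul _ (by fun_prop), grad_const_mul _ (by fun_prop), grad_coord, grad_coord,
    grad_const, add_zero]

theorem jacobian_similarityInvMatrix (hr : m ^ 2 + n ^ 2 ≠ 0) (z : Phase) :
    jacobian (pointTransform (similarityInvMatrix m n) (similarityInvMatrix m n *ᵥ (-e))) z =
      !![m / (m ^ 2 + n ^ 2), n / (m ^ 2 + n ^ 2), 0, 0;
        -n / (m ^ 2 + n ^ 2), m / (m ^ 2 + n ^ 2), 0, 0;
        0, 0, m, n;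
        0, 0, -n, m] := by
  have f0 : (fun w => pointTransform (similarityInvMatrix m n)
      (similarityInvMatrix m n *ᵥ (-e)) w 0) = fun w => m / (m ^ 2 + n ^ 2) * w 0
        + n / (m ^ 2 + n ^ 2) * w 1 + -(m * e 0 + n * e 1) / (m ^ 2 + n ^ 2) := by
    funext w
    rw [pointTransform_similarityInvMatrix hr]
    simp [join, similarityInv, position]
    ring
  have f1 : (fun w => pointTransform (similarityInvMatrix m n)
      (similarityInvMatrix m n *ᵥ (-e)) w 1) = fun w => -n / (m ^ 2 + n ^ 2) * w 0
        + m / (m ^ 2 + n ^ 2) * w 1 + -(-n * e 0 + m * e 1) / (m ^ 2 + n ^ 2) := by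
    funext w
    rw [pointTransform_similarityInvMatrix hr]
    simp [join, similarityInv, position]
    ring
  have f2 : (fun w => pointTransform (similarityInvMatrix m n)
      (similarityInvMatrix m n *ᵥ (-e)) w 2) = fun w => m * w 2 + n * w 3 + 0 := by
    funext w
    rw [pointTransform_similarityInvMatrix hr]
    simp [join]
  have f3 : (fun w => pointTransform (similarityInvMatrix m n)
      (similarityInvMatrix m n *ᵥ (-e)) w 3) = fun w => -n * w 2 + m * w 3 + 0 := by
    funext w
    rw [pointTransform_similarityInvMatrix hr]
    simp [join]
  ext i j
  rw [jacobian, Matrix.of_apply]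
  fin_cases i
  · change grad (fun w => pointTransform (similarityInvMatrix m n)
      (similarityInvMatrix m n *ᵥ (-e)) w 0) z j = _
    rw [f0, grad_affine_coord]
    fin_cases j <;> simp
  · change grad (fun w => pointTransform (similarityInvMatrix m n)
      (similarityInvMatrix m n *ᵥ (-e)) w 1) z j = _
    rw [f1, grad_affine_coord]
    fin_cases j <;> simp
  · change grad (fun w => pointTransform (similarityInvMatrix m n)
      (similarityInvMatrix m n *ᵥ (-e)) w 2) z j = _
    rw [f2, grad_affine_coord]
    fin_cases j <;> simp
  · change grad (fun w => pointTransform (similarityInvMatrix m n)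
      (similarityInvMatrix m n *ᵥ (-e)) w 3) z j = _
    rw [f3, grad_affine_coord]
    fin_cases j <;> simp

end

/-- The tensor with the blocks of `P'`. -/
def blockTensor (a b₁₁ b₁₂ b₂₁ b₂₂ f : ℝ) : Matrix (Fin 4) (Fin 4) ℝ :=
  !![0, a, b₁₁, b₁₂; -a, 0, b₂₁, b₂₂; -b₁₁, -b₂₁, 0, f; -b₁₂, -b₂₂, -f, 0]

theorem blockTensor_transform {m n : ℝ} (hr : m ^ 2 + n ^ 2 ≠ 0) (ν a b₁₁ b₁₂ b₂₁ b₂₂ f : ℝ) :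
    ((m ^ 2 + n ^ 2) ^ 2 * ν) • (!![m / (m ^ 2 + n ^ 2), n / (m ^ 2 + n ^ 2), 0, 0;
        -n / (m ^ 2 + n ^ 2), m / (m ^ 2 + n ^ 2), 0, 0; 0, 0, m, n; 0, 0, -n, m]
      * blockTensor a b₁₁ b₁₂ b₂₁ b₂₂ f * !![m / (m ^ 2 + n ^ 2), n / (m ^ 2 + n ^ 2), 0, 0;
        -n / (m ^ 2 + n ^ 2), m / (m ^ 2 + n ^ 2), 0, 0; 0, 0, m, n; 0, 0, -n, m]ᵀ)
      = blockTensor (ν * (m ^ 2 + n ^ 2) * a)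
        (ν * (m ^ 2 + n ^ 2) * (m ^ 2 * b₁₁ + m * n * b₁₂ + m * n * b₂₁ + n ^ 2 * b₂₂))
        (ν * (m ^ 2 + n ^ 2) * (-(m * n) * b₁₁ + m ^ 2 * b₁₂ - n ^ 2 * b₂₁ + m * n * b₂₂))
        (ν * (m ^ 2 + n ^ 2) * (-(m * n) * b₁₁ - n ^ 2 * b₁₂ + m ^ 2 * b₂₁ + m * n * b₂₂))
        (ν * (m ^ 2 + n ^ 2) * (n ^ 2 * b₁₁ - m * n * b₁₂ - m * n * b₂₁ + m ^ 2 * b₂₂))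
        (ν * (m ^ 2 + n ^ 2) ^ 3 * f) := by
  ext i j
  rw [Matrix.smul_apply]
  simp only [Matrix.mul_apply, Fin.sum_univ_four, Matrix.transpose_apply, smul_eq_mul,
    blockTensor]
  fin_cases i <;> fin_cases j <;> simp [-mul_eq_mul_left_iff, -mul_eq_zero] <;> field_simp <;> ring

/-- The point transformation is the inverse of the similarity, because the new data are pullbacks.
No condition on `H₂` is needed beyond its being the cubic integral up to a constant, since
`cubicIntegral` scales by exactly `κ μ`. -/
theorem equivalent_of_transport {S T : Data} (hR : ReducedSystem S.U S.c S.h S.f S.V)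
    {m n ν : ℝ} {e : Plane} (hr : m ^ 2 + n ^ 2 ≠ 0) (hν : ν ≠ 0) {k k₁ k₂ : ℝ}
    (hTU : T.U = similarity m n e ⁻¹' S.U) (hTc : T.c = transportCoeff m n ν S.c)
    (hTh : ∀ q ∈ T.U, T.h q = ν * (m ^ 2 + n ^ 2) * S.h (similarity m n e q))
    (hTf : ∀ q ∈ T.U, T.f q = ν * (m ^ 2 + n ^ 2) ^ 3 * S.f (similarity m n e q))
    (hTV : ∀ q ∈ T.U, T.V q = (m ^ 2 + n ^ 2) * S.V (similarity m n e q) + k)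
    (hS₂ : ∀ z ∈ S.phaseDomain, S.H₂ z = cubicIntegral S.c S.h S.V z + k₁)
    (hT₂ : ∀ z ∈ T.phaseDomain, T.H₂ z = cubicIntegral T.c T.h T.V z + k₂) :
    Equivalent S T := by
  have hU := hR.isOpen
  have hV := hR.smooth_V
  obtain ⟨s1, s2, -, -, -, -⟩ := hR.algebraic
  have hTo : IsOpen T.U := by
    rw [hTU]; exact hU.preimage (contDiff_similarity m n e).continuous
  -- The factors are `μ = (m ^ 2 + n ^ 2) ^ 2 * ν` and `κ = m ^ 2 + n ^ 2`; the last constant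
  -- corrects for the two additive constants in the second integrals.
  refine ⟨similarityInvMatrix m n, similarityInvMatrix m n *ᵥ (-e), (m ^ 2 + n ^ 2) ^ 2 * ν,
    m ^ 2 + n ^ 2, k, k₂ - (m ^ 2 + n ^ 2) * ((m ^ 2 + n ^ 2) ^ 2 * ν) * k₁, ?_,
    mul_ne_zero (pow_ne_zero 2 hr) hν, hr, ?_, ?_⟩
  · rw [det_similarityInvMatrix hr]
    exact (one_div_ne_zero hr).isUnit
  · rw [hTU, preimage_similarity hr]
    simp only [similarityInvMatrix_mulVec]
  intro z hz
  have hinv : similarity m n e (similarityInv m n e (position z)) = position z :=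
    similarity_similarityInv hr _
  have hq : similarityInv m n e (position z) ∈ T.U := by
    rw [hTU, Set.mem_preimage, hinv]; exact hz
  have dV : DifferentiableAt ℝ S.V (similarity m n e (similarityInv m n e (position z))) := by
    rw [hinv]; exact differentiableAt_of_contDiffOn hU hV hz
  have eh := hTh _ hq
  have ef := hTf _ hq
  have eV := hTV _ hq
  have ep : ∀ i, pd i T.V (similarityInv m n e (position z))
      = pd i (fun q => (m ^ 2 + n ^ 2) * S.V (similarity m n e q))
        (similarityInv m n e (position z)) := by
    intro i
    rw [pd_congr hTo hTV hq i, pd_add _ (differentiableAt_const k), pd_const, add_zero]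
    exact ((dV.hasFDerivAt.comp _ (hasFDerivAt_similarity m n e _)).const_mul _).differentiableAt
  have ep0 := (ep 0).trans (pd_comp_similarity dV _).1
  have ep1 := (ep 1).trans (pd_comp_similarity dV _).2
  rw [hinv] at eh ef eV ep0 ep1
  have hzT : join (similarityInv m n e (position z)) ![m * z 2 + n * z 3, -n * z 2 + m * z 3]
      ∈ T.phaseDomain := by
    simpa [Data.phaseDomain, position_join] using hq
  rw [pointTransform_similarityInvMatrix hr, jacobian_similarityInvMatrix hr]
  refine ⟨?_, ?_, ?_⟩
  · change blockTensor _ _ _ _ _ _ = _ • (_ * blockTensor _ _ _ _ _ _ * _)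
    rw [blockTensor_transform hr, position_join, eh, ef, hTc]
    congr 1 <;> simp [transportCoeff, join] <;> ring
  · simp [Data.H₁, position_join, eV]
    simp [join]
    ring
  · rw [hT₂ _ hzT, hS₂ z hz]
    simp [cubicIntegral, position_join, eh, ep0, ep1, hTc, transportCoeff, s1, s2]
    simp [join]
    ring

end BiHam

/-! ### The normal forms satisfy the reduced system. -/

namespace BiHam

/-- The function `g` is differentiable at `q` with the partial derivatives `a` and `b`. -/
def HasGrad (g : Plane → ℝ) (a b : ℝ) (q : Plane) : Prop :=
  HasFDerivAt g (a • ContinuousLinearMap.proj (R := ℝ) (φ := fun _ : Fin 2 => ℝ) 0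
    + b • ContinuousLinearMap.proj (R := ℝ) (φ := fun _ : Fin 2 => ℝ) 1) q

namespace HasGrad

variable {g g' : Plane → ℝ} {a b a' b' : ℝ} {q : Plane}

theorem of_eq (h : HasGrad g a b q) (ha : a = a') (hb : b = b') : HasGrad g a' b' q := by
  rwa [← ha, ← hb]

theorem pd_zero (h : HasGrad g a b q) : pd 0 g q = a := by
  rw [HasFDerivAt.pd_eq h]; simp

theorem pd_one (h : HasGrad g a b q) : pd 1 g q = b := by
  rw [HasFDerivAt.pd_eq h]; simp

theorem congr_on {U : Set Plane} (hU : IsOpen U) (hq : q ∈ U) (h : HasGrad g a b q)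
    (e : ∀ q ∈ U, g' q = g q) : HasGrad g' a b q :=
  HasFDerivAt.congr_of_eventuallyEq h (Filter.eventuallyEq_of_mem (hU.mem_nhds hq) e)

theorem const (x : ℝ) : HasGrad (fun _ => x) 0 0 q := by
  simpa [HasGrad] using hasFDerivAt_const x q

theorem coord_zero : HasGrad (fun q => q 0) 1 0 q := by
  have := (ContinuousLinearMap.proj (R := ℝ) (φ := fun _ : Fin 2 => ℝ) 0).hasFDerivAt (x := q)
  exact this.congr_fderiv (by simp)

theorem coord_one : HasGrad (fun q => q 1) 0 1 q := by
  have := (ContinuousLinearMap.proj (R := ℝ) (φ := fun _ : Fin 2 => ℝ) 1).hasFDerivAt (x := q)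
  exact this.congr_fderiv (by simp)

theorem add (h : HasGrad g a b q) (h' : HasGrad g' a' b' q) :
    HasGrad (fun q => g q + g' q) (a + a') (b + b') q := by
  refine (HasFDerivAt.fun_add h h').congr_fderiv ?_
  ext v
  simp
  ring

theorem mul (h : HasGrad g a b q) (h' : HasGrad g' a' b' q) :
    HasGrad (fun q => g q * g' q) (a * g' q + g q * a') (b * g' q + g q * b') q := by
  refine (HasFDerivAt.fun_mul h h').congr_fderiv ?_
  ext v
  simp
  ring

theorem const_mul (x : ℝ) (h : HasGrad g a b q) : HasGrad (fun q => x * g q) (x * a) (x * b) q :=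
  ((const x).mul h).of_eq (by ring) (by ring)

theorem sub (h : HasGrad g a b q) (h' : HasGrad g' a' b' q) :
    HasGrad (fun q => g q - g' q) (a - a') (b - b') q := by
  refine (HasFDerivAt.fun_sub h h').congr_fderiv ?_
  ext v
  simp
  ring

theorem comp {φ : ℝ → ℝ} {φ' : ℝ} (hφ : HasDerivAt φ φ' (g q)) (h : HasGrad g a b q) :
    HasGrad (fun q => φ (g q)) (φ' * a) (φ' * b) q := by
  refine (hφ.comp_hasFDerivAt q h).congr_fderiv ?_
  ext v
  simp
  ring

theorem pow (n : ℕ) (h : HasGrad g a b q) :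
    HasGrad (fun q => g q ^ n) (n * g q ^ (n - 1) * a) (n * g q ^ (n - 1) * b) q :=
  comp (hasDerivAt_pow n (g q)) h

/-- An inverse power of `q₁`, off the line `q₁ = 0` or with the factor zero. -/
theorem div_pow (x : ℝ) (n : ℕ) (h : q 0 ≠ 0 ∨ x = 0) :
    HasGrad (fun q => x / q 0 ^ n) (-(n * x) / q 0 ^ (n + 1)) 0 q := by
  rcases h with h | h
  · have hd : HasDerivAt (fun t : ℝ => x / t ^ n) (-(n * x) / q 0 ^ (n + 1)) (q 0) := by
      have := (hasDerivAt_const (q 0) x).fun_div (hasDerivAt_pow n (q 0)) (pow_ne_zero n h)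
      refine this.congr_deriv ?_
      rcases n with _ | n
      · simp
      · field_simp
        simp
        ring
    exact of_eq (comp (g := fun q => q 0) hd coord_zero) (mul_one _) (mul_zero _)
  · subst h
    simpa using const (q := q) 0

theorem rpow (r : ℝ) (h : 0 < q 0) :
    HasGrad (fun q => q 0 ^ r) (r * q 0 ^ (r - 1)) 0 q :=
  (comp (Real.hasDerivAt_rpow_const (Or.inl h.ne')) coord_zero).of_eq (by ring) (by ring)

theorem exp_linear (α β : ℝ) : HasGrad (fun q => Real.exp (α * q 0 + β * q 1))
    (α * Real.exp (α * q 0 + β * q 1)) (β * Real.exp (α * q 0 + β * q 1)) q :=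
  (comp (Real.hasDerivAt_exp _) ((coord_zero.const_mul α).add (coord_one.const_mul β))).of_eq
    (by ring) (by ring)

theorem of_pd {U : Set Plane} (hU : IsOpen U) (hg : ContDiffOn ℝ ∞ g U) (hq : q ∈ U)
    (h0 : pd 0 g q = a) (h1 : pd 1 g q = b) : HasGrad g a b q := by
  refine (differentiableAt_of_contDiffOn hU hg hq).hasFDerivAt.congr_fderiv ?_
  ext v
  simp [fderiv_eq_pd, h0, h1]
  ring

end HasGrad

theorem exists_const_of_hasGrad_zero {U : Set Plane} {g : Plane → ℝ} (hU : IsOpen U)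
    (hc : IsConnected U) (h : ∀ q ∈ U, HasGrad g 0 0 q) : ∃ k, ∀ q ∈ U, g q = k :=
  exists_const_of_pd_eq_zero hU hc
    (fun q hq => (HasFDerivAt.differentiableAt (h q hq)).differentiableWithinAt)
    (fun q hq => (h q hq).pd_zero) fun q hq => (h q hq).pd_one

theorem reducedSystem_of_hasGrad {U : Set Plane} {c : Fin 8 → ℝ} {h f V : Plane → ℝ}
    (hU : IsOpen U) (hc : IsConnected U) (sh : ContDiffOn ℝ ∞ h U) (sf : ContDiffOn ℝ ∞ f U)
    (sV : ContDiffOn ℝ ∞ V U) (ha : AlgebraicRelations c)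
    {f₁ f₂ V₁ V₂ V₁₁ V₁₂ V₂₂ : Plane → ℝ}
    (hh : ∀ q ∈ U, HasGrad h (c 4 - c 1) (c 6 - c 3) q)
    (hf : ∀ q ∈ U, HasGrad f (f₁ q) (f₂ q) q)
    (hV : ∀ q ∈ U, HasGrad V (V₁ q) (V₂ q) q)
    (hV₁ : ∀ q ∈ U, HasGrad V₁ (V₁₁ q) (V₁₂ q) q)
    (hV₂ : ∀ q ∈ U, HasGrad V₂ (V₁₂ q) (V₂₂ q) q)
    (ef₁ : ∀ q ∈ U, h q * f₁ q = -(c 4 + c 7) * f q)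
    (ef₂ : ∀ q ∈ U, h q * f₂ q = (c 0 + c 3) * f q)
    (eV₁₁ : ∀ q ∈ U, h q * V₁₁ q = (c 7 - c 4 + c 1) * V₁ q - c 5 * V₂ q + 2 * f q)
    (eV₁₂ : ∀ q ∈ U, h q * V₁₂ q = -c 6 * V₁ q + c 1 * V₂ q)
    (eV₂₂ : ∀ q ∈ U, h q * V₂₂ q = c 2 * V₁ q + (c 3 - c 0 - c 6) * V₂ q + 2 * f q) :
    ReducedSystem U c h f V := by
  have p0 : ∀ q ∈ U, pd 0 V q = V₁ q := fun q hq => (hV q hq).pd_zero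
  have p1 : ∀ q ∈ U, pd 1 V q = V₂ q := fun q hq => (hV q hq).pd_one
  refine ⟨hU, hc, sh, sf, sV, ha, fun q hq => (hh q hq).pd_zero, fun q hq => (hh q hq).pd_one,
    fun q hq => ?_, fun q hq => ?_, fun q hq => ?_, fun q hq => ?_, fun q hq => ?_⟩
  · rw [(hf q hq).pd_zero, ef₁ q hq]
  · rw [(hf q hq).pd_one, ef₂ q hq]
  · rw [pd_congr hU p0 hq, (hV₁ q hq).pd_zero, p0 q hq, p1 q hq, eV₁₁ q hq]
  · rw [pd_congr hU p1 hq, (hV₂ q hq).pd_zero, p0 q hq, p1 q hq, eV₁₂ q hq]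
  · rw [pd_congr hU p1 hq, (hV₂ q hq).pd_one, p0 q hq, p1 q hq, eV₂₂ q hq]

theorem contDiffOn_div_pow {U : Set Plane} (x : ℝ) (n : ℕ) (h : ∀ q ∈ U, q 0 ≠ 0 ∨ x = 0) :
    ContDiffOn ℝ ∞ (fun q : Plane => x / q 0 ^ n) U := by
  by_cases hx : x = 0
  · subst hx
    simpa using contDiffOn_const
  · exact contDiffOn_const.div ((contDiff_apply ℝ ℝ 0).pow n).contDiffOn
      fun q hq => pow_ne_zero n ((h q hq).resolve_right hx)

namespace NormalForm

variable {b C₁ C₂ : ℝ} {q : Plane}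

theorem hasGrad_V_toda : HasGrad (V ⟨.toda, b, C₁, C₂⟩)
    (-(2 * b / 3) * Real.exp (q 0) - C₁ / 2 * Real.exp (-(q 0) / 2 + √3 * q 1 / 2)
      - C₂ / 2 * Real.exp (-(q 0) / 2 - √3 * q 1 / 2))
    (√3 / 2 * C₁ * Real.exp (-(q 0) / 2 + √3 * q 1 / 2)
      - √3 / 2 * C₂ * Real.exp (-(q 0) / 2 - √3 * q 1 / 2)) q := by
  have e : V ⟨.toda, b, C₁, C₂⟩ = fun q => (-(2 * b / 3) * Real.exp (1 * q 0 + 0 * q 1)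
      + C₁ * Real.exp (-1 / 2 * q 0 + √3 / 2 * q 1))
      + C₂ * Real.exp (-1 / 2 * q 0 + -√3 / 2 * q 1) := by
    funext q
    simp only [V]
    ring_nf
  rw [e]
  refine ((((HasGrad.exp_linear 1 0).const_mul _).add ((HasGrad.exp_linear _ _).const_mul C₁)).add
    ((HasGrad.exp_linear _ _).const_mul C₂)).of_eq ?_ ?_ <;> ring_nf

theorem reduced_toda {U : Set Plane} (hU : IsOpen U) (hc : IsConnected U) :
    ReducedSystem U (c ⟨.toda, b, C₁, C₂⟩) (h ⟨.toda, b, C₁, C₂⟩) (f ⟨.toda, b, C₁, C₂⟩)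
      (V ⟨.toda, b, C₁, C₂⟩) := by
  have h3 : √3 * √3 = 3 := Real.mul_self_sqrt (by norm_num)
  have E : ∀ (α β : ℝ) (q : Plane), HasGrad (fun q => Real.exp (α * q 0 + β * q 1))
    (α * Real.exp (α * q 0 + β * q 1)) (β * Real.exp (α * q 0 + β * q 1)) q :=
    fun α β q => HasGrad.exp_linear α β
  have E0 : ∀ q : Plane, HasGrad (fun q => Real.exp (q 0)) (Real.exp (q 0)) 0 q := fun q =>
    (HasGrad.comp (Real.hasDerivAt_exp _) HasGrad.coord_zero).of_eq (by ring) (by ring)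
  have E1 : ∀ q : Plane, HasGrad (fun q => Real.exp (-(q 0) / 2 + √3 * q 1 / 2))
      (-1 / 2 * Real.exp (-(q 0) / 2 + √3 * q 1 / 2))
      (√3 / 2 * Real.exp (-(q 0) / 2 + √3 * q 1 / 2)) q := by
    intro q
    have e : ∀ q : Plane, -1 / 2 * q 0 + √3 / 2 * q 1 = -(q 0) / 2 + √3 * q 1 / 2 := fun q => by
      ring
    simpa only [e] using E (-1 / 2) (√3 / 2) q
  have E2 : ∀ q : Plane, HasGrad (fun q => Real.exp (-(q 0) / 2 - √3 * q 1 / 2))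
      (-1 / 2 * Real.exp (-(q 0) / 2 - √3 * q 1 / 2))
      (-√3 / 2 * Real.exp (-(q 0) / 2 - √3 * q 1 / 2)) q := by
    intro q
    have e : ∀ q : Plane, -1 / 2 * q 0 + -√3 / 2 * q 1 = -(q 0) / 2 - √3 * q 1 / 2 := fun q => by
      ring
    simpa only [e] using E (-1 / 2) (-√3 / 2) q
  refine reducedSystem_of_hasGrad hU hc ?_ ?_ ?_ ?_
    (f₁ := fun q => b * Real.exp (q 0)) (f₂ := fun q => 0)
    (V₁ := fun q => -(2 * b / 3) * Real.exp (q 0)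
      - C₁ / 2 * Real.exp (-(q 0) / 2 + √3 * q 1 / 2)
      - C₂ / 2 * Real.exp (-(q 0) / 2 - √3 * q 1 / 2))
    (V₂ := fun q => √3 / 2 * C₁ * Real.exp (-(q 0) / 2 + √3 * q 1 / 2)
      - √3 / 2 * C₂ * Real.exp (-(q 0) / 2 - √3 * q 1 / 2))
    (V₁₁ := fun q => -(2 * b / 3) * Real.exp (q 0)
      + C₁ / 4 * Real.exp (-(q 0) / 2 + √3 * q 1 / 2)
      + C₂ / 4 * Real.exp (-(q 0) / 2 - √3 * q 1 / 2))
    (V₁₂ := fun q => -√3 / 4 * C₁ * Real.exp (-(q 0) / 2 + √3 * q 1 / 2)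
      + √3 / 4 * C₂ * Real.exp (-(q 0) / 2 - √3 * q 1 / 2))
    (V₂₂ := fun q => 3 / 4 * C₁ * Real.exp (-(q 0) / 2 + √3 * q 1 / 2)
      + 3 / 4 * C₂ * Real.exp (-(q 0) / 2 - √3 * q 1 / 2))
    ?_ ?_ ?_ ?_ ?_ ?_ ?_ ?_ ?_ ?_
  · exact contDiffOn_const
  · unfold f; fun_prop
  · unfold V; fun_prop
  · constructor <;> simp [c]; norm_num
  · exact fun q _ => (HasGrad.const _).of_eq (by simp [c]) (by simp [c])
  · exact fun q _ => ((E0 q).const_mul b).of_eq rfl (by ring)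
  · exact fun q _ => hasGrad_V_toda
  · exact fun q _ => ((((E0 q).const_mul _).sub ((E1 q).const_mul _)).sub
      ((E2 q).const_mul _)).of_eq (by ring) (by ring)
  · exact fun q _ => (((E1 q).const_mul _).sub ((E2 q).const_mul _)).of_eq (by ring)
      (by linear_combination (C₁ / 4 * Real.exp (-(q 0) / 2 + √3 * q 1 / 2)
        + C₂ / 4 * Real.exp (-(q 0) / 2 - √3 * q 1 / 2)) * h3)
  all_goals
    intro q _
    simp [h, f, c]
    try ring

theorem hasGrad_V_calogeroA (h : q 0 ≠ 0 ∨ C₂ = 0) : HasGrad (V ⟨.calogeroA, b, C₁, C₂⟩)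
    (b / 2 * q 0 + (-2 * C₂) / q 0 ^ 3) (2 * b * q 1 + C₁) q := by
  have e : V ⟨.calogeroA, b, C₁, C₂⟩ = fun q => b * (1 / 4 * q 0 ^ 2 + q 1 ^ 2) + C₁ * q 1
      + C₂ / q 0 ^ 2 := by
    funext q; simp only [V]; ring
  rw [e]
  refine ((((((HasGrad.coord_zero.pow 2).const_mul _).add (HasGrad.coord_one.pow 2)).const_mul
    b).add (HasGrad.coord_one.const_mul C₁)).add (HasGrad.div_pow C₂ 2 h)).of_eq ?_ ?_ <;>
    norm_num <;> ring

theorem hasGrad_V_calogeroB (h : q 0 ≠ 0 ∨ b = 0) : HasGrad (V ⟨.calogeroB, b, C₁, C₂⟩)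
    (C₁ / 2 * q 0 + (-b / 2) / q 0 ^ 3) (2 * C₁ * q 1 + C₂) q := by
  have e : V ⟨.calogeroB, b, C₁, C₂⟩ = fun q => (b / 4) / q 0 ^ 2
      + C₁ * (q 1 ^ 2 + 1 / 4 * q 0 ^ 2) + C₂ * q 1 := by
    funext q; simp only [V]; rw [div_div]; ring
  rw [e]
  refine (((HasGrad.div_pow (b / 4) 2 (h.imp_right fun h => by rw [h]; ring)).add
    (((HasGrad.coord_one.pow 2).add ((HasGrad.coord_zero.pow 2).const_mul _)).const_mul C₁)).add
    (HasGrad.coord_one.const_mul C₂)).of_eq ?_ ?_ <;>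
    norm_num <;> ring

/-- With the quotient split into powers of `q 0`, each derivative of `V` only lowers an exponent. -/
theorem V_holt_eq (h0 : 0 < q 0) : V ⟨.holt, b, C₁, C₂⟩ q = 3 * b / 4 * q 0 ^ (4 / 3 : ℝ)
    + (b * q 1 ^ 2 + C₁ / 4 * q 1 + C₂ / 4) * q 0 ^ (-2 / 3 : ℝ) := by
  have e1 : q 0 ^ (4 / 3 : ℝ) = q 0 ^ 2 * q 0 ^ (-2 / 3 : ℝ) := by
    rw [← Real.rpow_natCast, ← Real.rpow_add h0]; norm_num
  have e2 : q 0 ^ (-2 / 3 : ℝ) = (q 0 ^ (2 / 3 : ℝ))⁻¹ := by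
    rw [← Real.rpow_neg h0.le]; norm_num
  have := (Real.rpow_pos_of_pos h0 (2 / 3)).ne'
  simp only [V]
  rw [e1, e2]
  field_simp
  ring

theorem hasGrad_V_holt (h0 : 0 < q 0) : HasGrad (V ⟨.holt, b, C₁, C₂⟩)
    (b * q 0 ^ (1 / 3 : ℝ)
      + -2 / 3 * ((b * q 1 ^ 2 + C₁ / 4 * q 1 + C₂ / 4) * q 0 ^ (-2 / 3 - 1 : ℝ)))
    ((2 * b * q 1 + C₁ / 4) * q 0 ^ (-2 / 3 : ℝ)) q := by
  refine (((((HasGrad.rpow _ h0).const_mul _).add (((((HasGrad.coord_one.pow 2).const_mul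
    b).add (HasGrad.coord_one.const_mul (C₁ / 4))).add (HasGrad.const (C₂ / 4))).mul
    (HasGrad.rpow _ h0)))).congr_on (isOpen_lt continuous_const (continuous_apply 0)) h0
    fun _ => V_holt_eq).of_eq ?_ ?_
  · norm_num; ring
  · norm_num; left; ring

theorem reduced_calogeroA {U : Set Plane} (hU : IsOpen U) (hc : IsConnected U)
    (hD : U ⊆ domain ⟨.calogeroA, b, C₁, C₂⟩) :
    ReducedSystem U (c ⟨.calogeroA, b, C₁, C₂⟩) (h ⟨.calogeroA, b, C₁, C₂⟩)
      (f ⟨.calogeroA, b, C₁, C₂⟩) (V ⟨.calogeroA, b, C₁, C₂⟩) := by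
  have hD' : ∀ q ∈ U, q 0 ≠ 0 ∨ C₂ = 0 := fun q hq => hD hq
  refine reducedSystem_of_hasGrad hU hc ?_ ?_ ?_ ?_
    (f₁ := fun q => b) (f₂ := fun q => 0)
    (V₁ := fun q => b / 2 * q 0 + (-2 * C₂) / q 0 ^ 3)
    (V₂ := fun q => 2 * b * q 1 + C₁)
    (V₁₁ := fun q => b / 2 + 6 * C₂ / q 0 ^ 4)
    (V₁₂ := fun q => 0)
    (V₂₂ := fun q => 2 * b)
    ?_ ?_ ?_ ?_ ?_ ?_ ?_ ?_ ?_ ?_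
  · unfold h; fun_prop
  · unfold f; fun_prop
  · have := contDiffOn_div_pow C₂ 2 hD'
    unfold V; fun_prop
  · constructor <;> simp [c]
  · exact fun q _ => HasGrad.coord_zero.of_eq (by simp [c]) (by simp [c])
  · exact fun q _ => (HasGrad.coord_zero.const_mul b).of_eq (by ring) (by ring)
  · exact fun q hq => hasGrad_V_calogeroA (hD' q hq)
  · intro q hq
    refine ((HasGrad.coord_zero.const_mul _).add (HasGrad.div_pow (-2 * C₂) 3 ?_)).of_eq ?_ ?_
    · exact (hD' q hq).imp_right fun h => by rw [h]; ring
    all_goals norm_num <;> ring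
  · exact fun q _ => ((HasGrad.coord_one.const_mul _).add (HasGrad.const _)).of_eq
      (by ring) (by ring)
  all_goals
    intro q hq
    simp [h, f, c]
  · ring
  · rcases hD' q hq with h0 | h0
    · field_simp; ring
    · rw [h0]; ring
  · ring

theorem reduced_calogeroB {U : Set Plane} (hU : IsOpen U) (hc : IsConnected U)
    (hD : U ⊆ domain ⟨.calogeroB, b, C₁, C₂⟩) :
    ReducedSystem U (c ⟨.calogeroB, b, C₁, C₂⟩) (h ⟨.calogeroB, b, C₁, C₂⟩)
      (f ⟨.calogeroB, b, C₁, C₂⟩) (V ⟨.calogeroB, b, C₁, C₂⟩) := by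
  have hD' : ∀ q ∈ U, q 0 ≠ 0 ∨ b = 0 := fun q hq => hD hq
  have hD4 : ∀ q ∈ U, q 0 ≠ 0 ∨ b / 4 = 0 := fun q hq =>
    (hD' q hq).imp_right fun h => by rw [h]; ring
  have e : V ⟨.calogeroB, b, C₁, C₂⟩ = fun q => (b / 4) / q 0 ^ 2
      + C₁ * (q 1 ^ 2 + 1 / 4 * q 0 ^ 2) + C₂ * q 1 := by
    funext q; simp only [V]; rw [div_div]; ring
  refine reducedSystem_of_hasGrad hU hc ?_ ?_ ?_ ?_
    (f₁ := fun q => -3 * b / q 0 ^ 4) (f₂ := fun q => 0)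
    (V₁ := fun q => C₁ / 2 * q 0 + (-b / 2) / q 0 ^ 3)
    (V₂ := fun q => 2 * C₁ * q 1 + C₂)
    (V₁₁ := fun q => C₁ / 2 + 3 / 2 * b / q 0 ^ 4)
    (V₁₂ := fun q => 0)
    (V₂₂ := fun q => 2 * C₁)
    ?_ ?_ ?_ ?_ ?_ ?_ ?_ ?_ ?_ ?_
  · unfold h; fun_prop
  · exact contDiffOn_div_pow b 3 hD'
  · have := contDiffOn_div_pow (b / 4) 2 hD4
    rw [e]; fun_prop
  · constructor <;> simp [c] <;> norm_num
  · exact fun q _ => HasGrad.coord_zero.of_eq (by simp [c]) (by simp [c])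
  · exact fun q hq => (HasGrad.div_pow b 3 (hD' q hq)).of_eq (by norm_num) rfl
  · exact fun q hq => hasGrad_V_calogeroB (hD' q hq)
  · intro q hq
    refine ((HasGrad.coord_zero.const_mul _).add (HasGrad.div_pow (-b / 2) 3 ?_)).of_eq ?_ ?_
    · exact (hD' q hq).imp_right fun h => by rw [h]; ring
    all_goals norm_num <;> ring
  · exact fun q _ => ((HasGrad.coord_one.const_mul _).add (HasGrad.const _)).of_eq
      (by ring) (by ring)
  all_goals
    intro q hq
    simp [h, f, c]
    try
      rcases hD' q hq with h0 | h0
      · field_simp; ring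
      · rw [h0]; ring

theorem reduced_holt {U : Set Plane} (hU : IsOpen U) (hc : IsConnected U)
    (hD : U ⊆ domain ⟨.holt, b, C₁, C₂⟩) :
    ReducedSystem U (c ⟨.holt, b, C₁, C₂⟩) (h ⟨.holt, b, C₁, C₂⟩)
      (f ⟨.holt, b, C₁, C₂⟩) (V ⟨.holt, b, C₁, C₂⟩) := by
  have hD' : ∀ q ∈ U, 0 < q 0 := fun q hq => hD hq
  have cp : ∀ r : ℝ, ContDiffOn ℝ ∞ (fun q : Plane => q 0 ^ r) U := fun r =>
    (contDiff_apply ℝ ℝ 0).contDiffOn.rpow_const_of_ne fun q hq => (hD' q hq).ne'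
  have mulp : ∀ q ∈ U, ∀ r : ℝ, q 0 * q 0 ^ (r - 1) = q 0 ^ r := fun q hq r => by
    rw [Real.rpow_sub_one (hD' q hq).ne']
    field_simp [(hD' q hq).ne']
  refine reducedSystem_of_hasGrad hU hc ?_ ?_ ?_ ?_
    (f₁ := fun q => b * (1 / 3 * q 0 ^ (1 / 3 - 1 : ℝ))) (f₂ := fun q => 0)
    (V₁ := fun q => b * q 0 ^ (1 / 3 : ℝ)
      + -2 / 3 * ((b * q 1 ^ 2 + C₁ / 4 * q 1 + C₂ / 4) * q 0 ^ (-2 / 3 - 1 : ℝ)))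
    (V₂ := fun q => (2 * b * q 1 + C₁ / 4) * q 0 ^ (-2 / 3 : ℝ))
    (V₁₁ := fun q => b * (1 / 3 * q 0 ^ (1 / 3 - 1 : ℝ))
      + 10 / 9 * ((b * q 1 ^ 2 + C₁ / 4 * q 1 + C₂ / 4) * q 0 ^ (-2 / 3 - 1 - 1 : ℝ)))
    (V₁₂ := fun q => (2 * b * q 1 + C₁ / 4) * (-2 / 3 * q 0 ^ (-2 / 3 - 1 : ℝ)))
    (V₂₂ := fun q => 2 * b * q 0 ^ (-2 / 3 : ℝ))
    ?_ ?_ ?_ ?_ ?_ ?_ ?_ ?_ ?_ ?_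
  · unfold h; fun_prop
  · exact contDiffOn_const.mul (cp _)
  · have c1 := cp (4 / 3)
    have c2 := cp (-2 / 3)
    refine ContDiffOn.congr ?_ fun q hq => V_holt_eq (hD' q hq)
    fun_prop
  · constructor <;> simp [c] <;> norm_num
  · exact fun q _ => HasGrad.coord_zero.of_eq (by simp [c]; norm_num) (by simp [c])
  · exact fun q hq => ((HasGrad.rpow _ (hD' q hq)).const_mul b).of_eq rfl (by ring)
  · exact fun q hq => hasGrad_V_holt (hD' q hq)
  · intro q hq
    refine (((HasGrad.rpow _ (hD' q hq)).const_mul b).add ((((((HasGrad.coord_one.pow 2).const_mul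
      b).add (HasGrad.coord_one.const_mul (C₁ / 4))).add (HasGrad.const (C₂ / 4))).mul
      (HasGrad.rpow _ (hD' q hq))).const_mul _)).of_eq ?_ ?_
    · norm_num; ring
    · norm_num; ring
  · intro q hq
    refine ((((HasGrad.coord_one.const_mul (2 * b))).add (HasGrad.const (C₁ / 4))).mul
      (HasGrad.rpow _ (hD' q hq))).of_eq ?_ ?_ <;> ring
  all_goals
    intro q hq
    have m1 := mulp q hq (1 / 3)
    have m2 := mulp q hq (-2 / 3 - 1)
    have m3 := mulp q hq (-2 / 3)
    have m4 : q 0 ^ (1 / 3 - 1 : ℝ) = q 0 ^ (-2 / 3 : ℝ) := by norm_num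
    simp only [h, f, c, Matrix.cons_val, Matrix.cons_val_zero, Matrix.cons_val_one]
  · linear_combination (b / 3) * m1
  · ring
  · linear_combination (b / 3) * m1
      + (10 / 9 * (b * q 1 ^ 2 + C₁ / 4 * q 1 + C₂ / 4)) * m2
  · linear_combination (-2 / 3 * (2 * b * q 1 + C₁ / 4)) * m3
  · linear_combination 2 * b * m1 - 2 * b * q 0 * m4

theorem reduced (F : NormalForm) {U : Set Plane} (hU : IsOpen U) (hc : IsConnected U)
    (hD : U ⊆ F.domain) : ReducedSystem U F.c F.h F.f F.V := by
  obtain ⟨kind, b, C₁, C₂⟩ := F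
  cases kind
  · exact reduced_toda hU hc
  · exact reduced_holt hU hc hD
  · exact reduced_calogeroA hU hc hD
  · exact reduced_calogeroB hU hc hD

theorem c_four_ne_zero (F : NormalForm) : F.c 4 ≠ 0 := by
  obtain ⟨kind, b, C₁, C₂⟩ := F
  cases kind <;> simp [c]

theorem isNontrivialSolution (F : NormalForm) {U : Set Plane} (hU : IsOpen U)
    (hc : IsConnected U) (hD : U ⊆ F.domain) (hV : ¬ ∃ k : ℝ, ∀ q ∈ U, F.V q = k) :
    (F.toData U (cubicIntegral F.c F.h F.V)).IsNontrivialSolution :=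
  Data.isNontrivialSolution_of_reduced (F.reduced hU hc hD) rfl F.c_four_ne_zero hV

theorem hasCubicIntegral (F : NormalForm) {U : Set Plane} (hU : IsOpen U)
    (hc : IsConnected U) (hD : U ⊆ F.domain) :
    (F.toData U (cubicIntegral F.c F.h F.V)).HasCubicIntegral :=
  Data.hasCubicIntegral_of_eq (F.reduced hU hc hD)
    (fun h => F.c_four_ne_zero (congrFun h 4)) (k := 0) fun _ _ => (add_zero _).symm

end NormalForm

end BiHam

/-! ### Integration of the reduced system for each normalized coefficient vector. -/

namespace BiHam

variable {U : Set Plane} {c : Fin 8 → ℝ} {h f V : Plane → ℝ}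

theorem hasGrad_of_contDiffOn {g : Plane → ℝ} (hU : IsOpen U) (hg : ContDiffOn ℝ ∞ g U)
    {q : Plane} (hq : q ∈ U) : HasGrad g (pd 0 g q) (pd 1 g q) q :=
  HasGrad.of_pd hU hg hq rfl rfl

theorem HasGrad.unique {g : Plane → ℝ} {a b a' b' : ℝ} {q : Plane} (h : HasGrad g a b q)
    (h' : HasGrad g a' b' q) : a = a' ∧ b = b' :=
  ⟨h.pd_zero.symm.trans h'.pd_zero, h.pd_one.symm.trans h'.pd_one⟩

theorem ReducedSystem.hasGrad_V₁ (hR : ReducedSystem U c h f V) {q : Plane} (hq : q ∈ U) :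
    HasGrad (pd 0 V) (pd 0 (pd 0 V) q) (pd 0 (pd 1 V) q) q :=
  HasGrad.of_pd hR.isOpen (contDiffOn_pd hR.isOpen hR.smooth_V 0) hq rfl
    (pd_comm hR.isOpen hR.smooth_V hq 1 0)

theorem ReducedSystem.hasGrad_V₂ (hR : ReducedSystem U c h f V) {q : Plane} (hq : q ∈ U) :
    HasGrad (pd 1 V) (pd 0 (pd 1 V) q) (pd 1 (pd 1 V) q) q :=
  hasGrad_of_contDiffOn hR.isOpen (contDiffOn_pd hR.isOpen hR.smooth_V 1) hq

theorem ReducedSystem.eq_add_const (hR : ReducedSystem U c h f V) {W : Plane → ℝ}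
    (hW : ∀ q ∈ U, HasGrad W (pd 0 V q) (pd 1 V q) q) : ∃ k, ∀ q ∈ U, V q = W q + k := by
  obtain ⟨k, hk⟩ := exists_const_of_hasGrad_zero (g := fun q => V q - W q) hR.isOpen
    hR.isConnected fun q hq =>
      ((hasGrad_of_contDiffOn hR.isOpen hR.smooth_V hq).sub (hW q hq)).of_eq (sub_self _)
        (sub_self _)
  exact ⟨k, fun q hq => by linarith [hk q hq]⟩

/-- The reduced system over `U` is one of the normal forms, up to an additive constant. -/
def IsNormalOver (U : Set Plane) (f V : Plane → ℝ) (kind : Kind) : Prop :=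
  ∃ b C₁ C₂ k : ℝ, U ⊆ NormalForm.domain ⟨kind, b, C₁, C₂⟩ ∧
    (∀ q ∈ U, NormalForm.f ⟨kind, b, C₁, C₂⟩ q = f q) ∧
    ∀ q ∈ U, NormalForm.V ⟨kind, b, C₁, C₂⟩ q = V q + k

/-- Off the line `q 0 = 0` the factor `h` can be cancelled, and continuity extends the results over
the line. Then `f` is linear in `q 0`, the variables separate in `V`, and `pd 1 V` is affine in `q
1`. -/
theorem isNormalOver_calogeroA (hR : ReducedSystem U ![0, 0, 0, 0, 1, 0, 0, -2] h f V)
    (hh : ∀ q ∈ U, h q = q 0) : IsNormalOver U f V .calogeroA := by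
  have hU := hR.isOpen
  have cV := contDiffOn_pd hU hR.smooth_V
  have cf := contDiffOn_pd hU hR.smooth_f
  have ef₁ : ∀ q ∈ U, f q = q 0 * pd 0 f q := fun q hq => by
    have := hR.f₁ q hq; simp [hh q hq] at this; linarith
  have ef₂ : ∀ q ∈ U, pd 1 f q = 0 := eq_zero_of_off_line hU (cf 1).continuousOn
    fun q hq h0 => by have := hR.f₂ q hq; simpa [hh q hq, h0] using this
  -- Differentiating `f = q 0 * pd 0 f` leaves `q 0 * pd 0 (pd 0 f) = 0`. Showing that `pd 0 f` is
  -- constant avoids dividing `f` by `q 0`, so one constant `b` serves on both sides of the line.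
  have ef₁₁ : ∀ q ∈ U, pd 0 (pd 0 f) q = 0 :=
    eq_zero_of_off_line hU (contDiffOn_pd hU (cf 0) 0).continuousOn fun q hq h0 => by
      have h1 := (HasGrad.coord_zero.mul (hasGrad_of_contDiffOn hU (cf 0) hq)).congr_on hU hq ef₁
      have := (h1.unique (hasGrad_of_contDiffOn hU hR.smooth_f hq)).1
      have : q 0 * pd 0 (pd 0 f) q = 0 := by linarith
      exact (mul_eq_zero.1 this).resolve_left h0
  have ef₁₂ : ∀ q ∈ U, pd 1 (pd 0 f) q = 0 := fun q hq => by
    rw [pd_comm hU hR.smooth_f hq, pd_congr hU ef₂ hq, pd_const]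
  obtain ⟨b, hb⟩ := exists_const_of_hasGrad_zero hU hR.isConnected fun q hq =>
    HasGrad.of_pd hU (cf 0) hq (ef₁₁ q hq) (ef₁₂ q hq)
  have ef : ∀ q ∈ U, f q = b * q 0 := fun q hq => by rw [ef₁ q hq, hb q hq, mul_comm]
  have eV₁₂ : ∀ q ∈ U, pd 0 (pd 1 V) q = 0 :=
    eq_zero_of_off_line hU (contDiffOn_pd hU (cV 1) 0).continuousOn
      fun q hq h0 => by have := hR.V₁₂ q hq; simpa [hh q hq, h0] using this
  have eV₂₂ : ∀ q ∈ U, pd 1 (pd 1 V) q - 2 * b = 0 :=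
    eq_zero_of_off_line hU ((contDiffOn_pd hU (cV 1) 1).continuousOn.sub continuousOn_const)
      fun q hq h0 => by
        have := hR.V₂₂ q hq
        simp [hh q hq, ef q hq] at this
        have : q 0 * (pd 1 (pd 1 V) q - 2 * b) = 0 := by linarith
        exact (mul_eq_zero.1 this).resolve_left h0
  obtain ⟨C₁, hC₁⟩ := exists_const_of_hasGrad_zero (g := fun q => pd 1 V q - 2 * b * q 1) hU
    hR.isConnected fun q hq => ((hR.hasGrad_V₂ hq).sub (HasGrad.coord_one.const_mul _)).of_eq
      (by rw [eV₁₂ q hq]; ring) (by linarith [eV₂₂ q hq])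
  -- The equation `q 0 * V₁₁ = -3 V₁ + 2 b q 0` has particular solution `b / 2 * q 0` and
  -- integrating factor `q 0 ^ 3`.
  obtain ⟨C₃, hC₃⟩ := exists_const_of_hasGrad_zero
    (g := fun q => q 0 ^ 3 * (pd 0 V q - b / 2 * q 0)) hU hR.isConnected fun q hq => by
      refine ((HasGrad.coord_zero.pow 3).mul
        ((hR.hasGrad_V₁ hq).sub (HasGrad.coord_zero.const_mul _))).of_eq ?_ ?_
      · have := hR.V₁₁ q hq
        simp [hh q hq, ef q hq] at this
        norm_num
        linear_combination q 0 ^ 2 * this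
      · rw [eV₁₂ q hq]; ring
  -- If `U` meets the line, evaluation there shows that the constant, hence the singular term, is
  -- zero.
  have hline : ∀ q ∈ U, q 0 ≠ 0 ∨ C₃ = 0 := fun q hq => by
    by_cases h0 : q 0 = 0
    · right; rw [← hC₃ q hq, h0]; ring
    · exact Or.inl h0
  have hdom : ∀ q ∈ U, q 0 ≠ 0 ∨ -C₃ / 2 = 0 := fun q hq =>
    (hline q hq).imp_right fun h => by rw [h]; ring
  have eV₁ : ∀ q ∈ U, pd 0 V q = b / 2 * q 0 + -2 * (-C₃ / 2) / q 0 ^ 3 := by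
    intro q hq
    rcases hline q hq with h0 | h0
    · rw [← hC₃ q hq]; field_simp; ring
    · have : ∀ q ∈ U, pd 0 V q - b / 2 * q 0 = 0 :=
        eq_zero_of_off_line hU ((cV 0).continuousOn.sub (by fun_prop)) fun q hq h1 => by
          have := hC₃ q hq
          rw [h0] at this
          exact (mul_eq_zero.1 this).resolve_left (pow_ne_zero 3 h1)
      rw [h0, neg_zero, zero_div, mul_zero, zero_div]
      linarith [this q hq]
  obtain ⟨k, hk⟩ := hR.eq_add_const fun q hq =>
    (NormalForm.hasGrad_V_calogeroA (b := b) (C₁ := C₁) (hdom q hq)).of_eq (eV₁ q hq).symm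
      (by linarith [hC₁ q hq])
  exact ⟨b, C₁, -C₃ / 2, -k, hdom, fun q hq => (ef q hq).symm, fun q hq => by rw [hk q hq]; ring⟩

/-- Here `q 0 ^ 3 * f` is constant. The decisive point is that `pd 1 (pd 1 V)` is constant; the
equation for it then gives `pd 0 V` algebraically. -/
theorem isNormalOver_calogeroB (hR : ReducedSystem U ![0, 0, 4, 0, 1, 0, 0, 2] h f V)
    (hh : ∀ q ∈ U, h q = q 0) : IsNormalOver U f V .calogeroB := by
  have hU := hR.isOpen
  have cV := contDiffOn_pd hU hR.smooth_V
  have cf := contDiffOn_pd hU hR.smooth_f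
  have ef₁ : ∀ q ∈ U, q 0 * pd 0 f q = -3 * f q := fun q hq => by
    have := hR.f₁ q hq; simp [hh q hq] at this; linarith
  have ef₂ : ∀ q ∈ U, pd 1 f q = 0 := eq_zero_of_off_line hU (cf 1).continuousOn
    fun q hq h0 => by have := hR.f₂ q hq; simpa [hh q hq, h0] using this
  have gf : ∀ q ∈ U, HasGrad f (pd 0 f q) 0 q := fun q hq =>
    HasGrad.of_pd hU hR.smooth_f hq rfl (ef₂ q hq)
  obtain ⟨b, hb⟩ := exists_const_of_hasGrad_zero (g := fun q => q 0 ^ 3 * f q) hU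
    hR.isConnected fun q hq => ((HasGrad.coord_zero.pow 3).mul (gf q hq)).of_eq
      (by norm_num; linear_combination q 0 ^ 2 * ef₁ q hq) (by ring)
  have hdom : ∀ q ∈ U, q 0 ≠ 0 ∨ b = 0 := fun q hq => by
    by_cases h0 : q 0 = 0
    · right; rw [← hb q hq, h0]; ring
    · exact Or.inl h0
  have ef : ∀ q ∈ U, f q = b / q 0 ^ 3 := by
    intro q hq
    rcases hdom q hq with h0 | h0
    · rw [← hb q hq]; field_simp
    · have : ∀ q ∈ U, f q = 0 := eq_zero_of_off_line hU hR.smooth_f.continuousOn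
        fun q hq h1 => by
          have := hb q hq
          rw [h0] at this
          exact (mul_eq_zero.1 this).resolve_left (pow_ne_zero 3 h1)
      rw [h0, this q hq, zero_div]
  have eV₁₂ : ∀ q ∈ U, pd 0 (pd 1 V) q = 0 :=
    eq_zero_of_off_line hU (contDiffOn_pd hU (cV 1) 0).continuousOn
      fun q hq h0 => by have := hR.V₁₂ q hq; simpa [hh q hq, h0] using this
  have eV₁₁ : ∀ q ∈ U, q 0 * pd 0 (pd 0 V) q = pd 0 V q + 2 * f q := fun q hq => by
    have := hR.V₁₁ q hq; simp [hh q hq] at this; linarith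
  have eV₂₂ : ∀ q ∈ U, q 0 * pd 1 (pd 1 V) q = 4 * pd 0 V q + 2 * f q := fun q hq => by
    have := hR.V₂₂ q hq; simp [hh q hq] at this; linarith
  have cV₂₂ := contDiffOn_pd hU (cV 1) 1
  have third : ∀ q ∈ U, pd 1 (pd 1 V) q + q 0 * pd 0 (pd 1 (pd 1 V)) q
      = 4 * pd 0 (pd 0 V) q + 2 * pd 0 f q ∧ q 0 * pd 1 (pd 1 (pd 1 V)) q = 0 := by
    intro q hq
    have h1 := HasGrad.coord_zero.mul (hasGrad_of_contDiffOn hU cV₂₂ hq)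
    have h2 := (((hR.hasGrad_V₁ hq).const_mul 4).add ((gf q hq).const_mul 2)).congr_on hU hq eV₂₂
    obtain ⟨u1, u2⟩ := h1.unique h2
    rw [eV₁₂ q hq] at u2
    constructor <;> linarith
  have eV₂₂₁ : ∀ q ∈ U, pd 0 (pd 1 (pd 1 V)) q = 0 :=
    eq_zero_of_off_line hU (contDiffOn_pd hU cV₂₂ 0).continuousOn fun q hq h0 => by
      have : q 0 ^ 2 * pd 0 (pd 1 (pd 1 V)) q = 0 := by
        -- The `q 0` derivative of the equation for `V₂₂` is combined with the equations for `V₂₂`,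
        -- `V₁₁` and `f`; everything cancels except the third derivative.
        linear_combination q 0 * (third q hq).1 - eV₂₂ q hq + 4 * eV₁₁ q hq + 2 * ef₁ q hq
      exact (mul_eq_zero.1 this).resolve_left (pow_ne_zero 2 h0)
  have eV₂₂₂ : ∀ q ∈ U, pd 1 (pd 1 (pd 1 V)) q = 0 :=
    eq_zero_of_off_line hU (contDiffOn_pd hU cV₂₂ 1).continuousOn fun q hq h0 =>
      (mul_eq_zero.1 (third q hq).2).resolve_left h0
  obtain ⟨C, hC⟩ := exists_const_of_hasGrad_zero hU hR.isConnected fun q hq =>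
    HasGrad.of_pd hU cV₂₂ hq (eV₂₂₁ q hq) (eV₂₂₂ q hq)
  obtain ⟨C₂, hC₂⟩ := exists_const_of_hasGrad_zero (g := fun q => pd 1 V q - C * q 1) hU
    hR.isConnected fun q hq => ((hR.hasGrad_V₂ hq).sub (HasGrad.coord_one.const_mul _)).of_eq
      (by rw [eV₁₂ q hq]; ring) (by linarith [hC q hq])
  have eV₁ : ∀ q ∈ U, pd 0 V q = C / 2 / 2 * q 0 + -b / 2 / q 0 ^ 3 := by
    intro q hq
    have h1 := eV₂₂ q hq
    have h2 : -b / 2 / q 0 ^ 3 = -(1 / 2) * f q := by rw [ef q hq]; ring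
    rw [hC q hq] at h1
    linarith
  obtain ⟨k, hk⟩ := hR.eq_add_const fun q hq =>
    (NormalForm.hasGrad_V_calogeroB (C₁ := C / 2) (C₂ := C₂) (hdom q hq)).of_eq (eV₁ q hq).symm
      (by linarith [hC₂ q hq])
  exact ⟨b, C / 2, C₂, -k, hdom, fun q hq => (ef q hq).symm, fun q hq => by rw [hk q hq]; ring⟩

/-- With `h = -2` this is a linear system with constant coefficients for `f`, `pd 0 V`, `pd 1 V`. It
has three exponential eigencombinations: `f` itself and one for each square root of `3`. -/
theorem isNormalOver_toda (hR : ReducedSystem U ![0, 1, 3, 0, 1, 0, 0, 1] h f V)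
    (hh : ∀ q ∈ U, h q = -2) : IsNormalOver U f V .toda := by
  have hU := hR.isOpen
  have h3 : √3 * √3 = 3 := Real.mul_self_sqrt (by norm_num)
  have gf : ∀ q ∈ U, HasGrad f (f q) 0 q := fun q hq => by
    have h1 := hR.f₁ q hq
    have h2 := hR.f₂ q hq
    simp [hh q hq] at h1 h2
    exact HasGrad.of_pd hU hR.smooth_f hq (by linarith) h2
  have gV₁ : ∀ q ∈ U, HasGrad (pd 0 V) (-(pd 0 V q + 2 * f q) / 2) (-pd 1 V q / 2) q :=
    fun q hq => by
      have h1 := hR.V₁₁ q hq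
      have h2 := hR.V₁₂ q hq
      simp [hh q hq] at h1 h2
      exact (hR.hasGrad_V₁ hq).of_eq (by linarith) (by linarith)
  have gV₂ : ∀ q ∈ U, HasGrad (pd 1 V) (-pd 1 V q / 2) (-(3 * pd 0 V q + 2 * f q) / 2) q :=
    fun q hq => by
      have h1 := hR.V₂₂ q hq
      have h2 := hR.V₁₂ q hq
      simp [hh q hq] at h1 h2
      exact (hR.hasGrad_V₂ hq).of_eq (by linarith) (by linarith)
  obtain ⟨b, hb⟩ := exists_const_of_hasGrad_zero
    (g := fun q => f q * Real.exp (-1 * q 0 + 0 * q 1)) hU hR.isConnected fun q hq =>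
      ((gf q hq).mul (HasGrad.exp_linear (-1) 0)).of_eq (by ring) (by ring)
  -- The combination is a common eigenvector for both partial derivatives, with eigenvalues `-1 / 2`
  -- and `s / 2`. Both signs of `s` are used.
  have key : ∀ s : ℝ, s * s = 3 → ∃ C, ∀ q ∈ U,
      (s / 3 * pd 1 V q - pd 0 V q - 2 / 3 * f q)
        = C * Real.exp (-(q 0) / 2 + s * q 1 / 2) := by
    intro s hs
    obtain ⟨C, hC⟩ := exists_const_of_hasGrad_zero
      (g := fun q => (s / 3 * pd 1 V q - pd 0 V q - 2 / 3 * f q)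
        * Real.exp (1 / 2 * q 0 + -s / 2 * q 1)) hU hR.isConnected fun q hq => by
        refine (((((gV₂ q hq).const_mul _).sub (gV₁ q hq)).sub ((gf q hq).const_mul _)).mul
          (HasGrad.exp_linear (1 / 2) (-s / 2))).of_eq ?_ ?_
        · ring
        · linear_combination
            (-(1 / 6) * pd 1 V q * Real.exp (1 / 2 * q 0 + -s / 2 * q 1)) * hs
    refine ⟨C, fun q hq => ?_⟩
    rw [← hC q hq, mul_assoc, ← Real.exp_add]
    ring_nf
    simp
  obtain ⟨C₁, hC₁⟩ := key √3 h3
  obtain ⟨C₂, hC₂⟩ := key (-√3) (by rw [neg_mul_neg, h3])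
  have ef : ∀ q ∈ U, f q = b * Real.exp (q 0) := fun q hq => by
    rw [← hb q hq, mul_assoc, ← Real.exp_add]
    simp
  have e2 : ∀ q : Plane, -(q 0) / 2 + -√3 * q 1 / 2 = -(q 0) / 2 - √3 * q 1 / 2 := fun q => by
    ring
  simp only [e2] at hC₂
  obtain ⟨k, hk⟩ := hR.eq_add_const fun q hq =>
    (NormalForm.hasGrad_V_toda (b := b) (C₁ := C₁) (C₂ := C₂)).of_eq
      (by linear_combination (2 / 3) * ef q hq + (1 / 2) * hC₁ q hq + (1 / 2) * hC₂ q hq)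
      (by linear_combination (-√3 / 2) * hC₁ q hq + (√3 / 2) * hC₂ q hq
            + (1 / 3) * pd 1 V q * h3)
  exact ⟨b, C₁, C₂, -k, Set.subset_univ _, fun q hq => (ef q hq).symm,
    fun q hq => by rw [hk q hq]; ring⟩

/-- The fractional exponents are incompatible with smoothness across `q 0 = 0`: if `U` met the line,
all singular quantities would vanish and `V` would be constant. So `U` avoids the line, and by
connectedness it lies in the half-plane containing the given point. -/
theorem isNormalOver_holt (hR : ReducedSystem U ![0, -2 / 3, 0, 0, 1 / 3, 0, 0, -2 / 3] h f V)
    (hh : ∀ q ∈ U, h q = q 0) (hpos : ∃ q ∈ U, 0 < q 0) (hV : ¬ ∃ k, ∀ q ∈ U, V q = k) :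
    IsNormalOver U f V .holt := by
  have hU := hR.isOpen
  have cV := contDiffOn_pd hU hR.smooth_V
  have cf := contDiffOn_pd hU hR.smooth_f
  have ef₁ : ∀ q ∈ U, q 0 * pd 0 f q = 1 / 3 * f q := fun q hq => by
    have := hR.f₁ q hq; simp [hh q hq] at this; linarith
  have ef₂ : ∀ q ∈ U, pd 1 f q = 0 := eq_zero_of_off_line hU (cf 1).continuousOn
    fun q hq h0 => by have := hR.f₂ q hq; simpa [hh q hq, h0] using this
  have gf : ∀ q ∈ U, HasGrad f (pd 0 f q) 0 q := fun q hq =>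
    HasGrad.of_pd hU hR.smooth_f hq rfl (ef₂ q hq)
  have eV₁₁ : ∀ q ∈ U, q 0 * pd 0 (pd 0 V) q = -5 / 3 * pd 0 V q + 2 * f q := fun q hq => by
    have := hR.V₁₁ q hq; simp [hh q hq] at this; linarith
  have eV₁₂ : ∀ q ∈ U, q 0 * pd 0 (pd 1 V) q = -2 / 3 * pd 1 V q := fun q hq => by
    have := hR.V₁₂ q hq; simp [hh q hq] at this; linarith
  have eV₂₂ : ∀ q ∈ U, q 0 * pd 1 (pd 1 V) q = 2 * f q := fun q hq => by
    have := hR.V₂₂ q hq; simp [hh q hq] at this; linarith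
  have hline : ∀ q ∈ U, q 0 ≠ 0 := by
    intro q₀ hq₀ h0
    -- Cubing removes the fractional exponents: `g` proportional to `q 0 ^ (-m / 3)` becomes a
    -- constant `q 0 ^ m * g ^ 3`, which is zero on the line. It is used with `m = 2` for `pd 0 f`
    -- and `pd 1 V`, and `m = 5` for `pd 0 V`.
    have vanish : ∀ {g : Plane → ℝ} (m : ℕ), 1 ≤ m → ContinuousOn g U →
        (∃ k, ∀ q ∈ U, q 0 ^ m * g q ^ 3 = k) → ∀ q ∈ U, g q = 0 := by
      rintro g m hm hg ⟨k, hk⟩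
      have hk0 : k = 0 := by
        rw [← hk q₀ hq₀, h0, zero_pow (by omega), zero_mul]
      refine eq_zero_of_off_line hU hg fun q hq h1 => ?_
      have := hk q hq
      rw [hk0] at this
      exact pow_eq_zero_iff three_ne_zero |>.1
        ((mul_eq_zero.1 this).resolve_left (pow_ne_zero m h1))
    have f₁₁ : ∀ q ∈ U, q 0 * pd 0 (pd 0 f) q = -2 / 3 * pd 0 f q := fun q hq => by
      have h1 := (((gf q hq).const_mul (1 / 3)).congr_on hU hq ef₁).unique
        (HasGrad.coord_zero.mul (hasGrad_of_contDiffOn hU (cf 0) hq))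
      linarith [h1.1]
    have f₁₂ : ∀ q ∈ U, pd 1 (pd 0 f) q = 0 := fun q hq => by
      rw [pd_comm hU hR.smooth_f hq, pd_congr hU ef₂ hq, pd_const]
    have z₁ : ∀ q ∈ U, pd 0 f q = 0 := vanish 2 (by norm_num) (cf 0).continuousOn
      (exists_const_of_hasGrad_zero hU hR.isConnected fun q hq => by
        refine ((HasGrad.coord_zero.pow 2).mul ((hasGrad_of_contDiffOn hU (cf 0) hq).pow
          3)).of_eq ?_ ?_
        · norm_num
          linear_combination 3 * q 0 * pd 0 f q ^ 2 * f₁₁ q hq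
        · rw [f₁₂ q hq]; ring)
    have z : ∀ q ∈ U, f q = 0 := fun q hq => by
      have := ef₁ q hq
      rw [z₁ q hq] at this
      linarith
    have z₂ : ∀ q ∈ U, pd 1 V q = 0 := vanish 2 (by norm_num) (cV 1).continuousOn
      (exists_const_of_hasGrad_zero hU hR.isConnected fun q hq => by
        refine ((HasGrad.coord_zero.pow 2).mul ((hR.hasGrad_V₂ hq).pow 3)).of_eq ?_ ?_
        · norm_num
          linear_combination 3 * q 0 * pd 1 V q ^ 2 * eV₁₂ q hq
        · have := eV₂₂ q hq
          rw [z q hq] at this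
          simp only [Nat.cast_ofNat, Nat.reduceSub]
          linear_combination 3 * q 0 * pd 1 V q ^ 2 * this)
    have z₃ : ∀ q ∈ U, pd 0 V q = 0 := vanish 5 (by norm_num) (cV 0).continuousOn
      (exists_const_of_hasGrad_zero hU hR.isConnected fun q hq => by
        refine ((HasGrad.coord_zero.pow 5).mul ((hR.hasGrad_V₁ hq).pow 3)).of_eq ?_ ?_
        · have := eV₁₁ q hq
          rw [z q hq] at this
          norm_num
          linear_combination 3 * q 0 ^ 4 * pd 0 V q ^ 2 * this
        · have := eV₁₂ q hq
          rw [z₂ q hq] at this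
          simp only [Nat.cast_ofNat, Nat.reduceSub]
          linear_combination 3 * q 0 ^ 4 * pd 0 V q ^ 2 * this)
    exact hV (exists_const_of_hasGrad_zero hU hR.isConnected fun q hq =>
      HasGrad.of_pd hU hR.smooth_V hq (z₃ q hq) (z₂ q hq))
  have hdom : ∀ q ∈ U, 0 < q 0 := by
    obtain ⟨q₁, hq₁, hpos₁⟩ := hpos
    have hs : U ⊆ {q : Plane | 0 < q 0} := by
      refine hR.isConnected.isPreconnected.subset_left_of_subset_union
        (isOpen_lt continuous_const (continuous_apply 0))
        (isOpen_lt (continuous_apply 0) continuous_const (g := fun _ : Plane => (0 : ℝ))) ?_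
        (fun q hq => ?_) ⟨q₁, hq₁, hpos₁⟩
      · exact Set.disjoint_left.2 fun q h1 h2 => lt_asymm (a := (0 : ℝ)) h1 h2
      · exact (lt_or_gt_of_ne (hline q hq)).symm
    exact fun q hq => hs hq
  have mulp : ∀ q ∈ U, ∀ r : ℝ, q 0 ^ r = q 0 * q 0 ^ (r - 1) := fun q hq r => by
    rw [Real.rpow_sub_one (hline q hq)]
    field_simp [hline q hq]
  have cancel : ∀ q ∈ U, ∀ r : ℝ, q 0 ^ r * q 0 ^ (-r) = 1 := fun q hq r => by
    rw [← Real.rpow_add (hdom q hq), add_neg_cancel, Real.rpow_zero]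
  obtain ⟨b, hb⟩ := exists_const_of_hasGrad_zero (g := fun q => f q * q 0 ^ (-1 / 3 : ℝ)) hU
    hR.isConnected fun q hq => ((gf q hq).mul (HasGrad.rpow _ (hdom q hq))).of_eq
      (by linear_combination pd 0 f q * mulp q hq (-1 / 3)
            + q 0 ^ (-1 / 3 - 1 : ℝ) * ef₁ q hq) (by ring)
  have ef : ∀ q ∈ U, f q = b * q 0 ^ (1 / 3 : ℝ) := fun q hq => by
    have := cancel q hq (1 / 3)
    norm_num at this
    rw [← hb q hq]
    norm_num
    linear_combination -f q * this
  have fp : ∀ q ∈ U, f q * q 0 ^ (2 / 3 : ℝ) = b * q 0 := fun q hq => by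
    rw [ef q hq, mul_assoc, ← Real.rpow_add (hdom q hq)]
    norm_num
  -- The homogeneous equation for `pd 1 V` has exponent `-2 / 3`, so `q 0 ^ (2 / 3)` is the
  -- integrating factor; for `pd 0 V` below it is `q 0 ^ (5 / 3)`.
  obtain ⟨C, hC⟩ := exists_const_of_hasGrad_zero
    (g := fun q => pd 1 V q * q 0 ^ (2 / 3 : ℝ) - 2 * b * q 1) hU hR.isConnected fun q hq => by
      have m := mulp q hq (2 / 3)
      refine (((hR.hasGrad_V₂ hq).mul (HasGrad.rpow _ (hdom q hq))).sub
        (HasGrad.coord_one.const_mul _)).of_eq ?_ ?_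
      · linear_combination pd 0 (pd 1 V) q * m + q 0 ^ (2 / 3 - 1 : ℝ) * eV₁₂ q hq
      · have : q 0 * (pd 1 (pd 1 V) q * q 0 ^ (2 / 3 : ℝ) - 2 * b) = 0 := by
          linear_combination q 0 ^ (2 / 3 : ℝ) * eV₂₂ q hq + 2 * fp q hq
        have := (mul_eq_zero.1 this).resolve_left (hline q hq)
        linarith
  obtain ⟨D, hD⟩ := exists_const_of_hasGrad_zero
    (g := fun q => pd 0 V q * q 0 ^ (5 / 3 : ℝ) - b * q 0 ^ 2
      + 2 / 3 * (b * q 1 ^ 2 + C * q 1)) hU hR.isConnected fun q hq => by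
      have m := mulp q hq (5 / 3)
      have e : q 0 ^ (5 / 3 - 1 : ℝ) = q 0 ^ (2 / 3 : ℝ) := by norm_num
      rw [e] at m
      refine ((((hR.hasGrad_V₁ hq).mul (HasGrad.rpow _ (hdom q hq))).sub
        ((HasGrad.coord_zero.pow 2).const_mul _)).add ((((HasGrad.coord_one.pow 2).const_mul
        b).add (HasGrad.coord_one.const_mul C)).const_mul _)).of_eq ?_ ?_
      · rw [e]
        norm_num
        linear_combination pd 0 (pd 0 V) q * m + q 0 ^ (2 / 3 : ℝ) * eV₁₁ q hq + 2 * fp q hq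
      · norm_num
        linear_combination pd 0 (pd 1 V) q * m + q 0 ^ (2 / 3 : ℝ) * eV₁₂ q hq
          - 2 / 3 * hC q hq
  -- `C₁ / 4 = C` and `-(2 / 3) * (C₂ / 4) = D` give the constants of the normal form.
  obtain ⟨k, hk⟩ := hR.eq_add_const fun q hq => by
    have c1 := cancel q hq (2 / 3)
    have c2 := cancel q hq (5 / 3)
    have e1 : (-(2 / 3) : ℝ) = -2 / 3 := by norm_num
    have e2 : (-(5 / 3) : ℝ) = -2 / 3 - 1 := by norm_num
    have e3 : q 0 ^ (1 / 3 : ℝ) = q 0 ^ 2 * q 0 ^ (-2 / 3 - 1 : ℝ) := by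
      rw [← Real.rpow_natCast, ← Real.rpow_add (hdom q hq)]; norm_num
    rw [e1] at c1
    rw [e2] at c2
    exact (NormalForm.hasGrad_V_holt (b := b) (C₁ := 4 * C) (C₂ := -6 * D) (hdom q hq)).of_eq
      (by linear_combination b * e3 - q 0 ^ (-2 / 3 - 1 : ℝ) * hD q hq + pd 0 V q * c2)
      (by linear_combination -q 0 ^ (-2 / 3 : ℝ) * hC q hq + pd 1 V q * c1)
  exact ⟨b, 4 * C, -6 * D, -k, hdom, fun q hq => (ef q hq).symm,
    fun q hq => by rw [hk q hq]; ring⟩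

end BiHam

/-! ### Normalization by a similarity. -/

namespace BiHam

section Coefficients

variable {c : Fin 8 → ℝ}

/-- After elimination the unknowns are `c 1`, `c 3`, `c 7`. The relations exclude `c 3 ≠ 0` and then
give `c 1 * (c 1 - c 7) = 0`. The branch `c 1 = 0` leaves `c 7 = ±2`, and `c 7 = c 1` leaves `-2 /
3`. -/
theorem eq_of_gradient_normalized (hc : AlgebraicRelations c) (h₁ : c 4 - c 1 = 1)
    (h₂ : c 6 - c 3 = 0) :
    c = ![0, 0, 0, 0, 1, 0, 0, -2] ∨ c = ![0, 0, 4, 0, 1, 0, 0, 2] ∨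
      c = ![0, -2 / 3, 0, 0, 1 / 3, 0, 0, -2 / 3] := by
  obtain ⟨s1, s2, q1, q2, q3, q4⟩ := hc
  have e4 : c 4 = c 1 + 1 := by linarith
  have e6 : c 6 = c 3 := by linarith
  rw [s1, s2, e4, e6] at q1 q4
  rw [s1, e4, e6] at q3
  rw [s2, e6] at q2
  -- In the sum of `quad₁` and `quad₄` all quadratic terms cancel.
  have e0 : c 0 = -c 3 := by linear_combination -q1 - q4
  rw [e0] at q1 q2 q3
  have e3 : c 3 = 0 := by
    by_contra h3
    have hw : c 7 = -c 1 - 3 := by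
      have : c 3 * (c 7 + c 1 + 3) = 0 := by linear_combination q1
      linarith [(mul_eq_zero.1 this).resolve_left h3]
    rw [hw] at q2 q3
    have : (5 : ℝ) = 0 := by linear_combination q3 + q2
    norm_num at this
  rw [e3] at q2 q3 e0 e6
  have key : ∀ u w : ℝ, c 1 = u → c 7 = w → c = ![0, u, w + 2 * (u + 1), 0, u + 1, 0, 0, w] := by
    intro u w hu hw
    ext i
    fin_cases i <;> simp [e0, hu, s1, hw, e4, e3, s2, e6]
  by_cases hu : c 1 = 0
  · rw [hu] at q3
    have : (c 7 + 2) * (c 7 - 2) = 0 := by linear_combination q3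
    rcases mul_eq_zero.1 this with h | h
    · left
      rw [key 0 (-2) hu (by linarith)]
      norm_num
    · right; left
      rw [key 0 2 hu (by linarith)]
      norm_num
  · have hw : c 7 = c 1 := by
      have : c 1 * (c 1 - c 7) = 0 := by linear_combination q2
      linarith [(mul_eq_zero.1 this).resolve_left hu]
    rw [hw] at q3
    right; right
    rw [key (-2 / 3) (-2 / 3) (by linarith) (by linarith)]
    norm_num

theorem eq_of_trace_normalized (hc : AlgebraicRelations c) (h₁ : c 4 - c 1 = 0)
    (h₂ : c 6 - c 3 = 0) (ht₁ : c 0 + c 6 = 0) (ht₂ : c 1 + c 7 = 2) :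
    c = ![0, 1, 3, 0, 1, 0, 0, 1] := by
  obtain ⟨s1, s2, q1, q2, q3, q4⟩ := hc
  have e4 : c 4 = c 1 := by linarith
  have e6 : c 6 = c 3 := by linarith
  have e0 : c 0 = -c 3 := by linarith
  have e7 : c 7 = 2 - c 1 := by linarith
  rw [s1, s2, e4, e6, e7, e0] at q1
  have e3 : c 3 = 0 := by linarith
  rw [s2, e6, e0, e7, e3] at q2
  rw [s1, e4, e6, e0, e7, e3] at q3
  -- `quad₂` alone also allows `c 1 = 0` and `quad₃` alone `c 1 = -2`; in their sum the squares
  -- cancel, which leaves `4 - 4 c 1 = 0`.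
  have e1 : c 1 = 1 := by linarith
  ext i
  fin_cases i <;> simp [e0, e3, e1, s1, e7, e4, s2, e6] <;> norm_num

end Coefficients

theorem ReducedSystem.exists_affine {U : Set Plane} {c : Fin 8 → ℝ} {h f V : Plane → ℝ}
    (hR : ReducedSystem U c h f V) :
    ∃ h₀, ∀ q ∈ U, h q = (c 4 - c 1) * q 0 + (c 6 - c 3) * q 1 + h₀ := by
  obtain ⟨k, hk⟩ := exists_const_of_hasGrad_zero
    (g := fun q => h q - ((c 4 - c 1) * q 0 + (c 6 - c 3) * q 1)) hR.isOpen hR.isConnected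
    fun q hq => ((HasGrad.of_pd hR.isOpen hR.smooth_h hq (hR.h₁ q hq) (hR.h₂ q hq)).sub
      ((HasGrad.coord_zero.const_mul _).add (HasGrad.coord_one.const_mul _))).of_eq
      (by ring) (by ring)
  exact ⟨k, fun q hq => by linarith [hk q hq]⟩

theorem not_const_transport {U : Set Plane} {V : Plane → ℝ} {m n : ℝ} {e : Plane}
    (hr : m ^ 2 + n ^ 2 ≠ 0) (hV : ¬ ∃ k : ℝ, ∀ q ∈ U, V q = k) :
    ¬ ∃ k : ℝ, ∀ q ∈ similarity m n e ⁻¹' U, (m ^ 2 + n ^ 2) * V (similarity m n e q) = k := by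
  rintro ⟨k, hk⟩
  refine hV ⟨k / (m ^ 2 + n ^ 2), fun q hq => ?_⟩
  have := hk (similarityInv m n e q) (by rwa [Set.mem_preimage, similarity_similarityInv hr])
  rw [similarity_similarityInv hr] at this
  rw [← this]
  field_simp

/-- The functions `h` of the normal forms. -/
def kindH : Kind → Plane → ℝ
  | .toda => fun _ => -2
  | _ => fun q => q 0

/-- The coefficients of the normal forms. -/
noncomputable def kindC (kind : Kind) : Fin 8 → ℝ :=
  NormalForm.c ⟨kind, 0, 0, 0⟩

theorem normalForm_c (F : NormalForm) : F.c = kindC F.kind := rfl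

theorem normalForm_h (F : NormalForm) : F.h = kindH F.kind := by
  obtain ⟨kind, b, C₁, C₂⟩ := F
  cases kind <;> rfl

/-- The similarity turns the gradient of the affine function `h` onto the first axis and moves its
zero line to `q 0 = 0`; scaling makes `h` equal to `q 0`. The coefficient list for this `h` then
applies. -/
theorem exists_normalization_of_gradient_ne_zero {U : Set Plane} {c : Fin 8 → ℝ}
    {h f V : Plane → ℝ} (hR : ReducedSystem U c h f V) (hV : ¬ ∃ k : ℝ, ∀ q ∈ U, V q = k)
    (hg : (c 4 - c 1) ^ 2 + (c 6 - c 3) ^ 2 ≠ 0) :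
    ∃ (m n ν : ℝ) (e : Plane) (kind : Kind), m ^ 2 + n ^ 2 ≠ 0 ∧ ν ≠ 0 ∧
      transportCoeff m n ν c = kindC kind ∧
      (∀ q ∈ similarity m n e ⁻¹' U,
        ν * (m ^ 2 + n ^ 2) * h (similarity m n e q) = kindH kind q) ∧
      IsNormalOver (similarity m n e ⁻¹' U)
        (fun q => ν * (m ^ 2 + n ^ 2) ^ 3 * f (similarity m n e q))
        (fun q => (m ^ 2 + n ^ 2) * V (similarity m n e q)) kind := by
  obtain ⟨h₀, hh⟩ := hR.exists_affine
  obtain ⟨q₁, hq₁, hne⟩ : ∃ q ∈ U, h q ≠ 0 := by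
    by_contra! hz
    obtain ⟨q, hq⟩ := hR.isConnected.nonempty
    have e1 := hR.h₁ q hq
    have e2 := hR.h₂ q hq
    rw [pd_congr hR.isOpen hz hq, pd_const] at e1 e2
    exact hg (by rw [← e1, ← e2]; ring)
  -- The sign puts a point of the new domain in `q 0 > 0`, as the half-plane of the Holt form
  -- requires.
  obtain ⟨ε, hε, hpos⟩ : ∃ ε : ℝ, ε ^ 2 = 1 ∧ 0 < ε * h q₁ := by
    rcases lt_or_gt_of_ne hne with h1 | h1
    · exact ⟨-1, by norm_num, by linarith⟩
    · exact ⟨1, by norm_num, by linarith⟩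
  have hε0 : ε ≠ 0 := by rintro rfl; norm_num at hε
  generalize hx : c 4 - c 1 = x at *
  generalize hy : c 6 - c 3 = y at *
  have er : (ε * x) ^ 2 + (ε * y) ^ 2 = x ^ 2 + y ^ 2 := by
    linear_combination (x ^ 2 + y ^ 2) * hε
  have hr : (ε * x) ^ 2 + (ε * y) ^ 2 ≠ 0 := by rwa [er]
  have hν : ε / (x ^ 2 + y ^ 2) ^ 2 ≠ 0 := div_ne_zero hε0 (pow_ne_zero 2 hg)
  -- The translation `e` is a point where the affine extension of `h` vanishes.
  obtain ⟨e, he⟩ : ∃ e : Plane, e = ![-(h₀ * x / (x ^ 2 + y ^ 2)), -(h₀ * y / (x ^ 2 + y ^ 2))] :=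
    ⟨_, rfl⟩
  obtain ⟨m, hm⟩ : ∃ m, m = ε * x := ⟨_, rfl⟩
  obtain ⟨n, hn⟩ : ∃ n, n = ε * y := ⟨_, rfl⟩
  obtain ⟨ν, hν'⟩ : ∃ ν, ν = ε / (x ^ 2 + y ^ 2) ^ 2 := ⟨_, rfl⟩
  rw [← hm, ← hn] at er hr
  rw [← hν'] at hν
  have hR' := hR.transport hr ν e
  have eh : ∀ q ∈ similarity m n e ⁻¹' U,
      ν * (m ^ 2 + n ^ 2) * h (similarity m n e q) = q 0 := by
    intro q hq
    rw [hh _ hq, er, hν', hm, hn, he]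
    simp [similarity]
    field_simp
    linear_combination (q 0 * (x ^ 2 + y ^ 2) ^ 2) * hε
  have hV' := not_const_transport (e := e) hr hV
  have halg : transportCoeff m n ν c 4 - transportCoeff m n ν c 1 = 1 ∧
      transportCoeff m n ν c 6 - transportCoeff m n ν c 3 = 0 := by
    obtain ⟨q, hq⟩ := hR'.isConnected.nonempty
    rw [← hR'.h₁ q hq, ← hR'.h₂ q hq, pd_congr hR'.isOpen eh hq, pd_congr hR'.isOpen eh hq,
      pd_coord, pd_coord]
    simp
  have hpos' : ∃ q ∈ similarity m n e ⁻¹' U, 0 < q 0 := by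
    have hmem : similarityInv m n e q₁ ∈ similarity m n e ⁻¹' U := by
      rwa [Set.mem_preimage, similarity_similarityInv hr]
    refine ⟨_, hmem, ?_⟩
    rw [← eh _ hmem, similarity_similarityInv hr, er, hν']
    have hτ : 0 < x ^ 2 + y ^ 2 := lt_of_le_of_ne (by positivity) (Ne.symm hg)
    have : ε / (x ^ 2 + y ^ 2) ^ 2 * (x ^ 2 + y ^ 2) * h q₁ = ε * h q₁ / (x ^ 2 + y ^ 2) := by
      field_simp
    rw [this]
    exact div_pos hpos hτ
  rcases eq_of_gradient_normalized hR'.algebraic halg.1 halg.2 with hc | hc | hc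
  · refine ⟨m, n, ν, e, .calogeroA, hr, hν, hc, eh, ?_⟩
    rw [hc] at hR'
    exact isNormalOver_calogeroA hR' eh
  · refine ⟨m, n, ν, e, .calogeroB, hr, hν, hc, eh, ?_⟩
    rw [hc] at hR'
    exact isNormalOver_calogeroB hR' eh
  · refine ⟨m, n, ν, e, .holt, hr, hν, hc, eh, ?_⟩
    rw [hc] at hR'
    exact isNormalOver_holt hR' eh hpos' hV'

/-- With `h` constant, the trace of `B` supplies the direction for the rotation. The two remaining
scale parameters fix its size and the value of `h`. -/
theorem exists_normalization_of_gradient_eq_zero {U : Set Plane} {c : Fin 8 → ℝ}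
    {h f V : Plane → ℝ} (hR : ReducedSystem U c h f V) (hV : ¬ ∃ k : ℝ, ∀ q ∈ U, V q = k)
    (hc : c ≠ 0) (h₁ : c 4 - c 1 = 0) (h₂ : c 6 - c 3 = 0) :
    ∃ (m n ν : ℝ) (e : Plane) (kind : Kind), m ^ 2 + n ^ 2 ≠ 0 ∧ ν ≠ 0 ∧
      transportCoeff m n ν c = kindC kind ∧
      (∀ q ∈ similarity m n e ⁻¹' U,
        ν * (m ^ 2 + n ^ 2) * h (similarity m n e q) = kindH kind q) ∧
      IsNormalOver (similarity m n e ⁻¹' U)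
        (fun q => ν * (m ^ 2 + n ^ 2) ^ 3 * f (similarity m n e q))
        (fun q => (m ^ 2 + n ^ 2) * V (similarity m n e q)) kind := by
  obtain ⟨h₀, hh⟩ := hR.exists_affine
  rw [h₁, h₂] at hh
  have hh : ∀ q ∈ U, h q = h₀ := fun q hq => by rw [hh q hq]; ring
  have e4 : c 4 = c 1 := by linarith
  have e6 : c 6 = c 3 := by linarith
  obtain ⟨s1, s2, q1, q2, q3, q4⟩ := hR.algebraic
  have hspin : c 1 ^ 2 + c 3 ^ 2 ≠ 0 := by
    intro h0
    have z1 : c 1 = 0 := by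
      rw [← sq_eq_zero_iff]; nlinarith [sq_nonneg (c 1), sq_nonneg (c 3)]
    have z3 : c 3 = 0 := by
      rw [← sq_eq_zero_iff]; nlinarith [sq_nonneg (c 1), sq_nonneg (c 3)]
    exact hc (hR.algebraic.eq_zero z1 z3 (by rw [e4, z1]) (by rw [e6, z3]))
  -- If `h = 0`, the equations for `V` become linear in `dV`. The difference of the first and third,
  -- with the second, is a linear system of determinant proportional to `c 1 ^ 2 + c 3 ^ 2`, so `V`
  -- would be constant.
  have hh₀ : h₀ ≠ 0 := by
    rintro rfl
    refine hV (exists_const_of_hasGrad_zero hR.isOpen hR.isConnected fun q hq => ?_)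
    have a := hR.V₁₁ q hq
    have b := hR.V₁₂ q hq
    have d := hR.V₂₂ q hq
    rw [hh q hq, zero_mul] at a b d
    rw [s2] at a
    rw [s1] at d
    rw [e4] at a d
    rw [e6] at b d
    refine HasGrad.of_pd hR.isOpen hR.smooth_V hq ?_ ?_
    · refine (mul_eq_zero.1 ?_).resolve_left hspin
      linear_combination (c 1 / 2) * (a - d) + c 3 * b
    · refine (mul_eq_zero.1 ?_).resolve_left hspin
      linear_combination (c 3 / 2) * (a - d) - c 1 * b
  -- For zero trace `quad₂` reads `2 (c 1 ^ 2 + c 3 ^ 2) = 0`.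
  have htrace : (c 0 + c 6) ^ 2 + (c 1 + c 7) ^ 2 ≠ 0 := by
    intro h0
    have t0 : c 0 + c 6 = 0 := by
      rw [← sq_eq_zero_iff]; nlinarith [sq_nonneg (c 0 + c 6), sq_nonneg (c 1 + c 7)]
    have t1 : c 1 + c 7 = 0 := by
      rw [← sq_eq_zero_iff]; nlinarith [sq_nonneg (c 0 + c 6), sq_nonneg (c 1 + c 7)]
    have e0 : c 0 = -c 3 := by linarith
    have e7 : c 7 = -c 1 := by linarith
    rw [s2, e6, e7, e0] at q2
    exact hspin (by linear_combination q2 / 2)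
  generalize hx : c 0 + c 6 = x at *
  generalize hy : c 1 + c 7 = y at *
  have hτ : x ^ 2 + y ^ 2 ≠ 0 := htrace
  -- With `τ = x ^ 2 + y ^ 2`, the choice `(m, n) = s (y, -x)` makes the trace proportional to `p₂`.
  -- The conditions trace `= 2 p₂` and `h = -2` are `ν s ^ 3 τ ^ 2 = 2` and `ν s ^ 2 τ h₀ = -2`, and
  -- these determine `s` and `ν`.
  obtain ⟨s, hs⟩ : ∃ s, s = -h₀ / (x ^ 2 + y ^ 2) := ⟨_, rfl⟩
  have hs0 : s ≠ 0 := by rw [hs]; exact div_ne_zero (neg_ne_zero.2 hh₀) hτ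
  obtain ⟨m, hm⟩ : ∃ m, m = s * y := ⟨_, rfl⟩
  obtain ⟨n, hn⟩ : ∃ n, n = -s * x := ⟨_, rfl⟩
  obtain ⟨ν, hν⟩ : ∃ ν, ν = 2 / (s ^ 3 * (x ^ 2 + y ^ 2) ^ 2) := ⟨_, rfl⟩
  have er : m ^ 2 + n ^ 2 = s ^ 2 * (x ^ 2 + y ^ 2) := by rw [hm, hn]; ring
  have hr : m ^ 2 + n ^ 2 ≠ 0 := by rw [er]; exact mul_ne_zero (pow_ne_zero 2 hs0) hτ
  have hν0 : ν ≠ 0 := by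
    rw [hν]
    exact div_ne_zero two_ne_zero (mul_ne_zero (pow_ne_zero 3 hs0) (pow_ne_zero 2 hτ))
  have hR' := hR.transport hr ν 0
  have eh : ∀ q ∈ similarity m n 0 ⁻¹' U,
      ν * (m ^ 2 + n ^ 2) * h (similarity m n 0 q) = -2 := by
    intro q hq
    have : h₀ = -s * (x ^ 2 + y ^ 2) := by rw [hs]; field_simp
    rw [hh _ hq, er, hν, this]
    field_simp
  have halg : transportCoeff m n ν c 4 - transportCoeff m n ν c 1 = 0 ∧
      transportCoeff m n ν c 6 - transportCoeff m n ν c 3 = 0 := by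
    obtain ⟨q, hq⟩ := hR'.isConnected.nonempty
    rw [← hR'.h₁ q hq, ← hR'.h₂ q hq, pd_congr hR'.isOpen eh hq, pd_congr hR'.isOpen eh hq,
      pd_const, pd_const]
    simp
  have ht₁ : transportCoeff m n ν c 0 + transportCoeff m n ν c 6 = 0 := by
    have : transportCoeff m n ν c 0 + transportCoeff m n ν c 6
        = ν * (m ^ 2 + n ^ 2) * (m * x + n * y) := by
      rw [← hx, ← hy]; simp [transportCoeff]; ring
    rw [this, hm, hn]
    ring
  have ht₂ : transportCoeff m n ν c 1 + transportCoeff m n ν c 7 = 2 := by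
    have : transportCoeff m n ν c 1 + transportCoeff m n ν c 7
        = ν * (m ^ 2 + n ^ 2) * (-n * x + m * y) := by
      rw [← hx, ← hy]; simp [transportCoeff]; ring
    rw [this, er, hm, hn, hν]
    field_simp
  have hc' := eq_of_trace_normalized hR'.algebraic halg.1 halg.2 ht₁ ht₂
  refine ⟨m, n, ν, 0, .toda, hr, hν0, hc', eh, ?_⟩
  rw [hc'] at hR'
  exact isNormalOver_toda hR' eh

theorem exists_equivalent_normalForm {S : Data} (hS : S.IsNontrivialSolution) (hc : S.c ≠ 0) :
    ∃ (F : NormalForm) (U : Set Plane) (H₂ : Phase → ℝ),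
      U ⊆ F.domain ∧ (F.toData U H₂).IsNontrivialSolution ∧ Equivalent S (F.toData U H₂) := by
  have hR := Data.reduced_of_solution hS.toIsSolution
  obtain ⟨k₁, hk₁⟩ := Data.H₂_of_solution hS.toIsSolution
  obtain ⟨m, n, ν, e, kind, hr, hν, ec, eh, b, C₁, C₂, k, hD, ef, eV⟩ :
      ∃ (m n ν : ℝ) (e : Plane) (kind : Kind), m ^ 2 + n ^ 2 ≠ 0 ∧ ν ≠ 0 ∧
        transportCoeff m n ν S.c = kindC kind ∧
        (∀ q ∈ similarity m n e ⁻¹' S.U,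
          ν * (m ^ 2 + n ^ 2) * S.h (similarity m n e q) = kindH kind q) ∧
        IsNormalOver (similarity m n e ⁻¹' S.U)
          (fun q => ν * (m ^ 2 + n ^ 2) ^ 3 * S.f (similarity m n e q))
          (fun q => (m ^ 2 + n ^ 2) * S.V (similarity m n e q)) kind := by
    by_cases hg : (S.c 4 - S.c 1) ^ 2 + (S.c 6 - S.c 3) ^ 2 = 0
    · refine exists_normalization_of_gradient_eq_zero hR hS.not_const hc ?_ ?_ <;>
        rw [← sq_eq_zero_iff] <;>
        nlinarith [sq_nonneg (S.c 4 - S.c 1), sq_nonneg (S.c 6 - S.c 3)]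
    · exact exists_normalization_of_gradient_ne_zero hR hS.not_const hg
  have hR' := hR.transport hr ν e
  refine ⟨⟨kind, b, C₁, C₂⟩, _, cubicIntegral _ _ _, hD,
    NormalForm.isNontrivialSolution _ hR'.isOpen hR'.isConnected hD ?_,
    equivalent_of_transport (k₂ := 0) (k := k) hR hr hν rfl ec.symm (fun q hq => ?_) ef eV hk₁
      fun _ _ => (add_zero _).symm⟩
  · rintro ⟨x, hx⟩
    refine not_const_transport (e := e) hr hS.not_const ⟨x - k, fun q hq => ?_⟩
    linarith [eV q hq, hx q hq]
  · rw [eh q hq]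
    exact congrFun (normalForm_h ⟨kind, b, C₁, C₂⟩) q

end BiHam

/-! ### Inequivalence of the four types. -/

namespace BiHam

theorem not_forall_affine_eq {U : Set Plane} (hU : IsOpen U) (hne : U.Nonempty) {x y w : ℝ}
    (h : ∀ q ∈ U, x * q 0 + y * q 1 + w = 0) : x = 0 ∧ y = 0 ∧ w = 0 := by
  obtain ⟨q, hq⟩ := hne
  have g : HasGrad (fun q => x * q 0 + y * q 1 + w) (x * 1 + y * 0 + 0) (x * 0 + y * 1 + 0) q :=
    (((HasGrad.coord_zero.const_mul x).add (HasGrad.coord_one.const_mul y)).add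
      (HasGrad.const w)).of_eq (by ring) (by ring)
  obtain ⟨hx, hy⟩ := g.unique ((HasGrad.const 0).congr_on hU hq h)
  have hx : x = 0 := by linarith
  have hy : y = 0 := by linarith
  have := h q hq
  rw [hx, hy] at this
  exact ⟨hx, hy, by linarith⟩

/-- The transformation of the entry `P'₁₂` and of the trace of `B` under an equivalence. -/
theorem Equivalent.entries {S T : Data} (h : Equivalent S T) :
    ∃ (A : Matrix (Fin 2) (Fin 2) ℝ) (d : Plane) (μ : ℝ), A.det ≠ 0 ∧ μ ≠ 0 ∧
      ∀ q ∈ S.U, ∀ p : Plane,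
        T.h (A *ᵥ q + d) = μ * A.det * S.h q ∧
        (T.c 0 + T.c 6) * ((A 1 1 * p 0 - A 1 0 * p 1) / A.det)
            + (T.c 1 + T.c 7) * ((A 0 0 * p 1 - A 0 1 * p 0) / A.det)
          = μ * ((S.c 0 + S.c 6) * p 0 + (S.c 1 + S.c 7) * p 1) := by
  obtain ⟨A, d, μ, κ, k₁, k₂, hA, hμ, -, -, hz⟩ := h
  have hdet : A.det ≠ 0 := hA.ne_zero
  have hdet' : A 0 0 * A 1 1 - A 0 1 * A 1 0 ≠ 0 := by rwa [← Matrix.det_fin_two]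
  have hinv : (Aᵀ)⁻¹ = !![A 1 1 / A.det, -A 1 0 / A.det; -A 0 1 / A.det, A 0 0 / A.det] := by
    refine Matrix.inv_eq_right_inv ?_
    rw [Matrix.det_fin_two]
    ext i j
    fin_cases i <;> fin_cases j <;> simp [Matrix.mul_apply, Fin.sum_univ_two] <;> field_simp <;>
      ring
  have hpt : ∀ z, pointTransform A d z = join (A *ᵥ position z + d)
      ![(A 1 1 * z 2 - A 1 0 * z 3) / A.det, (A 0 0 * z 3 - A 0 1 * z 2) / A.det] := by
    intro z
    rw [pointTransform, hinv]
    congr 1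
    ext i
    fin_cases i <;> simp [Matrix.mulVec, dotProduct, Fin.sum_univ_two, momentum] <;> ring
  refine ⟨A, d, μ, hdet, hμ, fun q hq p => ?_⟩
  have hmem : join q p ∈ S.phaseDomain := by
    simpa [Data.phaseDomain, position_join] using hq
  have f0 : (fun w => pointTransform A d w 0) = fun w => A 0 0 * w 0 + A 0 1 * w 1 + d 0 := by
    funext w
    rw [hpt]
    simp [join, position]
  have f1 : (fun w => pointTransform A d w 1) = fun w => A 1 0 * w 0 + A 1 1 * w 1 + d 1 := by
    funext w
    rw [hpt]
    simp [join, position]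
  have f2 : (fun w => pointTransform A d w 2) =
      fun w => A 1 1 / A.det * w 2 + -A 1 0 / A.det * w 3 + 0 := by
    funext w
    rw [hpt]
    simp [join]
    ring
  have f3 : (fun w => pointTransform A d w 3) =
      fun w => -A 0 1 / A.det * w 2 + A 0 0 / A.det * w 3 + 0 := by
    funext w
    rw [hpt]
    simp [join]
    ring
  have hJ : jacobian (pointTransform A d) (join q p) =
      !![A 0 0, A 0 1, 0, 0; A 1 0, A 1 1, 0, 0;
        0, 0, A 1 1 / A.det, -A 1 0 / A.det; 0, 0, -A 0 1 / A.det, A 0 0 / A.det] := by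
    ext i j
    rw [jacobian, Matrix.of_apply]
    fin_cases i
    · change grad (fun w => pointTransform A d w 0) _ j = _
      rw [f0, grad_affine_coord]
      fin_cases j <;> simp
    · change grad (fun w => pointTransform A d w 1) _ j = _
      rw [f1, grad_affine_coord]
      fin_cases j <;> simp
    · change grad (fun w => pointTransform A d w 2) _ j = _
      rw [f2, grad_affine_coord]
      fin_cases j <;> simp
    · change grad (fun w => pointTransform A d w 3) _ j = _
      rw [f3, grad_affine_coord]
      fin_cases j <;> simp
  have hP := (hz _ hmem).1
  rw [hJ, hpt, position_join] at hP
  generalize A *ᵥ q + d = Q at hP ⊢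
  have entry : ∀ i j, _ := fun i j => congrFun (congrFun hP i) j
  simp only [Matrix.smul_apply, Matrix.mul_apply, Fin.sum_univ_four, Matrix.transpose_apply,
    smul_eq_mul] at entry
  have e1 := entry 0 1
  have e2 := entry 0 2
  have e3 := entry 1 3
  simp [Data.P', position_join] at e1 e2 e3
  simp [join] at e1 e2 e3
  constructor
  · rw [e1, Matrix.det_fin_two]
    ring
  · have e4 : μ * ((S.c 0 + S.c 6) * p 0 + (S.c 1 + S.c 7) * p 1)
        = μ * ((S.c 0 + S.c 6) * p 0 + (S.c 1 + S.c 7) * p 1)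
          * ((A 0 0 * A 1 1 - A 0 1 * A 1 0) / A.det) := by
      rw [Matrix.det_fin_two, div_self hdet', mul_one]
    rw [e4]
    linear_combination e2 + e3

/-- Constancy of `h` is invariant and singles out Toda. For the other types `h = q 0` on both sides
forces `A 0 1 = 0` and `A 0 0 = μ det A`, which makes the `p₂` coefficient of the trace of `B`
invariant. Its values are `-4 / 3`, `-2` and `2` for Holt and the two Calogero types. -/
theorem kind_eq_of_equivalent {F F' : NormalForm} {U U' : Set Plane} {H₂ H₂' : Phase → ℝ}
    (hU : IsOpen U) (hne : U.Nonempty) (h : Equivalent (F.toData U H₂) (F'.toData U' H₂')) :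
    F.kind = F'.kind := by
  obtain ⟨A, d, μ, hdet, hμ, hA⟩ := h.entries
  have h1 : ∀ q ∈ U, F'.h (A *ᵥ q + d) = μ * A.det * F.h q := fun q hq => (hA q hq 0).1
  have h2 : ∀ p : Plane, (F'.c 0 + F'.c 6) * ((A 1 1 * p 0 - A 1 0 * p 1) / A.det)
      + (F'.c 1 + F'.c 7) * ((A 0 0 * p 1 - A 0 1 * p 0) / A.det)
      = μ * ((F.c 0 + F.c 6) * p 0 + (F.c 1 + F.c 7) * p 1) := by
    obtain ⟨q, hq⟩ := hne
    exact fun p => (hA q hq p).2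
  rw [normalForm_h, normalForm_h] at h1
  rw [normalForm_c, normalForm_c] at h2
  generalize F.kind = K at *
  generalize F'.kind = K' at *
  have hμd : μ * A.det ≠ 0 := mul_ne_zero hμ hdet
  have hboth : ∀ q ∈ U, (A *ᵥ q + d) 0 = A 0 0 * q 0 + A 0 1 * q 1 + d 0 := fun q _ => by
    simp
  have hline : K ≠ .toda → K' ≠ .toda → A 0 1 = 0 ∧ A 0 0 = μ * A.det := by
    intro hK hK'
    have e : ∀ q ∈ U, (A 0 0 - μ * A.det) * q 0 + A 0 1 * q 1 + d 0 = 0 := fun q hq => by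
      have := h1 q hq
      have k1 : kindH K q = q 0 := by cases K <;> simp_all [kindH]
      have k2 : kindH K' (A *ᵥ q + d) = (A *ᵥ q + d) 0 := by cases K' <;> simp_all [kindH]
      rw [k1, k2, hboth q hq] at this
      linarith
    obtain ⟨x, y, -⟩ := not_forall_affine_eq hU hne e
    exact ⟨y, by linarith⟩
  have hconst : K = .toda ↔ K' = .toda := by
    constructor
    · rintro rfl
      by_contra hK'
      have e : ∀ q ∈ U, A 0 0 * q 0 + A 0 1 * q 1 + (d 0 + 2 * (μ * A.det)) = 0 := fun q hq => by
        have := h1 q hq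
        have k2 : kindH K' (A *ᵥ q + d) = (A *ᵥ q + d) 0 := by cases K' <;> simp_all [kindH]
        rw [k2, hboth q hq] at this
        simp only [kindH] at this
        linarith
      obtain ⟨x, y, -⟩ := not_forall_affine_eq hU hne e
      exact hdet (by rw [Matrix.det_fin_two, x, y]; ring)
    · rintro rfl
      by_contra hK
      have e : ∀ q ∈ U, μ * A.det * q 0 + 0 * q 1 + 2 = 0 := fun q hq => by
        have := h1 q hq
        have k1 : kindH K q = q 0 := by cases K <;> simp_all [kindH]
        rw [k1] at this
        simp only [kindH] at this
        linarith
      exact hμd (not_forall_affine_eq hU hne e).1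
  by_cases hK : K = .toda
  · rw [hK, hconst.1 hK]
  · have hK' : K' ≠ .toda := fun h => hK (hconst.2 h)
    obtain ⟨a01, a00⟩ := hline hK hK'
    -- At this momentum the transformed trace picks up the factor `A 0 0 / det A = μ`, which cancels
    -- the `μ` on the other side.
    have e := h2 ![0, 1]
    have t0 : ∀ K : Kind, kindC K 0 + kindC K 6 = 0 := fun K => by
      cases K <;> simp [kindC, NormalForm.c]
    rw [t0, t0, a00] at e
    have et : kindC K' 1 + kindC K' 7 = kindC K 1 + kindC K 7 := by
      simp at e
      rw [mul_div_assoc, div_self hdet, mul_one, mul_comm] at e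
      exact mul_left_cancel₀ hμ e
    cases K <;> cases K' <;> first
      | rfl
      | exact absurd rfl hK
      | exact absurd rfl hK'
      | (exfalso; simp [kindC, NormalForm.c] at et; norm_num at et)

end BiHam

theorem mainTheorem2 :
    -- each of the four families consists of nontrivial solutions with cubic second integrals
    (∀ (F : BiHam.NormalForm) (U : Set BiHam.Plane), IsOpen U → IsConnected U → U ⊆ F.domain →
      (¬ ∃ k : ℝ, ∀ q ∈ U, F.V q = k) →
      ∃ H₂ : BiHam.Phase → ℝ,
        (F.toData U H₂).IsNontrivialSolution ∧ (F.toData U H₂).HasCubicIntegral) ∧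
    -- every nontrivial solution has a cubic second integral and is equivalent to one of these
    (∀ S : BiHam.Data, S.IsNontrivialSolution → S.c ≠ 0 →
      S.HasCubicIntegral ∧
      ∃ (F : BiHam.NormalForm) (U : Set BiHam.Plane) (H₂ : BiHam.Phase → ℝ),
        U ⊆ F.domain ∧ (F.toData U H₂).IsNontrivialSolution ∧
        BiHam.Equivalent S (F.toData U H₂)) ∧
    -- solutions of different types are not equivalent
    (∀ (F F' : BiHam.NormalForm) (U U' : Set BiHam.Plane) (H₂ H₂' : BiHam.Phase → ℝ),
      U ⊆ F.domain → U' ⊆ F'.domain →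
      (F.toData U H₂).IsNontrivialSolution → (F'.toData U' H₂').IsNontrivialSolution →
      BiHam.Equivalent (F.toData U H₂) (F'.toData U' H₂') → F.kind = F'.kind) := by
  refine ⟨fun F U hU hc hD hV => ⟨_, F.isNontrivialSolution hU hc hD hV,
    F.hasCubicIntegral hU hc hD⟩, fun S hS hc => ⟨?_, BiHam.exists_equivalent_normalForm hS hc⟩,
    fun F F' U U' H₂ H₂' _ _ hS _ h =>
      BiHam.kind_eq_of_equivalent hS.isOpen hS.isConnected.nonempty h⟩
  obtain ⟨k, hk⟩ := BiHam.Data.H₂_of_solution hS.toIsSolution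
  exact BiHam.Data.hasCubicIntegral_of_eq
    (BiHam.Data.reduced_of_solution hS.toIsSolution) hc hk
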